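/- Let $C\subset\mathbb P^2$ be a smooth complex plane quartic, let $H$ be the class of a line section of $C$, and let $\eta$ be an even theta characteristic on $C$, i.e. a divisor class with $2\eta\sim H\sim K_C$ and $h^0(C,\eta)$ even. A heptagon is a tuple $P=(L_1,\dots,L_7)$ of lines in $\mathbb P^2$ no three of which meet in a point; let $\mathcal H$ be the set of heptagons and write $\{p_{ij}\}=L_i\cap L_j$. The residual points of $P$ are the $14$ points $p_{ij}$ with $i,j$ not consecutive modulo $7$, and the adjoint quartic $\operatorname{adj}(P)$ is the unique quartic curve through them. Let $\operatorname{adj}^{-1}(C,\eta)$ be the set of heptagons $P$ with adjoint quartic $C$ such that the sum $R$ of the residual points satisfies $R\sim 3H+\eta$ on $C$. Let $S(\eta)=\{(x,y)\in C\times C: h^0(C,\eta+x-y)>0\}$ be the Scorza correspondence, let $S_{ij}=\{x\in C^7:(x_i,x_j)\in S(\eta)\}$, and let $$T_7=S_{12}\cap S_{23}\cap S_{34}\cap S_{45}\cap S_{56}\cap S_{67}\cap S_{17}\subseteq C^7 .$$ Let $I(L_1,\dots,L_7)=(p_{13},p_{46},p_{27},p_{35},p_{16},p_{24},p_{57})$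 for heptagons, and let $J$ be the rational map $J(x_1,\dots,x_7)=(\ell_{15},\ell_{36},\ell_{14},\ell_{26},\ell_{47},\ell_{25},\ell_{37})$ on $(\mathbb P^2)^7$, where $\ell_{ij}$ is the line through $x_i$ and $x_j$; thus $J^{-1}(\mathcal H)$ consists of the $x$ such that $x_i\ne x_j$ for each of these seven pairs $ij$ and $J(x)\in\mathcal H$. Then $I$ restricts to a bijection from $\operatorname{adj}^{-1}(C,\eta)$ onto $T_7\cap J^{-1}(\mathcal H)$ with inverse $J$, and both maps are given locally by polynomials in the homogeneous coordinates, so that $I$ induces an isomorphism between these two sets. In particular, if $T_7\cap J^{-1}(\mathcal H)$ contains at most $336$ isolated points, then there are at most $336$ heptagons in $\operatorname{adj}^{-1}(C,\eta)$ at which the differential of the map $\operatorname{adj}\colon\mathcal H\to|\mathcal O_{\mathbb P^2}(4H)|\cong\mathbb P^{14}$ is nonsingular. -/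

import Mathlib

namespace HeptagonAdjoint

noncomputable section

/-! ### The projective plane, forms and plane curves -/

/-- The complex projective plane. It is also used as the dual plane: the class of `(a, b, c)` is
then the line `a x + b y + c z = 0`, and `Projectivization.orthogonal` is the incidence relation. -/
abbrev P2 : Type := Projectivization ℂ (Fin 3 → ℂ)

/-- The classical topology on the projective plane (quotient topology). -/
instance instTopologicalSpaceP2 : TopologicalSpace P2 :=
  TopologicalSpace.coinduced (Projectivization.mk' ℂ) inferInstance

/-- Polynomials in the three homogeneous coordinates. -/
abbrev Form : Type := MvPolynomial (Fin 3) ℂ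

/-- The homogeneous prime ideal of a point of the plane. A form `G` vanishes at `p` if and only if
`G ∈ pointIdeal p`. -/
def pointIdeal (p : P2) : Ideal Form :=
  MvPolynomial.vanishingIdeal ℂ (p.submodule : Set (Fin 3 → ℂ))

/-- The points of the plane curve `F = 0`. -/
abbrev Curve (F : Form) : Type := {p : P2 // F ∈ pointIdeal p}

/-- The plane curve `F = 0` is smooth: at each of its points some partial derivative of `F` does
not vanish. -/
def IsSmoothCurve (F : Form) : Prop :=
  ∀ p : Curve F, ∃ i : Fin 3, MvPolynomial.pderiv i F ∉ pointIdeal p.1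

/-! ### Divisors on a smooth plane curve -/

/-- The order of vanishing at a point `p` of the smooth curve `F = 0` of (the restriction to the
curve of) a form `G`: the largest `n` such that `G` lies in the `n`-th power of the maximal ideal
of the local ring at `p`. Here "lies in" is written with the denominator `s` cleared, in the
homogeneous coordinate ring `ℂ[x, y, z] / (F)` localized at the prime of `p`.
It is only used for forms `G` that are not divisible by `F`. -/
def ordAt (F : Form) (p : P2) (G : Form) : ℕ :=
  sSup {n : ℕ | ∃ s : Form, s ∉ pointIdeal p ∧ s * G ∈ pointIdeal p ^ n ⊔ Ideal.span {F}}

/-- The group of divisors on the curve `F = 0`. -/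
abbrev Divisor (F : Form) : Type := Curve F →₀ ℤ

/-- The divisor cut out on the curve `F = 0` by a form `G` (as a function on the points). -/
def formDiv (F G : Form) : Curve F → ℤ := fun p => (ordAt F p.1 G : ℤ)

/-- The hyperplane class `H`: the divisor cut out by the line `x = 0`. -/
def lineDiv (F : Form) : Curve F → ℤ := formDiv F (MvPolynomial.X 0)

/-- Linear equivalence on the curve `F = 0`: the difference `D - D'` is the divisor of a nonzero
rational function `A / B`, where `A` and `B` are forms of the same degree. -/
def LinEquiv (F : Form) (D D' : Curve F → ℤ) : Prop :=
  ∃ (d : ℕ) (A B : Form), A.IsHomogeneous d ∧ B.IsHomogeneous d ∧ ¬ F ∣ A ∧ ¬ F ∣ B ∧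
    ∀ p : Curve F, D p - D' p = formDiv F A p - formDiv F B p

/-- The fraction field of the homogeneous coordinate ring of the curve `F = 0`. The rational
functions on the curve are its elements of the form `A / B` with `A`, `B` of the same degree. -/
abbrev FracRing (F : Form) : Type := FractionRing (Form ⧸ Ideal.span {F})

/-- The class of a form in `FracRing F`. -/
def toFrac (F G : Form) : FracRing F :=
  algebraMap (Form ⧸ Ideal.span {F}) (FracRing F) (Ideal.Quotient.mk (Ideal.span {F}) G)

/-- The Riemann-Roch space `H⁰(C, D)`: zero together with the nonzero rational functions `f = A / B`
such that `div f + D` is effective. (These form a linear subspace, so taking the span changes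
nothing.) -/
def rrSpace (F : Form) (D : Curve F → ℤ) : Submodule ℂ (FracRing F) :=
  Submodule.span ℂ {f | ∃ (d : ℕ) (A B : Form), A.IsHomogeneous d ∧ B.IsHomogeneous d ∧
    ¬ F ∣ A ∧ ¬ F ∣ B ∧ f * toFrac F B = toFrac F A ∧
    ∀ p : Curve F, 0 ≤ formDiv F A p - formDiv F B p + D p}

/-- `h⁰(C, D)`. -/
def h0 (F : Form) (D : Curve F → ℤ) : ℕ := Module.finrank ℂ (rrSpace F D)

/-- `η` is a theta characteristic of the plane quartic `F = 0`: twice `η` is the canonical class,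
which on a smooth plane quartic is the class of a line section. -/
def IsThetaChar (F : Form) (η : Divisor F) : Prop :=
  LinEquiv F (fun p => 2 * η p) (lineDiv F)

/-- The Scorza correspondence `S(η) ⊆ C × C`. -/
def scorza (F : Form) (η : Divisor F) : Set (Curve F × Curve F) :=
  {xy | 0 < h0 F (η + Finsupp.single xy.1 1 - Finsupp.single xy.2 1 : Divisor F)}

/-- The pullback `S_ij ⊆ C⁷` of the Scorza correspondence along the projection to the
components `i` and `j`. -/
def scorzaPullback (F : Form) (η : Divisor F) (i j : Fin 7) : Set (Fin 7 → Curve F) :=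
  {x | (x i, x j) ∈ scorza F η}

/-- `T₇ = S₁₂ ∩ S₂₃ ∩ S₃₄ ∩ S₄₅ ∩ S₅₆ ∩ S₆₇ ∩ S₁₇` (the indices `1, …, 7` are written
`0, …, 6`, here and below). -/
def T7 (F : Form) (η : Divisor F) : Set (Fin 7 → Curve F) :=
  scorzaPullback F η 0 1 ∩ scorzaPullback F η 1 2 ∩ scorzaPullback F η 2 3 ∩
    scorzaPullback F η 3 4 ∩ scorzaPullback F η 4 5 ∩ scorzaPullback F η 5 6 ∩
    scorzaPullback F η 0 6

/-! ### Heptagons, residual points and adjoint quartics -/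

/-- The set `ℋ` of heptagons: seven labelled lines, no three of which meet in a point.
(In particular the lines are distinct.) -/
def heptagons : Set (Fin 7 → P2) :=
  {L | ∀ i j k : Fin 7, i ≠ j → i ≠ k → j ≠ k →
    ¬ ∃ p : P2, p.orthogonal (L i) ∧ p.orthogonal (L j) ∧ p.orthogonal (L k)}

/-- The pairs of non-consecutive indices modulo seven, each listed once. -/
def residualPairs : Finset (Fin 7 × Fin 7) :=
  {(0, 2), (0, 3), (0, 4), (0, 5), (1, 3), (1, 4), (1, 5), (1, 6), (2, 4), (2, 5), (2, 6),
    (3, 5), (3, 6), (4, 6)}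

/-- The intersection point `p_ij` of the (distinct) lines `L i` and `L j`. -/
def meet (L : Fin 7 → P2) (i j : Fin 7) : P2 := (L i).cross (L j)

/-- The line `ℓ_ij` joining the (distinct) points `x i` and `x j`. -/
def join (x : Fin 7 → P2) (i j : Fin 7) : P2 := (x i).cross (x j)

/-- The form `G` vanishes at all residual points of the heptagon `L`. -/
def VanishesOnResidual (L : Fin 7 → P2) (G : Form) : Prop :=
  ∀ ij ∈ residualPairs, G ∈ pointIdeal (meet L ij.1 ij.2)

/-- The curve `F = 0` is the adjoint quartic of the heptagon `L`: the unique quartic curve through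
the residual points. -/
def IsAdjointQuartic (L : Fin 7 → P2) (F : Form) : Prop :=
  F.IsHomogeneous 4 ∧ F ≠ 0 ∧ VanishesOnResidual L F ∧
    ∀ G : Form, G.IsHomogeneous 4 → VanishesOnResidual L G → ∃ c : ℂ, G = MvPolynomial.C c * F

/-- The divisor `R` on the curve `F = 0` that is the sum of the residual points of `L` (all of
which lie on the curve if this is the adjoint quartic of `L`). -/
def residualDivisor (F : Form) (L : Fin 7 → P2) : Divisor F :=
  Finsupp.subtypeDomain (fun p : P2 => F ∈ pointIdeal p)
    (∑ ij ∈ residualPairs, Finsupp.single (meet L ij.1 ij.2) (1 : ℤ))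

/-- The fibre `adj⁻¹(C, η)`: the heptagons with adjoint quartic `C` such that `R ∼ 3H + η`. -/
def adjFibre (F : Form) (η : Divisor F) : Set (Fin 7 → P2) :=
  {L | L ∈ heptagons ∧ IsAdjointQuartic L F ∧
    LinEquiv F (residualDivisor F L) (fun p => 3 * lineDiv F p + η p)}

/-- The map `I`, sending a heptagon to its labelled inner residual points
`(p₁₃, p₄₆, p₂₇, p₃₅, p₁₆, p₂₄, p₅₇)`. -/
def innerPoints (L : Fin 7 → P2) : Fin 7 → P2 :=
  ![meet L 0 2, meet L 3 5, meet L 1 6, meet L 2 4, meet L 0 5, meet L 1 3, meet L 4 6]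

/-- The rational map `J`, sending seven points to the lines
`(ℓ₁₅, ℓ₃₆, ℓ₁₄, ℓ₂₆, ℓ₄₇, ℓ₂₅, ℓ₃₇)`. -/
def linesOfPoints (x : Fin 7 → P2) : Fin 7 → P2 :=
  ![join x 0 4, join x 2 5, join x 0 3, join x 1 5, join x 3 6, join x 1 4, join x 2 6]

/-- The domain of definition of the rational map `J`. -/
def linesDomain : Set (Fin 7 → P2) :=
  {x | x 0 ≠ x 4 ∧ x 2 ≠ x 5 ∧ x 0 ≠ x 3 ∧ x 1 ≠ x 5 ∧ x 3 ≠ x 6 ∧ x 1 ≠ x 4 ∧ x 2 ≠ x 6}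

/-- The preimage `J⁻¹(ℋ)` of the set of heptagons under the rational map `J`. -/
def linesPreimage : Set (Fin 7 → P2) :=
  {x | x ∈ linesDomain ∧ linesOfPoints x ∈ heptagons}

/-- The set `T₇ ∩ J⁻¹(ℋ)`, as a subset of `(ℙ²)⁷ ⊇ C⁷`. -/
def scorzaHeptagons (F : Form) (η : Divisor F) : Set (Fin 7 → P2) :=
  {x | ∃ y ∈ T7 F η, ∀ i, (y i : P2) = x i} ∩ linesPreimage

/-! ### Morphisms, isolated points and the differential of the adjoint map -/

/-- The seven vectors `v` are homogeneous coordinates of the seven points (or lines) `x`. -/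
def IsLift (v : Fin 7 → Fin 3 → ℂ) (x : Fin 7 → P2) : Prop :=
  ∀ i, ∃ hi : v i ≠ 0, Projectivization.mk ℂ (v i) hi = x i

/-- The vector of values of three polynomials in the homogeneous coordinates of seven points. -/
def evalTriple (q : Fin 3 → MvPolynomial (Fin 7 × Fin 3) ℂ) (v : Fin 7 → Fin 3 → ℂ) : Fin 3 → ℂ :=
  fun a => MvPolynomial.eval (fun ij : Fin 7 × Fin 3 => v ij.1 ij.2) (q a)

/-- On the subset `X` of `(ℙ²)⁷` the map `f` is a morphism to `(ℙ²)⁷`: Zariski locally on `X` (where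
`q` does not vanish), each component of `f` is given by three polynomials `q` in the homogeneous
coordinates. -/
def IsMorphismOn (X : Set (Fin 7 → P2)) (f : (Fin 7 → P2) → (Fin 7 → P2)) : Prop :=
  ∀ x ∈ X, ∀ k : Fin 7, ∃ q : Fin 3 → MvPolynomial (Fin 7 × Fin 3) ℂ,
    (∀ v, IsLift v x → evalTriple q v ≠ 0) ∧
    ∀ y ∈ X, ∀ v, IsLift v y → ∀ hq : evalTriple q v ≠ 0,
      f y k = Projectivization.mk ℂ (evalTriple q v) hq

/-- The isolated points of a set. -/
def isolatedPoints {X : Type*} [TopologicalSpace X] (S : Set X) : Set X :=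
  {x | ∃ U : Set X, IsOpen U ∧ U ∩ S = {x}}

/-- The differential of the adjoint map `adj : ℋ → |𝒪(4H)|` is nonsingular at the heptagon `L`.
In homogeneous coordinates: `adj` has near a lift `v` of `L` a lift `Φ` to quartic forms that has a
derivative `dΦ` at `v` (coefficient by coefficient), and the induced map between the tangent spaces
`∏ᵢ ℂ³ / ℂ vᵢ` and `ℂ[x, y, z]₄ / ℂ Φ(v)`, both of dimension `14`, is injective. -/
def AdjDifferentialNonsingular (L : Fin 7 → P2) : Prop :=
  ∃ (v : Fin 7 → Fin 3 → ℂ) (Φ : (Fin 7 → Fin 3 → ℂ) → Form)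
    (dΦ : (Fin 7 → Fin 3 → ℂ) →ₗ[ℂ] Form), IsLift v L ∧
    (∀ᶠ w in nhds v, ∃ M : Fin 7 → P2, IsLift w M ∧ IsAdjointQuartic M (Φ w)) ∧
    (∀ m : Fin 3 →₀ ℕ, HasFDerivAt (fun w => (Φ w).coeff m)
      (LinearMap.toContinuousLinearMap (MvPolynomial.lcoeff ℂ m ∘ₗ dΦ)) v) ∧
    ∀ u : Fin 7 → Fin 3 → ℂ, (∃ c : ℂ, dΦ u = MvPolynomial.C c * Φ v) →
      ∀ i, ∃ a : ℂ, u i = a • v i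

end

end HeptagonAdjoint

open HeptagonAdjoint

namespace HeptagonAdjoint

open MvPolynomial Topology Filter

/-! ### Points, lines and their ideals -/

/-! Write `x_k = p_{3k,3k+2}` for the inner points and `z_k = p_{3k+3,3k+6}` for the other seven
residual points, with indices modulo 7. On a line of the heptagon there are four distinct residual
points, and by Bézout they are its whole intersection with `C` (`formDiv_lineForm`). Adding up the
three consecutive lines `L_{3k}, L_{3k+1}, L_{3k+2}` gives `3H ∼ R + x_k - x_{k+1} - x_{k-1} - z_k`
(`sum_three_lines`). Hence, for each single `k`, `R ∼ 3H + η` says the same as `η + x_k ∼ x_{k+1} +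
x_{k-1} + z_k` (`linEquiv_iff_isEff`). In particular neighbouring inner points of a heptagon in the
fibre are in Scorza correspondence.

For the converse, let `x` be in `T₇` with `J(x) = L` a heptagon. An effective theta characteristic
on a smooth plane quartic has `h⁰ = 1`, so an even one is not effective (`not_isEff_of_even`), and
therefore `η + x_k` is equivalent to at most one effective divisor (`isEff_unique`). Both neighbours
of `x_k` lie in it, so it is `x_{k+1} + x_{k-1} + z_k` for some point `z_k` of `C`. Then `x_{k-1} +
z_k ∼ η + x_k - x_{k+1}` and `x_{k+2} + z_{k+1} ∼ η + x_{k+1} - x_k` have sum of class `2η ∼ H`, and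
this sum is cut out by a line (`scorza_line`). That line joins `x_{k-1}` and `x_{k+2}`, so it is
`L_{3k+6}`. Thus `z_k` lies on `L_{3k+3}` and on `L_{3k+6}`, and all 14 residual points are on `C`.
This makes `C` the adjoint quartic (`isAdjointQuartic_of_vanishes`), and the equivalence at `k = 0`
gives the class of `R`.

The divisor theory rests on three facts about the curve: its local rings are discrete valuation
rings with linear uniformizers (`exists_localRing`), Noether's theorem holds
(`IsSmoothQuartic.noether`), and a dimension count gives Bézout (`IsSmoothQuartic.card_mdiv`). For
the bound, a nonsingular differential isolates a heptagon among all those with the same adjoint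
quartic. Continuity of `J` carries the isolation over to the inner points, and `I` is injective. -/

/-- An ideal modulo which an endomorphism `σ` killing the ideal is the identity is the kernel
of `σ`. -/
theorem ker_eq_of_sub_mem (I : Ideal Form) (σ : Form →ₐ[ℂ] Form)
    (hI : ∀ G ∈ I, σ G = 0) (hX : ∀ j, σ (X j) - X j ∈ I) : I = RingHom.ker σ := by
  refine le_antisymm (fun G hG => hI G hG) fun G hG => ?_
  have h : (Ideal.Quotient.mkₐ ℂ I).comp σ = Ideal.Quotient.mkₐ ℂ I := by
    refine MvPolynomial.algHom_ext fun j => ?_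
    simpa using (Ideal.Quotient.mk_eq_mk_iff_sub_mem _ _).2 (hX j)
  have h' := DFunLike.congr_fun h G
  rw [AlgHom.comp_apply, (show σ G = 0 from hG), map_zero] at h'
  exact Ideal.Quotient.eq_zero_iff_mem.1 h'.symm

theorem mem_pointIdeal_iff (v : Fin 3 → ℂ) (hv : v ≠ 0) (G : Form) :
    G ∈ pointIdeal (Projectivization.mk ℂ v hv) ↔ ∀ c : ℂ, eval (c • v) G = 0 := by
  unfold pointIdeal
  rw [mem_vanishingIdeal_iff]
  simp only [Projectivization.submodule_mk, SetLike.mem_coe, Submodule.mem_span_singleton,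
    forall_exists_index, forall_apply_eq_imp_iff, MvPolynomial.aeval_eq_eval]

theorem eval_smul_of_isHomogeneous {G : Form} {d : ℕ} (hG : G.IsHomogeneous d) (c : ℂ)
    (v : Fin 3 → ℂ) : eval (c • v) G = c ^ d * eval v G := by
  rw [eval_eq, eval_eq, Finset.mul_sum]
  refine Finset.sum_congr rfl fun m hm => ?_
  have : m.degree = d := by
    by_contra h
    exact (mem_support_iff.1 hm) (hG.coeff_eq_zero h)
  simp only [Pi.smul_apply, smul_eq_mul, mul_pow, Finset.prod_mul_distrib,
    Finset.prod_pow_eq_pow_sum]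
  rw [← this, Finsupp.degree_apply]
  ring

theorem mem_pointIdeal_iff_eval (v : Fin 3 → ℂ) (hv : v ≠ 0) {G : Form} {d : ℕ}
    (hG : G.IsHomogeneous d) :
    G ∈ pointIdeal (Projectivization.mk ℂ v hv) ↔ eval v G = 0 := by
  rw [mem_pointIdeal_iff]
  refine ⟨fun h => by simpa using h 1, fun h c => ?_⟩
  rw [eval_smul_of_isHomogeneous hG, h, mul_zero]

/-- The substitution projecting onto the line through `v`. -/
noncomputable def subPoint (v : Fin 3 → ℂ) (k : Fin 3) : Form →ₐ[ℂ] Form :=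
  aeval fun j => C (v j / v k) * X k

theorem eval_subPoint (v w : Fin 3 → ℂ) (k : Fin 3) (G : Form) :
    eval w (subPoint v k G) = eval ((w k / v k) • v) G := by
  have : (aeval w : Form →ₐ[ℂ] ℂ).comp (subPoint v k) =
      (aeval ((w k / v k) • v) : Form →ₐ[ℂ] ℂ) := by
    refine MvPolynomial.algHom_ext fun j => ?_
    simp [subPoint]; ring
  have := DFunLike.congr_fun this G
  simpa [MvPolynomial.aeval_eq_eval] using this

/-- The substitution restricts a polynomial to the line spanned by `v`, with `X k` as parameter.
Being the kernel of a map into a domain, the ideal of a point is then prime. -/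
theorem mem_pointIdeal_iff_subPoint (v : Fin 3 → ℂ) (hv : v ≠ 0) {k : Fin 3} (hk : v k ≠ 0)
    (G : Form) : G ∈ pointIdeal (Projectivization.mk ℂ v hv) ↔ subPoint v k G = 0 := by
  rw [mem_pointIdeal_iff]
  constructor
  · intro h
    refine MvPolynomial.funext fun w => ?_
    rw [eval_subPoint, h, map_zero]
  · intro h c
    have := eval_subPoint v (c • v) k G
    rw [h, map_zero] at this
    rw [this]
    simp [hk]

theorem pointIdeal_isPrime (p : P2) : (pointIdeal p).IsPrime := by
  induction p using Projectivization.ind with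
  | h v hv =>
    obtain ⟨k, hk⟩ := Function.ne_iff.1 hv
    have : pointIdeal (Projectivization.mk ℂ v hv) = RingHom.ker (subPoint v k) := by
      ext G
      rw [mem_pointIdeal_iff_subPoint v hv hk]
      rfl
    rw [this]
    exact RingHom.ker_isPrime _

instance (p : P2) : (pointIdeal p).IsPrime := pointIdeal_isPrime p

/-- The linear form with coefficient vector `a`. -/
noncomputable def linForm (a : Fin 3 → ℂ) : Form := ∑ i, C (a i) * X i

theorem linForm_isHomogeneous (a : Fin 3 → ℂ) : (linForm a).IsHomogeneous 1 :=
  IsHomogeneous.sum _ _ _ fun i _ => isHomogeneous_C_mul_X (a i) i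

@[simp] theorem eval_linForm (a v : Fin 3 → ℂ) : eval v (linForm a) = a ⬝ᵥ v := by
  simp [linForm, dotProduct]

theorem linForm_add (a b : Fin 3 → ℂ) : linForm (a + b) = linForm a + linForm b := by
  simp [linForm, add_mul, Finset.sum_add_distrib]

theorem linForm_smul (c : ℂ) (a : Fin 3 → ℂ) : linForm (c • a) = C c * linForm a := by
  simp [linForm, Finset.mul_sum, mul_assoc]

theorem coeff_linForm (a : Fin 3 → ℂ) (i : Fin 3) :
    (linForm a).coeff (Finsupp.single i 1) = a i := by
  simp [linForm, coeff_sum, coeff_C_mul, coeff_X, Finsupp.single_left_inj]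

theorem linForm_injective : Function.Injective linForm := fun a b h => by
  ext i
  rw [← coeff_linForm a, h, coeff_linForm]

theorem linForm_ne_zero {a : Fin 3 → ℂ} (ha : a ≠ 0) : linForm a ≠ 0 := fun h =>
  ha (linForm_injective (by simpa [linForm] using h))

theorem exists_eq_linForm {G : Form} (hG : G.IsHomogeneous 1) : ∃ a, G = linForm a := by
  have : G ∈ Submodule.span ℂ (Set.range (X : Fin 3 → Form)) := by
    rw [← homogeneousSubmodule_one_eq_span_X]
    exact hG
  obtain ⟨a, ha⟩ := (Submodule.mem_span_range_iff_exists_fun ℂ).1 this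
  exact ⟨a, by rw [← ha]; simp [linForm, smul_eq_C_mul]⟩

theorem linForm_mem_pointIdeal_mk (a v : Fin 3 → ℂ) (hv : v ≠ 0) :
    linForm a ∈ pointIdeal (Projectivization.mk ℂ v hv) ↔ a ⬝ᵥ v = 0 := by
  rw [mem_pointIdeal_iff_eval v hv (linForm_isHomogeneous a), eval_linForm]

theorem linForm_mem_pointIdeal_iff (a : Fin 3 → ℂ) (ha : a ≠ 0) (p : P2) :
    linForm a ∈ pointIdeal p ↔ p.orthogonal (Projectivization.mk ℂ a ha) := by
  induction p using Projectivization.ind with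
  | h v hv =>
    rw [linForm_mem_pointIdeal_mk, Projectivization.orthogonal_mk, dotProduct_comm]

/-- Every nonzero linear form is prime. -/
theorem linForm_prime {a : Fin 3 → ℂ} (ha : a ≠ 0) : Prime (linForm a) := by
  obtain ⟨k, hk⟩ := Function.ne_iff.1 ha
  simp only [Pi.zero_apply, ne_eq] at hk
  -- `σ` eliminates `X k` by solving `linForm a = 0` for it, so its kernel is generated by `linForm
  -- a`.
  let σ : Form →ₐ[ℂ] Form := aeval fun j =>
    if j = k then X k - C (a k)⁻¹ * linForm a else X j
  have hσ : σ (linForm a) = 0 := by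
    have h1 : linForm a = C (a k) * X k + ∑ i ∈ Finset.univ.erase k, C (a i) * X i := by
      exact (Finset.add_sum_erase _ (fun i => C (a i) * X i) (Finset.mem_univ k)).symm
    have h2 : σ (linForm a) = C (a k) * (X k - C (a k)⁻¹ * linForm a)
        + ∑ i ∈ Finset.univ.erase k, C (a i) * X i := by
      conv_lhs => rw [h1]
      rw [map_add, map_sum, map_mul]
      congr 1
      · simp [σ, MvPolynomial.algebraMap_eq]
      · refine Finset.sum_congr rfl fun i hi => ?_
        simp [σ, MvPolynomial.algebraMap_eq, (Finset.mem_erase.1 hi).1]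
    rw [h2, mul_sub, ← mul_assoc, ← C_mul, mul_inv_cancel₀ hk, C_1, one_mul]
    rw [h1]
    ring
  have hker : Ideal.span {linForm a} = RingHom.ker σ := by
    refine ker_eq_of_sub_mem _ _ ?_ fun j => ?_
    · intro G hG
      obtain ⟨c, rfl⟩ := Ideal.mem_span_singleton.1 hG
      rw [map_mul, hσ, zero_mul]
    · by_cases hj : j = k
      · subst hj
        simp only [σ, aeval_X, if_true]
        rw [Ideal.mem_span_singleton]
        exact ⟨-C (a j)⁻¹, by ring⟩
      · simp [σ, hj]
  rw [← Ideal.span_singleton_prime (linForm_ne_zero ha), hker]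
  exact RingHom.ker_isPrime _

/-- The ideal of a point is generated by two linear forms. -/
theorem exists_pointIdeal_eq_span (p : P2) : ∃ a b : Fin 3 → ℂ, LinearIndependent ℂ ![a, b] ∧
    pointIdeal p = Ideal.span {linForm a, linForm b} := by
  induction p using Projectivization.ind with
  | h v hv =>
    obtain ⟨k, hk⟩ := Function.ne_iff.1 hv
    simp only [Pi.zero_apply, ne_eq] at hk
    obtain ⟨i, j, hij, hik, hjk, hall⟩ : ∃ i j : Fin 3, i ≠ j ∧ i ≠ k ∧ j ≠ k ∧
        ∀ l, l = i ∨ l = j ∨ l = k := by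
      clear hk; revert k; decide
    -- The minors `v_k X_l - v_l X_k` against a nonzero coordinate `v_k`; the one with `l = k` is
    -- zero, which leaves two generators.
    let f : Fin 3 → Fin 3 → ℂ := fun l => v k • Pi.single l 1 - v l • Pi.single k 1
    have hf : ∀ l, linForm (f l) = C (v k) * X l - C (v l) * X k := fun l => by
      have hs : ∀ m : Fin 3, linForm (Pi.single m 1) = X m := fun m => by
        simp [linForm, Pi.single_apply, ite_mul]
      rw [show f l = v k • Pi.single l 1 + (-v l) • Pi.single k 1 by simp [f, sub_eq_add_neg],
        linForm_add, linForm_smul, linForm_smul, hs, hs, map_neg]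
      ring
    refine ⟨f i, f j, ?_, ?_⟩
    · rw [LinearIndependent.pair_iff]
      intro s t hst
      have h1 := congrFun hst i
      have h2 := congrFun hst j
      simp [f, hij, hij.symm, hik, hjk, hk] at h1 h2
      exact ⟨h1, h2⟩
    · have hker : Ideal.span {linForm (f i), linForm (f j)} = RingHom.ker (subPoint v k) := by
        have hm : ∀ l, linForm (f l) ∈ Ideal.span {linForm (f i), linForm (f j)} := by
          intro l
          rcases hall l with rfl | rfl | rfl
          · exact Ideal.subset_span (by simp)
          · exact Ideal.subset_span (by simp)
          · rw [show linForm (f l) = 0 by rw [hf, sub_self]]; exact zero_mem _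
        refine ker_eq_of_sub_mem _ _ ?_ fun l => ?_
        · have hz : ∀ l, subPoint v k (linForm (f l)) = 0 := fun l => by
            rw [hf]
            simp only [subPoint, map_sub, map_mul, aeval_X, algHom_C, MvPolynomial.algebraMap_eq]
            rw [← mul_assoc, ← mul_assoc, ← C_mul, ← C_mul, mul_div_cancel₀ _ hk,
              div_self hk, mul_one, sub_self]
          intro G hG
          have : Ideal.span {linForm (f i), linForm (f j)} ≤ RingHom.ker (subPoint v k) := by
            rw [Ideal.span_le]
            rintro _ (rfl | rfl)
            · exact hz i
            · exact hz j
          exact this hG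
        · have : subPoint v k (X l) - X l = C (-(v k)⁻¹) * linForm (f l) := by
            rw [hf, mul_sub, ← mul_assoc, ← mul_assoc, ← C_mul, ← C_mul]
            simp only [subPoint, aeval_X, neg_mul, inv_mul_cancel₀ hk, C_neg, C_1]
            rw [div_eq_inv_mul]
            ring
          rw [this]
          exact Ideal.mul_mem_left _ _ (hm l)
      ext G
      rw [mem_pointIdeal_iff_subPoint v hv hk, hker]
      rfl

theorem exists_X_notMem_pointIdeal (p : P2) : ∃ i : Fin 3, (X i : Form) ∉ pointIdeal p := by
  induction p using Projectivization.ind with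
  | h v hv =>
    obtain ⟨k, hk⟩ := Function.ne_iff.1 hv
    refine ⟨k, fun h => hk ?_⟩
    rw [mem_pointIdeal_iff_eval v hv (isHomogeneous_X _ k)] at h
    simpa using h

/-- Distinct points are separated by linear forms. -/
theorem exists_linForm_separating {p q : P2} (h : p ≠ q) :
    ∃ a, linForm a ∈ pointIdeal p ∧ linForm a ∉ pointIdeal q := by
  induction p using Projectivization.ind with
  | h v hv =>
    induction q using Projectivization.ind with
    | h w hw =>
      by_contra! hcon
      simp only [linForm_mem_pointIdeal_mk] at hcon
      have h0 : crossProduct v w ≠ 0 := fun h0 =>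
        h ((Projectivization.mk_eq_mk_iff_crossProduct_eq_zero hv hw).2 h0)
      apply h0
      ext i
      -- The forms with coefficients `v × e_i` all vanish at `v`. If they vanish at `w` too, every
      -- coordinate of `v × w` is zero.
      have := hcon (crossProduct v (Pi.single i 1)) (by
        rw [dotProduct_comm, dot_self_cross])
      rw [dotProduct_comm, triple_product_permutation, triple_product_permutation] at this
      rw [← cross_anticomm]
      simpa [single_dotProduct] using this

theorem pointIdeal_injective : Function.Injective pointIdeal := fun p q h => by
  by_contra hne
  obtain ⟨a, h1, h2⟩ := exists_linForm_separating hne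
  exact h2 (h ▸ h1)

/-- A line through two distinct points is unique. -/
theorem linForm_proportional_of_two_points {p q : P2} (h : p ≠ q) {a b : Fin 3 → ℂ}
    (ha : a ≠ 0) (hap : linForm a ∈ pointIdeal p) (haq : linForm a ∈ pointIdeal q)
    (hbp : linForm b ∈ pointIdeal p) (hbq : linForm b ∈ pointIdeal q) :
    ∃ c : ℂ, b = c • a := by
  by_contra hcon
  have hli : LinearIndependent ℂ ![a, b] := by
    rw [LinearIndependent.pair_iff' ha]
    intro c hc
    exact hcon ⟨c, hc.symm⟩
  rw [← crossProduct_ne_zero_iff_linearIndependent] at hli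
  apply h
  have key : ∀ r : P2, linForm a ∈ pointIdeal r → linForm b ∈ pointIdeal r →
      r = Projectivization.mk ℂ _ hli := by
    intro r hra hrb
    induction r using Projectivization.ind with
    | h v hv =>
      rw [linForm_mem_pointIdeal_mk] at hra hrb
      rw [Projectivization.mk_eq_mk_iff_crossProduct_eq_zero, cross_cross_eq_smul_sub_smul']
      rw [dotProduct_comm] at hrb
      simp [hra, hrb]
  rw [key p hap hbp, key q haq hbq]

/-! ### Irreducibility of smooth quartics -/

theorem homogeneousComponent_mul_right {A : Form} {a : ℕ} (hA : A.IsHomogeneous a) (s : Form)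
    (k : ℕ) : homogeneousComponent (k + a) (s * A) = homogeneousComponent k s * A := by
  classical
  let 𝒜 := homogeneousSubmodule (Fin 3) ℂ
  let _ : GradedAlgebra 𝒜 := MvPolynomial.gradedAlgebra
  have h := DirectSum.coe_decompose_mul_add_of_right_mem 𝒜 (i := k) (j := a) (a := s) (b := A) hA
  have e : ∀ (G : Form) (n : ℕ), ((DirectSum.decompose 𝒜 G) n : Form) = homogeneousComponent n G :=
    fun G n => decomposition.decompose'_apply G n
  rwa [e, e] at h

theorem homogeneousComponent_mul_right_of_lt {A : Form} {a : ℕ} (hA : A.IsHomogeneous a)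
    (s : Form) {n : ℕ} (hn : n < a) : homogeneousComponent n (s * A) = 0 := by
  classical
  let 𝒜 := homogeneousSubmodule (Fin 3) ℂ
  let _ : GradedAlgebra 𝒜 := MvPolynomial.gradedAlgebra
  have h := DirectSum.coe_decompose_mul_of_right_mem_of_not_le 𝒜 (a := s) (b_mem := hA)
    (not_le.2 hn)
  have e : ∀ (G : Form) (n : ℕ), ((DirectSum.decompose 𝒜 G) n : Form) = homogeneousComponent n G :=
    fun G n => decomposition.decompose'_apply G n
  rwa [e] at h

theorem exists_homogeneousComponent_notMem {I : Ideal Form} {s : Form} (hs : s ∉ I) :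
    ∃ k, homogeneousComponent k s ∉ I := by
  by_contra! h
  apply hs
  rw [← sum_homogeneousComponent s]
  exact sum_mem fun i _ => h i

/-- The substitution `X i ↦ X i * T`. -/
noncomputable def scaleHom : Form →ₐ[ℂ] Polynomial Form :=
  aeval fun i => Polynomial.C (X i) * Polynomial.X

theorem scaleHom_monomial (m : Fin 3 →₀ ℕ) (c : ℂ) :
    scaleHom (monomial m c) = Polynomial.monomial m.degree (monomial m c) := by
  have h : (m.prod fun i k => (Polynomial.C (X i : Form) * Polynomial.X) ^ k) =
      Polynomial.C (m.prod fun i k => (X i : Form) ^ k) * Polynomial.X ^ m.degree := by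
    simp only [Finsupp.prod, mul_pow, Finset.prod_mul_distrib, map_prod, map_pow,
      Finset.prod_pow_eq_pow_sum, Finsupp.degree_apply]
  rw [scaleHom, aeval_monomial, h, ← Polynomial.C_mul_X_pow_eq_monomial, monomial_eq,
    Polynomial.C_mul, mul_assoc]
  rfl

theorem coeff_scaleHom (G : Form) (n : ℕ) :
    (scaleHom G).coeff n = homogeneousComponent n G := by
  induction G using MvPolynomial.induction_on' with
  | monomial m c =>
    rw [scaleHom_monomial, Polynomial.coeff_monomial]
    split_ifs with h
    · rw [homogeneousComponent_of_mem (isHomogeneous_monomial c h), if_pos rfl]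
    · rw [homogeneousComponent_of_mem (isHomogeneous_monomial c rfl), if_neg (Ne.symm h)]
  | add p q hp hq => rw [map_add, Polynomial.coeff_add, hp, hq, map_add]

/-- The factors of a homogeneous polynomial are homogeneous. -/
theorem isHomogeneous_of_mul {A B : Form} {d : ℕ} (hAB : (A * B).IsHomogeneous d)
    (h0 : A * B ≠ 0) : ∃ a b, a + b = d ∧ A.IsHomogeneous a ∧ B.IsHomogeneous b := by
  obtain ⟨φ, hφ_def⟩ : ∃ φ, φ = scaleHom := ⟨_, rfl⟩
  have hcoeff : ∀ (G : Form) (n : ℕ), (φ G).coeff n = homogeneousComponent n G := by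
    rw [hφ_def]; exact coeff_scaleHom
  have hinj : ∀ G, φ G = 0 → G = 0 := by
    intro G hG
    rw [← sum_homogeneousComponent G]
    exact Finset.sum_eq_zero fun i _ => by rw [← hcoeff, hG, Polynomial.coeff_zero]
  have hA0 : φ A ≠ 0 := fun h => h0 (by rw [hinj A h, zero_mul])
  have hB0 : φ B ≠ 0 := fun h => h0 (by rw [hinj B h, mul_zero])
  -- As a polynomial in `T` the product is a monomial. Degree and trailing degree are both additive,
  -- so they must agree for each factor.
  have hφ : φ (A * B) = Polynomial.monomial d (A * B) := by
    ext1 n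
    rw [hcoeff, homogeneousComponent_of_mem hAB, Polynomial.coeff_monomial]
    simp [eq_comm]
  have h1 : (φ A).natDegree + (φ B).natDegree = d := by
    rw [← Polynomial.natDegree_mul hA0 hB0, ← map_mul, hφ, Polynomial.natDegree_monomial_eq _ h0]
  have h2 : (φ A).natTrailingDegree + (φ B).natTrailingDegree = d := by
    rw [← Polynomial.natTrailingDegree_mul hA0 hB0, ← map_mul, hφ,
      Polynomial.natTrailingDegree_monomial h0]
  have h3 := Polynomial.natTrailingDegree_le_natDegree (φ A)
  have h4 := Polynomial.natTrailingDegree_le_natDegree (φ B)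
  have key : ∀ G : Form, (φ G).natTrailingDegree = (φ G).natDegree →
      G.IsHomogeneous (φ G).natDegree := by
    intro G hG
    have : G = homogeneousComponent (φ G).natDegree G := by
      conv_lhs => rw [← sum_homogeneousComponent G]
      by_cases hmem : (φ G).natDegree ∈ Finset.range (G.totalDegree + 1)
      · refine Finset.sum_eq_single_of_mem _ hmem fun i _ hi => ?_
        rw [← hcoeff]
        rcases lt_or_gt_of_ne hi with h | h
        · exact Polynomial.coeff_eq_zero_of_lt_natTrailingDegree (hG ▸ h)
        · exact Polynomial.coeff_eq_zero_of_natDegree_lt h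
      · rw [Finset.mem_range, not_lt] at hmem
        rw [homogeneousComponent_eq_zero _ _ (by lia)]
        refine Finset.sum_eq_zero fun i hi => ?_
        rw [← hcoeff]
        exact Polynomial.coeff_eq_zero_of_lt_natTrailingDegree
          (by rw [hG]; exact (Finset.mem_range.1 hi).trans_le hmem)
    have h := homogeneousComponent_isHomogeneous (φ G).natDegree G
    rwa [← this] at h
  exact ⟨_, _, h1, key A (by lia), key B (by lia)⟩

theorem isUnit_of_isHomogeneous_zero {A : Form} (hA : A.IsHomogeneous 0) (h0 : A ≠ 0) :
    IsUnit A := by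
  obtain ⟨c, rfl⟩ : ∃ c : ℂ, A = C c :=
    ⟨coeff 0 A, (totalDegree_eq_zero_iff_eq_C (p := A)).1
      ((totalDegree_zero_iff_isHomogeneous (Fin 3)).2 hA)⟩
  exact IsUnit.map (C : ℂ →+* Form) (isUnit_iff_ne_zero.2 fun h => h0 (by rw [h, C_0]))

/-- The chain is zero, a linear form, the ideal of a point, `M`. Against Krull's bound of 2 for two
generators it yields a common zero other than the origin. -/
theorem height_vars_ge_three (M : Ideal Form) [M.IsPrime] (hM : ∀ i, X i ∈ M) :
    3 ≤ M.height := by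
  obtain ⟨a, b, hab, hp⟩ := exists_pointIdeal_eq_span
    (Projectivization.mk ℂ (Pi.single 0 1 : Fin 3 → ℂ) (by simp))
  set P := pointIdeal (Projectivization.mk ℂ (Pi.single 0 1 : Fin 3 → ℂ) (by simp))
  have ha : a ≠ 0 := hab.ne_zero 0
  have hlin : ∀ c, linForm c ∈ M := fun c => sum_mem fun i _ => Ideal.mul_mem_left _ _ (hM i)
  have : (Ideal.span {linForm a}).IsPrime :=
    (Ideal.span_singleton_prime (linForm_ne_zero ha)).2 (linForm_prime ha)
  have h1 : (⊥ : Ideal Form) < Ideal.span {linForm a} := by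
    rw [bot_lt_iff_ne_bot, Ne, Ideal.span_singleton_eq_bot]
    exact linForm_ne_zero ha
  have h2 : Ideal.span {linForm a} < P := by
    refine lt_of_le_of_ne (by rw [hp]; exact Ideal.span_mono (by simp)) fun h => ?_
    have hb : linForm b ∈ Ideal.span {linForm a} := by
      rw [h, hp]; exact Ideal.subset_span (by simp)
    obtain ⟨c, hc⟩ := Ideal.mem_span_singleton.1 hb
    have hb0 : linForm b ≠ 0 := linForm_ne_zero (hab.ne_zero 1)
    obtain ⟨i, j, hij, hi, hj⟩ := isHomogeneous_of_mul (hc ▸ linForm_isHomogeneous b)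
      (hc ▸ hb0)
    have hi1 := hi.inj_right (linForm_isHomogeneous a) (linForm_ne_zero ha)
    obtain rfl : j = 0 := by lia
    obtain ⟨e, rfl⟩ : ∃ e : ℂ, c = C e :=
      ⟨coeff 0 c, (totalDegree_eq_zero_iff_eq_C (p := c)).1
        ((totalDegree_zero_iff_isHomogeneous (Fin 3)).2 hj)⟩
    rw [mul_comm, ← linForm_smul] at hc
    exact (LinearIndependent.pair_iff' ha).1 hab e (linForm_injective hc).symm
  have h3 : P < M := by
    refine lt_of_le_of_ne ?_ fun h => ?_
    · rw [hp, Ideal.span_le]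
      rintro _ (rfl | rfl) <;> exact hlin _
    · obtain ⟨i, hi⟩ := exists_X_notMem_pointIdeal
        (Projectivization.mk ℂ (Pi.single 0 1 : Fin 3 → ℂ) (by simp))
      exact hi (by rw [show pointIdeal _ = M from h]; exact hM i)
  have e1 := Ideal.height_add_one_le_of_lt_of_isPrime h1
  have e2 := Ideal.height_add_one_le_of_lt_of_isPrime h2
  have e3 := Ideal.height_add_one_le_of_lt_of_isPrime h3
  calc (3 : ℕ∞) = 0 + 1 + 1 + 1 := by norm_num
    _ ≤ (⊥ : Ideal Form).height + 1 + 1 + 1 := by gcongr; exact zero_le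
    _ ≤ (Ideal.span {linForm a}).height + 1 + 1 := by gcongr
    _ ≤ P.height + 1 := by gcongr
    _ ≤ _ := e3

/-- Two plane curves have a common point. -/
theorem exists_common_zero {A B : Form} {a b : ℕ} (hA : A.IsHomogeneous a)
    (hB : B.IsHomogeneous b) (ha : a ≠ 0) (hb : b ≠ 0) :
    ∃ p : P2, A ∈ pointIdeal p ∧ B ∈ pointIdeal p := by
  have hz : ∀ {G : Form} {d : ℕ}, G.IsHomogeneous d → d ≠ 0 → eval (0 : Fin 3 → ℂ) G = 0 := by
    intro G d hG hd
    have := eval_smul_of_isHomogeneous hG 0 0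
    rw [zero_smul, zero_pow hd, zero_mul] at this
    exact this
  have hle : Ideal.span {A, B} ≤ vanishingIdeal ℂ {(0 : Fin 3 → ℂ)} := by
    rw [Ideal.span_le]
    rintro _ (rfl | rfl)
    · simpa [mem_vanishingIdeal_singleton_iff, aeval_eq_eval] using hz hA ha
    · simpa [mem_vanishingIdeal_singleton_iff, aeval_eq_eval] using hz hB hb
  have : (vanishingIdeal ℂ {(0 : Fin 3 → ℂ)}).IsPrime :=
    (isMaximal_iff_eq_vanishingIdeal_singleton.2 ⟨0, rfl⟩).isPrime
  obtain ⟨Q, hQ, -⟩ := Ideal.exists_minimalPrimes_le hle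
  have : Q.IsPrime := hQ.1.1
  have hheight : Q.height ≤ 2 := by
    refine (Ideal.height_le_card_of_mem_minimalPrimes_span (by simp) hQ).trans ?_
    have := Set.ncard_insert_le A {B}
    rw [Set.ncard_singleton] at this
    exact_mod_cast this
  -- If the origin were the only zero, the Nullstellensatz would put all variables into `Q`, making
  -- its height at least 3.
  obtain ⟨v, hv, hv0⟩ : ∃ v ∈ zeroLocus ℂ Q, v ≠ 0 := by
    by_contra! hcon
    have hX : ∀ i, X i ∈ Q := fun i => by
      rw [← IsPrime.vanishingIdeal_zeroLocus (K := ℂ) Q, mem_vanishingIdeal_iff]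
      intro v hv
      simp [hcon v hv]
    exact absurd ((height_vars_ge_three Q hX).trans hheight) (by norm_num)
  refine ⟨Projectivization.mk ℂ v hv0, ?_, ?_⟩
  · rw [mem_pointIdeal_iff_eval v hv0 hA]
    simpa [aeval_eq_eval] using hv A (hQ.1.2 (Ideal.subset_span (by simp)))
  · rw [mem_pointIdeal_iff_eval v hv0 hB]
    simpa [aeval_eq_eval] using hv B (hQ.1.2 (Ideal.subset_span (by simp)))

theorem IsSmoothCurve.ne_zero {F : Form} (h : IsSmoothCurve F) : F ≠ 0 := by
  rintro rfl
  obtain ⟨i, hi⟩ := h ⟨Projectivization.mk ℂ (Pi.single 0 1 : Fin 3 → ℂ) (by simp), zero_mem _⟩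
  exact hi (by simp)

/-- Two factors of positive degree would meet in a point, where by the product rule all partial
derivatives of `F` vanish. -/
theorem IsSmoothCurve.prime {F : Form} {d : ℕ} (h : IsSmoothCurve F) (hF : F.IsHomogeneous d)
    (hd : d ≠ 0) : Prime F := by
  rw [← irreducible_iff_prime]
  have hF0 := h.ne_zero
  refine ⟨fun hu => ?_, fun A B hAB => ?_⟩
  · have := hF.inj_right ((totalDegree_zero_iff_isHomogeneous (Fin 3)).1
      (isUnit_iff_totalDegree_of_isReduced.1 hu).2) hF0
    exact hd this
  · by_contra! hcon
    obtain ⟨a, b, hab, hA, hB⟩ := isHomogeneous_of_mul (hAB ▸ hF) (hAB ▸ hF0)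
    have hA0 : A ≠ 0 := fun h => hF0 (by rw [hAB, h, zero_mul])
    have hB0 : B ≠ 0 := fun h => hF0 (by rw [hAB, h, mul_zero])
    obtain ⟨p, hpA, hpB⟩ := exists_common_zero hA hB
      (fun h0 => hcon.1 (isUnit_of_isHomogeneous_zero (h0 ▸ hA) hA0))
      (fun h0 => hcon.2 (isUnit_of_isHomogeneous_zero (h0 ▸ hB) hB0))
    obtain ⟨i, hi⟩ := h ⟨p, by rw [hAB]; exact Ideal.mul_mem_right _ _ hpA⟩
    apply hi
    have : pderiv i F = A • pderiv i B + B • pderiv i A := by rw [hAB, Derivation.leibniz]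
    rw [this]
    exact add_mem (Ideal.mul_mem_right _ _ hpA) (Ideal.mul_mem_right _ _ hpB)

/-! ### Local rings of a smooth plane quartic -/

theorem not_dvd_of_degree_lt {F G : Form} {d e : ℕ} (hF : F.IsHomogeneous d) (hF0 : F ≠ 0)
    (hG : G.IsHomogeneous e) (hG0 : G ≠ 0) (h : e < d) : ¬ F ∣ G := by
  rintro ⟨c, rfl⟩
  obtain ⟨a, b, hab, ha, -⟩ := isHomogeneous_of_mul hG hG0
  have := ha.inj_right hF hF0
  lia

/-- The forms vanishing to order at least `n` at `p` on the curve `F = 0`. -/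
def ordIdeal (F : Form) (p : P2) (n : ℕ) : Ideal Form where
  carrier := {G | ∃ s : Form, s ∉ pointIdeal p ∧ s * G ∈ pointIdeal p ^ n ⊔ Ideal.span {F}}
  zero_mem' := ⟨1, fun h => (pointIdeal_isPrime p).ne_top ((Ideal.eq_top_iff_one _).2 h),
    by simp⟩
  add_mem' := by
    rintro G H ⟨s, hs, hG⟩ ⟨t, ht, hH⟩
    refine ⟨s * t, fun h => ((pointIdeal_isPrime p).mem_or_mem h).elim hs ht, ?_⟩
    rw [mul_add, show s * t * G = t * (s * G) by ring, mul_assoc]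
    exact add_mem (Ideal.mul_mem_left _ _ hG) (Ideal.mul_mem_left _ _ hH)
  smul_mem' := by
    rintro c G ⟨s, hs, hG⟩
    refine ⟨s, hs, ?_⟩
    rw [smul_eq_mul, mul_left_comm]
    exact Ideal.mul_mem_left _ _ hG

theorem mem_ordIdeal {F : Form} {p : P2} {n : ℕ} {G : Form} : G ∈ ordIdeal F p n ↔
    ∃ s : Form, s ∉ pointIdeal p ∧ s * G ∈ pointIdeal p ^ n ⊔ Ideal.span {F} := Iff.rfl

theorem mem_ordIdeal_of_dvd {F : Form} (p : P2) (n : ℕ) {G : Form} (h : F ∣ G) :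
    G ∈ ordIdeal F p n :=
  ⟨1, fun h => (pointIdeal_isPrime p).ne_top ((Ideal.eq_top_iff_one _).2 h),
    by rw [one_mul]; exact Ideal.mem_sup_right (Ideal.mem_span_singleton.2 h)⟩

open IsLocalRing in
open IsDiscreteValuationRing hiding maximalIdeal in
/-- The local ring of the (cone over the) curve `F = 0` at a point is a discrete valuation ring
with a linear form as uniformizer. -/
theorem exists_localRing {F : Form} {d : ℕ} (hF : F.IsHomogeneous d) (hd : 2 ≤ d)
    (hsm : IsSmoothCurve F) (p : Curve F) :
    ∃ (A : Type) (_ : CommRing A) (_ : IsDomain A) (_ : IsDiscreteValuationRing A)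
      (φ : Form →+* A) (a : Fin 3 → ℂ), a ≠ 0 ∧ Irreducible (φ (linForm a)) ∧
      (∀ G, φ G = 0 ↔ F ∣ G) ∧ (∀ s, s ∈ pointIdeal p.1 ↔ φ s ∈ maximalIdeal A) ∧
      (∀ (I : Ideal Form) (G : Form), φ G ∈ I.map φ ↔
        ∃ s ∉ pointIdeal p.1, s * G ∈ I ⊔ Ideal.span {F}) ∧
      (∀ G, ¬ F ∣ G → addVal A (φ G) = ordAt F p.1 G) ∧
      (∀ n, ordIdeal F p.1 n = (maximalIdeal A ^ n).comap φ) := by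
  obtain ⟨p, hp⟩ := p
  have hF0 := hsm.ne_zero
  have hprime : Prime F := hsm.prime hF (by lia)
  have : (Ideal.span {F}).IsPrime := (Ideal.span_singleton_prime hF0).2 hprime
  set R := Form ⧸ Ideal.span {F}
  set π : Form →+* R := Ideal.Quotient.mk (Ideal.span {F})
  have hπ : Function.Surjective π := Ideal.Quotient.mk_surjective
  have hker : RingHom.ker π = Ideal.span {F} := Ideal.mk_ker
  have hkP : RingHom.ker π ≤ pointIdeal p := by
    rw [hker, Ideal.span_singleton_le_iff_mem]; exact hp
  let Q : Ideal R := (pointIdeal p).map π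
  have hQ : Q.IsPrime := Ideal.map_isPrime_of_surjective hπ hkP
  have hmemmap : ∀ (I : Ideal Form) (G : Form), π G ∈ I.map π ↔ G ∈ I ⊔ Ideal.span {F} := by
    intro I G
    have h := Ideal.comap_map_of_surjective' π hπ I
    rw [show RingHom.ker π = _ from hker] at h
    rw [← h, Ideal.mem_comap]
  have hPF : pointIdeal p ⊔ Ideal.span {F} = pointIdeal p := sup_eq_left.2 (hker ▸ hkP)
  have hQmem : ∀ s, π s ∈ Q ↔ s ∈ pointIdeal p := fun s => by rw [hmemmap, hPF]
  obtain ⟨A, _, _, _⟩ : ∃ (A : Type) (_ : CommRing A) (_ : Algebra R A),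
      IsLocalization.AtPrime A Q := ⟨Localization.AtPrime Q, inferInstance, inferInstance,
        inferInstance⟩
  have : IsLocalRing A := IsLocalization.AtPrime.isLocalRing A Q
  have : IsNoetherianRing A := IsLocalization.isNoetherianRing Q.primeCompl A inferInstance
  have : IsDomain A := IsLocalization.isDomain_of_le_nonZeroDivisors A Q.primeCompl_le_nonZeroDivisors
  let φ : Form →+* A := (algebraMap R A).comp π
  have hφ0 : ∀ G, φ G = 0 ↔ F ∣ G := by
    intro G
    change algebraMap R A (π G) = 0 ↔ _
    rw [IsLocalization.to_map_eq_zero_iff A Q.primeCompl_le_nonZeroDivisors,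
      ← Ideal.mem_span_singleton]
    exact Ideal.Quotient.eq_zero_iff_mem
  have hφI : ∀ (I : Ideal Form) (G : Form), φ G ∈ I.map φ ↔
        ∃ s ∉ pointIdeal p, s * G ∈ I ⊔ Ideal.span {F} := by
    intro I G
    rw [show I.map φ = (I.map π).map (algebraMap R A) from (Ideal.map_map _ _).symm,
      show φ G = algebraMap R A (π G) from rfl,
      IsLocalization.algebraMap_mem_map_algebraMap_iff Q.primeCompl]
    constructor
    · rintro ⟨m, hm, h⟩
      obtain ⟨s, rfl⟩ := hπ m
      rw [← map_mul, hmemmap] at h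
      exact ⟨s, fun h' => hm ((hQmem s).2 h'), h⟩
    · rintro ⟨s, hs, h⟩
      exact ⟨π s, fun h' => hs ((hQmem s).1 h'), by rwa [← map_mul, hmemmap]⟩
  have hmax : maximalIdeal A = (pointIdeal p).map φ := by
    rw [← IsLocalization.AtPrime.map_eq_maximalIdeal Q A, Ideal.map_map]
  have hmaxmem : ∀ s, s ∈ pointIdeal p ↔ φ s ∈ maximalIdeal A := by
    intro s
    rw [hmax, hφI, hPF]
    refine ⟨fun h => ⟨1, fun h1 => (pointIdeal_isPrime p).ne_top
      ((Ideal.eq_top_iff_one _).2 h1), by rwa [one_mul]⟩, ?_⟩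
    rintro ⟨t, ht, h⟩
    exact ((pointIdeal_isPrime p).mem_or_mem h).resolve_left ht
  obtain ⟨a, b, hab, hP⟩ := exists_pointIdeal_eq_span p
  have hm2 : maximalIdeal A = Ideal.span {φ (linForm a), φ (linForm b)} := by
    rw [hmax, hP, Ideal.map_span, Set.image_pair]
  -- Write `F = g a + h b` with `a`, `b` the linear generators of the ideal of `p`. If `g` and `h`
  -- both vanished at `p`, so would every derivative of `F`. Hence one of them is a unit, and the
  -- relation `g a + h b = 0` in `A` makes one generator redundant.
  have hunif : ∃ c : Fin 3 → ℂ, c ≠ 0 ∧ maximalIdeal A = Ideal.span {φ (linForm c)} := by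
    obtain ⟨i, hi⟩ := hsm ⟨p, hp⟩
    have hpF := hp
    rw [hP, Ideal.mem_span_pair] at hpF
    obtain ⟨g, h, hgh⟩ := hpF
    have ha : linForm a ∈ pointIdeal p := by rw [hP]; exact Ideal.subset_span (by simp)
    have hb : linForm b ∈ pointIdeal p := by rw [hP]; exact Ideal.subset_span (by simp)
    have hrel : φ g * φ (linForm a) + φ h * φ (linForm b) = 0 := by
      rw [← map_mul, ← map_mul, ← map_add, hgh, hφ0]
    have hunit : ∀ s, s ∉ pointIdeal p → IsUnit (φ s) := fun s hs => by
      rw [hmaxmem] at hs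
      exact notMem_maximalIdeal.1 hs
    by_cases hg : g ∈ pointIdeal p
    · by_cases hh : h ∈ pointIdeal p
      · exfalso
        apply hi
        have : pderiv i F = (g • pderiv i (linForm a) + linForm a • pderiv i g) +
            (h • pderiv i (linForm b) + linForm b • pderiv i h) := by
          rw [← hgh, map_add, Derivation.leibniz, Derivation.leibniz]
        rw [this]
        exact add_mem
          (add_mem (Ideal.mul_mem_right _ _ hg) (Ideal.mul_mem_right _ _ ha))
          (add_mem (Ideal.mul_mem_right _ _ hh) (Ideal.mul_mem_right _ _ hb))
      · refine ⟨a, hab.ne_zero 0, ?_⟩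
        rw [hm2, Ideal.span_pair_eq_span_left_iff_dvd]
        obtain ⟨u, hu⟩ := hunit h hh
        refine ⟨-(↑u⁻¹ * φ g), ?_⟩
        rw [← hu] at hrel
        calc φ (linForm b) = ↑u⁻¹ * (↑u * φ (linForm b)) := by
              rw [← mul_assoc, Units.inv_mul, one_mul]
          _ = ↑u⁻¹ * (-(φ g * φ (linForm a))) := by rw [eq_neg_of_add_eq_zero_right hrel]
          _ = _ := by ring
    · refine ⟨b, hab.ne_zero 1, ?_⟩
      rw [hm2, Ideal.span_pair_eq_span_right_iff_dvd]
      obtain ⟨u, hu⟩ := hunit g hg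
      refine ⟨-(↑u⁻¹ * φ h), ?_⟩
      rw [← hu] at hrel
      calc φ (linForm a) = ↑u⁻¹ * (↑u * φ (linForm a)) := by
            rw [← mul_assoc, Units.inv_mul, one_mul]
        _ = ↑u⁻¹ * (-(φ h * φ (linForm b))) := by rw [eq_neg_of_add_eq_zero_left hrel]
        _ = _ := by ring
  obtain ⟨c, hc, hmc⟩ := hunif
  have hc0 : φ (linForm c) ≠ 0 := by
    rw [Ne, hφ0]
    exact not_dvd_of_degree_lt hF hF0 (linForm_isHomogeneous c) (linForm_ne_zero hc) (by lia)
  have hfield : ¬ IsField A := by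
    rw [isField_iff_maximalIdeal_eq, hmc, Ideal.span_singleton_eq_bot]
    exact hc0
  have hdvr : IsDiscreteValuationRing A := by
    have h : IsDiscreteValuationRing A ↔ (maximalIdeal A).IsPrincipal :=
      (IsDiscreteValuationRing.TFAE A hfield).out 0 4
    exact h.2 ⟨φ (linForm c), hmc⟩
  have hirr : Irreducible (φ (linForm c)) := (irreducible_iff_uniformizer _).2 hmc
  have hord : ∀ n, ordIdeal F p n = (maximalIdeal A ^ n).comap φ := by
    intro n
    ext G
    rw [Ideal.mem_comap, hmax, ← Ideal.map_pow, hφI, mem_ordIdeal]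
  refine ⟨A, inferInstance, inferInstance, hdvr, φ, c, hc, hirr, hφ0, hmaxmem, hφI, ?_, hord⟩
  intro G hG
  have hne : addVal A (φ G) ≠ ⊤ := by rw [Ne, addVal_eq_top_iff, hφ0]; exact hG
  lift addVal A (φ G) to ℕ using hne with k hk
  have hset : {n : ℕ | ∃ s : Form, s ∉ pointIdeal p ∧
      s * G ∈ pointIdeal p ^ n ⊔ Ideal.span {F}} = Set.Iic k := by
    ext n
    change G ∈ ordIdeal F p n ↔ n ≤ k
    rw [hord, Ideal.mem_comap, hmc, Ideal.span_singleton_pow, Ideal.mem_span_singleton,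
      ← addVal_le_iff_dvd, hirr.addVal_pow, ← hk, Nat.cast_le]
  change (k : ℕ∞) = (sSup _ : ℕ)
  rw [hset, csSup_Iic]

section Ord

variable {F : Form} {d : ℕ}

open IsLocalRing
open IsDiscreteValuationRing hiding maximalIdeal

/-- The set in the definition of `ordAt` is an initial segment ending at the valuation. For
multiples of `F` it would be all of `ℕ`, with the default supremum 0. -/
theorem le_ordAt_iff (hF : F.IsHomogeneous d) (hd : 2 ≤ d) (hsm : IsSmoothCurve F) (p : Curve F)
    {G : Form} (hG : ¬ F ∣ G) (n : ℕ) : n ≤ ordAt F p.1 G ↔ G ∈ ordIdeal F p.1 n := by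
  obtain ⟨A, _, _, _, φ, a, ha, hirr, h0, hmax, hI, hord, hoi⟩ := exists_localRing hF hd hsm p
  rw [hoi, Ideal.mem_comap, hirr.maximalIdeal_eq, Ideal.span_singleton_pow,
    Ideal.mem_span_singleton, ← addVal_le_iff_dvd, hirr.addVal_pow, hord G hG, Nat.cast_le]

theorem ordAt_mul (hF : F.IsHomogeneous d) (hd : 2 ≤ d) (hsm : IsSmoothCurve F) (p : Curve F)
    {G H : Form} (hG : ¬ F ∣ G) (hH : ¬ F ∣ H) :
    ordAt F p.1 (G * H) = ordAt F p.1 G + ordAt F p.1 H := by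
  obtain ⟨A, _, _, _, φ, a, ha, hirr, h0, hmax, hI, hord, hoi⟩ := exists_localRing hF hd hsm p
  have hGH : ¬ F ∣ G * H := fun h =>
    ((hsm.prime hF (by lia)).dvd_or_dvd h).elim hG hH
  have := addVal_mul (R := A) (a := φ G) (b := φ H)
  rw [← map_mul, hord _ hGH, hord _ hG, hord _ hH] at this
  exact_mod_cast this

theorem ordAt_pos_iff (hF : F.IsHomogeneous d) (hd : 2 ≤ d) (hsm : IsSmoothCurve F)
    (p : Curve F) {G : Form} (hG : ¬ F ∣ G) : 1 ≤ ordAt F p.1 G ↔ G ∈ pointIdeal p.1 := by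
  rw [le_ordAt_iff hF hd hsm p hG]
  obtain ⟨A, _, _, _, φ, a, ha, hirr, h0, hmax, hI, hord, hoi⟩ := exists_localRing hF hd hsm p
  rw [hoi, pow_one, Ideal.mem_comap, hmax]

theorem mul_mem_ordIdeal (hF : F.IsHomogeneous d) (hd : 2 ≤ d) (hsm : IsSmoothCurve F)
    (p : Curve F) {G H : Form} {m n : ℕ} (hG : G ∈ ordIdeal F p.1 m)
    (hH : H ∈ ordIdeal F p.1 n) : G * H ∈ ordIdeal F p.1 (m + n) := by
  obtain ⟨A, _, _, _, φ, a, ha, hirr, h0, hmax, hI, hord, hoi⟩ := exists_localRing hF hd hsm p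
  rw [hoi, Ideal.mem_comap] at *
  rw [map_mul, pow_add]
  exact Ideal.mul_mem_mul hG hH

theorem ordIdeal_antitone (hF : F.IsHomogeneous d) (hd : 2 ≤ d) (hsm : IsSmoothCurve F)
    (p : Curve F) : Antitone (ordIdeal F p.1) := by
  obtain ⟨A, _, _, _, φ, a, ha, hirr, h0, hmax, hI, hord, hoi⟩ := exists_localRing hF hd hsm p
  intro m n h
  rw [hoi, hoi]
  exact Ideal.comap_mono (Ideal.pow_le_pow_right h)

theorem mem_ordIdeal_zero (F : Form) (p : P2) (G : Form) : G ∈ ordIdeal F p 0 :=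
  ⟨1, fun h => (pointIdeal_isPrime p).ne_top ((Ideal.eq_top_iff_one _).2 h), by simp⟩

theorem ordAt_congr (p : Curve F) {G H : Form} (h : F ∣ G - H) :
    ordAt F p.1 G = ordAt F p.1 H := by
  have hmem : ∀ n, G ∈ ordIdeal F p.1 n ↔ H ∈ ordIdeal F p.1 n := fun n => by
    have := mem_ordIdeal_of_dvd p.1 n h
    constructor
    · intro hG; simpa using sub_mem hG this
    · intro hH; simpa using add_mem this hH
  exact congrArg sSup (Set.ext hmem)

/-- If `B` divides `G` in the local ring at `p`, then `G ∈ (B, F)` locally at `p`. -/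
theorem exists_mul_mem_span_pair (hF : F.IsHomogeneous d) (hd : 2 ≤ d) (hsm : IsSmoothCurve F)
    (p : Curve F) {B G : Form} (hB : ¬ F ∣ B) (hBG : G ∈ ordIdeal F p.1 (ordAt F p.1 B)) :
    ∃ s ∉ pointIdeal p.1, s * G ∈ Ideal.span {B, F} := by
  obtain ⟨A, _, _, _, φ, a, ha, hirr, h0, hmax, hI, hord, hoi⟩ := exists_localRing hF hd hsm p
  rw [Ideal.span_insert, ← hI, Ideal.map_span, Set.image_singleton, Ideal.mem_span_singleton,
    ← addVal_le_iff_dvd, hord B hB]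
  rwa [hoi, Ideal.mem_comap, hirr.maximalIdeal_eq, Ideal.span_singleton_pow,
    Ideal.mem_span_singleton, ← addVal_le_iff_dvd, hirr.addVal_pow] at hBG

theorem exists_uniformizer (hF : F.IsHomogeneous d) (hd : 2 ≤ d) (hsm : IsSmoothCurve F)
    (p : Curve F) : ∃ a : Fin 3 → ℂ, a ≠ 0 ∧ ordAt F p.1 (linForm a) = 1 ∧
      ∀ n G, G ∈ ordIdeal F p.1 n →
        ∃ s ∉ pointIdeal p.1, s * G ∈ Ideal.span {linForm a ^ n, F} := by
  obtain ⟨A, _, _, _, φ, a, ha, hirr, h0, hmax, hI, hord, hoi⟩ := exists_localRing hF hd hsm p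
  have hnd : ¬ F ∣ linForm a := by rw [← h0]; exact hirr.ne_zero
  refine ⟨a, ha, ?_, fun n G hG => ?_⟩
  · have := hord _ hnd
    rw [addVal_uniformizer hirr] at this
    exact_mod_cast this.symm
  · rw [Ideal.span_insert, ← hI, Ideal.map_span, Set.image_singleton, map_pow,
      ← Ideal.span_singleton_pow, ← hirr.maximalIdeal_eq]
    rwa [hoi] at hG

/-- A homogeneous version of the factorization of a form into a unit and a power of the
uniformizer. -/
theorem exists_homogeneous_unit {p : P2} {t A : Form} (ht : t.IsHomogeneous 1)
    (hprime : Prime F) (hFp : F ∈ pointIdeal p)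
    (hF : F.IsHomogeneous d) {e n : ℕ} (hA : A.IsHomogeneous e) (hFA : ¬ F ∣ A)
    (h : ∃ s ∉ pointIdeal p, s * A ∈ Ideal.span {t ^ n, F}) :
    ∃ k l s u, k + e = l + n ∧ s.IsHomogeneous k ∧ u.IsHomogeneous l ∧ s ∉ pointIdeal p ∧
      F ∣ s * A - u * t ^ n := by
  obtain ⟨s, hs, hsA⟩ := h
  obtain ⟨k, hk⟩ := exists_homogeneousComponent_notMem hs
  obtain ⟨u, w, huw⟩ := Ideal.mem_span_pair.1 hsA
  have htn : (t ^ n).IsHomogeneous n := by simpa using ht.pow n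
  have hcomp := congrArg (homogeneousComponent (k + e)) huw
  rw [map_add, homogeneousComponent_mul_right hA] at hcomp
  have hFw : F ∣ homogeneousComponent (k + e) (w * F) := by
    rcases lt_or_ge (k + e) d with hlt | hge
    · rw [homogeneousComponent_mul_right_of_lt hF w hlt]; exact dvd_zero _
    · obtain ⟨m, hm⟩ := Nat.exists_eq_add_of_le' hge
      rw [hm, homogeneousComponent_mul_right hF]; exact dvd_mul_left _ _
  have hkF : ¬ F ∣ homogeneousComponent k s := fun h =>
    hk (Ideal.mem_of_dvd _ h hFp)
  rcases lt_or_ge (k + e) n with hlt | hge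
  -- In degree below `n` the term `u * t ^ n` contributes nothing, so `F` would divide a product of
  -- two forms neither of which it divides.
  · rw [homogeneousComponent_mul_right_of_lt htn u hlt, zero_add] at hcomp
    rw [hcomp] at hFw
    exact ((hprime.dvd_or_dvd hFw).elim hkF hFA).elim
  · obtain ⟨l, hl⟩ := Nat.exists_eq_add_of_le' hge
    refine ⟨k, l, _, homogeneousComponent l u, hl, homogeneousComponent_isHomogeneous _ _,
      homogeneousComponent_isHomogeneous _ _, hk, ?_⟩
    rw [← hcomp, hl, homogeneousComponent_mul_right htn, ← hl, add_sub_cancel_left]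
    exact hFw

/-- Two forms of the same degree vanishing to order `n` at `p` have a nontrivial linear
combination vanishing to order `n + 1`. -/
theorem exists_combination (hF : F.IsHomogeneous d) (hd : 2 ≤ d) (hsm : IsSmoothCurve F)
    (p : Curve F) {A B : Form} {e n : ℕ} (hA : A.IsHomogeneous e) (hB : B.IsHomogeneous e)
    (hAn : A ∈ ordIdeal F p.1 n) (hBn : B ∈ ordIdeal F p.1 n) :
    ∃ c c' : ℂ, (c ≠ 0 ∨ c' ≠ 0) ∧ C c * A + C c' * B ∈ ordIdeal F p.1 (n + 1) := by
  by_cases hFA : F ∣ A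
  · exact ⟨1, 0, Or.inl one_ne_zero, mem_ordIdeal_of_dvd _ _ (by simpa using hFA)⟩
  by_cases hFB : F ∣ B
  · exact ⟨0, 1, Or.inr one_ne_zero, mem_ordIdeal_of_dvd _ _ (by simpa using hFB)⟩
  have hprime := hsm.prime hF (by lia)
  obtain ⟨a, ha, ha1, hloc⟩ := exists_uniformizer hF hd hsm p
  obtain ⟨k, l, s, u, hkl, hs, hu, hsp, hFs⟩ := exists_homogeneous_unit
    (linForm_isHomogeneous a) hprime p.2 hF hA hFA (hloc n A hAn)
  obtain ⟨k', l', s', u', hkl', hs', hu', hsp', hFs'⟩ := exists_homogeneous_unit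
    (linForm_isHomogeneous a) hprime p.2 hF hB hFB (hloc n B hBn)
  have hta : linForm a ∈ ordIdeal F p.1 1 := by
    rw [← le_ordAt_iff hF hd hsm p (not_dvd_of_degree_lt hF hsm.ne_zero
      (linForm_isHomogeneous a) (linForm_ne_zero ha) (by lia)), ha1]
  have htn : ∀ n, linForm a ^ n ∈ ordIdeal F p.1 n := by
    intro n
    induction n with
    | zero => exact mem_ordIdeal_zero _ _ _
    | succ n ih => rw [pow_succ]; exact mul_mem_ordIdeal hF hd hsm p ih hta
  obtain ⟨v, hv, hpv⟩ : ∃ v hv, p.1 = Projectivization.mk ℂ v hv :=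
    ⟨_, _, (Projectivization.mk_rep p.1).symm⟩
  have hev : ∀ {G : Form} {m : ℕ}, G.IsHomogeneous m → (G ∈ pointIdeal p.1 ↔ eval v G = 0) :=
    fun hG => by rw [hpv, mem_pointIdeal_iff_eval v hv hG]
  rw [hev hs] at hsp
  rw [hev hs'] at hsp'
  -- Locally `A = (u / s) tⁿ` and `B = (u' / s') tⁿ` on the curve. The constants are chosen so that
  -- the leading coefficients at `p` cancel.
  obtain ⟨c, c', hcc, hcomb⟩ : ∃ c c' : ℂ, (c ≠ 0 ∨ c' ≠ 0) ∧
      c * (eval v u * eval v s') + c' * (eval v u' * eval v s) = 0 := by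
    by_cases h : eval v u = 0
    · exact ⟨1, 0, Or.inl one_ne_zero, by rw [h]; ring⟩
    · exact ⟨-(eval v u' * eval v s), eval v u * eval v s',
        Or.inr (mul_ne_zero h hsp'), by ring⟩
  refine ⟨c, c', hcc, ?_⟩
  set g : Form := C c * (u * s') + C c' * (u' * s) with hg
  have hghom : g.IsHomogeneous (l + k') :=
    ((hu.mul hs').C_mul c).add (by
      have := (hu'.mul hs).C_mul c'
      rwa [show l' + k = l + k' by lia] at this)
  have hgp : g ∈ ordIdeal F p.1 1 := by
    refine ⟨1, fun h => (pointIdeal_isPrime p.1).ne_top ((Ideal.eq_top_iff_one _).2 h), ?_⟩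
    rw [one_mul, pow_one]
    exact Ideal.mem_sup_left ((hev hghom).2 (by simpa [hg] using hcomb))
  have hfin : (s * s') * (C c * A + C c' * B) ∈ ordIdeal F p.1 (n + 1) := by
    have h1 : g * linForm a ^ n ∈ ordIdeal F p.1 (n + 1) := by
      rw [add_comm]; exact mul_mem_ordIdeal hF hd hsm p hgp (htn n)
    have h2 : F ∣ (s * s') * (C c * A + C c' * B) - g * linForm a ^ n := by
      have : (s * s') * (C c * A + C c' * B) - g * linForm a ^ n =
          C c * s' * (s * A - u * linForm a ^ n) + C c' * s * (s' * B - u' * linForm a ^ n) := by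
        rw [hg]; ring
      rw [this]
      exact dvd_add (dvd_mul_of_dvd_right hFs _) (dvd_mul_of_dvd_right hFs' _)
    simpa using add_mem (mem_ordIdeal_of_dvd p.1 (n + 1) h2) h1
  obtain ⟨r, hr, hrm⟩ := hfin
  refine ⟨r * (s * s'), fun h => ?_, by rwa [mul_assoc]⟩
  rcases (pointIdeal_isPrime p.1).mem_or_mem h with h | h
  · exact hr h
  · rcases (pointIdeal_isPrime p.1).mem_or_mem h with h | h
    · exact hsp ((hev hs).1 h)
    · exact hsp' ((hev hs').1 h)

end Ord

/-! ### Noether's theorem -/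

theorem dvd_homogeneousComponent {F G : Form} {d : ℕ} (hF : F.IsHomogeneous d) (h : F ∣ G)
    (n : ℕ) : F ∣ homogeneousComponent n G := by
  obtain ⟨w, rfl⟩ := h
  rw [mul_comm]
  rcases lt_or_ge n d with hlt | hge
  · rw [homogeneousComponent_mul_right_of_lt hF w hlt]; exact dvd_zero _
  · obtain ⟨m, rfl⟩ := Nat.exists_eq_add_of_le' hge
    rw [homogeneousComponent_mul_right hF]; exact dvd_mul_left _ _

/-- The powers of a regular sequence `x, y` are again regular: divisibility by `x` is peeled off one
factor at a time. It serves to patch two local quotients in `mem_span_pair_of_locally`. -/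
theorem pow_dvd_of_pow_dvd_pow_mul {R : Type*} [CommRing R] [IsDomain R] {x y : R} (hx : x ≠ 0)
    (h : ∀ b, x ∣ y * b → x ∣ b) (n m : ℕ) (b : R) (hb : x ^ n ∣ y ^ m * b) : x ^ n ∣ b := by
  have h1 : ∀ (m : ℕ) (b : R), x ∣ y ^ m * b → x ∣ b := by
    intro m
    induction m with
    | zero => intro b hb; simpa using hb
    | succ m ih =>
      intro b hb
      rw [pow_succ, mul_assoc] at hb
      exact h _ (ih _ hb)
  induction n generalizing b with
  | zero => simp
  | succ n ih =>
    obtain ⟨c, rfl⟩ := h1 m b ((dvd_pow_self x n.succ_ne_zero).trans hb)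
    rw [pow_succ', mul_left_comm, mul_dvd_mul_iff_left hx] at hb
    rw [pow_succ']
    exact mul_dvd_mul_left x (ih c hb)

theorem exists_notMem_pointIdeal {F : Form} {d : ℕ} (hF : F.IsHomogeneous d) (hd : d ≠ 0)
    (hF0 : F ≠ 0) : ∃ p : P2, F ∉ pointIdeal p := by
  obtain ⟨v, hv⟩ : ∃ v, eval v F ≠ 0 := by
    by_contra! h
    exact hF0 (MvPolynomial.funext fun v => by rw [h v, map_zero])
  have hv0 : v ≠ 0 := by
    rintro rfl
    have := eval_smul_of_isHomogeneous hF 0 0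
    rw [zero_smul, zero_pow hd, zero_mul] at this
    exact hv this
  exact ⟨Projectivization.mk ℂ v hv0, by rwa [mem_pointIdeal_iff_eval v hv0 hF]⟩

/-- A form that lies locally everywhere in the ideal `(B, F)` lies in this ideal. -/
theorem mem_span_pair_of_locally {F B G : Form} {d b g : ℕ} (hF : F.IsHomogeneous d)
    (hd : 2 ≤ d) (hprime : Prime F) (hB : B.IsHomogeneous b) (hFB : ¬ F ∣ B)
    (hG : G.IsHomogeneous g)
    (hloc : ∀ p : P2, ∃ s ∉ pointIdeal p, s * G ∈ Ideal.span {B, F}) :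
    G ∈ Ideal.span {B, F} := by
  have hJ : ∀ {H : Form}, H ∈ Ideal.span {B, F} → ∀ n,
      homogeneousComponent n H ∈ Ideal.span {B, F} := by
    intro H hH n
    obtain ⟨u, w, rfl⟩ := Ideal.mem_span_pair.1 hH
    rw [map_add]
    exact add_mem
      (Ideal.mem_of_dvd _ (dvd_homogeneousComponent hB (dvd_mul_left _ _) n)
        (Ideal.subset_span (by simp)))
      (Ideal.mem_of_dvd _ (dvd_homogeneousComponent hF (dvd_mul_left _ _) n)
        (Ideal.subset_span (by simp)))
  -- This is the colon ideal of `G` into `(B, F)`. By the local hypothesis it has no zero apart from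
  -- possibly the origin, so some power of every linear form lies in it.
  let I : Ideal Form := Submodule.comap (LinearMap.mulRight Form G) (Ideal.span {B, F})
  have hI : ∀ s, s ∈ I ↔ s * G ∈ Ideal.span {B, F} := fun s => Iff.rfl
  have hpow : ∀ a : Fin 3 → ℂ, ∃ n : ℕ, linForm a ^ n * G ∈ Ideal.span {B, F} := by
    intro a
    change linForm a ∈ I.radical
    rw [← vanishingIdeal_zeroLocus_eq_radical (K := ℂ), mem_vanishingIdeal_iff]
    intro v hv
    have hv0 : v = 0 := by
      by_contra hv0
      obtain ⟨s, hs, hsG⟩ := hloc (Projectivization.mk ℂ v hv0)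
      obtain ⟨k, hk⟩ := exists_homogeneousComponent_notMem hs
      apply hk
      rw [mem_pointIdeal_iff_eval v hv0 (homogeneousComponent_isHomogeneous k s)]
      have hmem : homogeneousComponent k s ∈ I := by
        rw [hI, ← homogeneousComponent_mul_right hG]
        exact hJ hsG _
      simpa [aeval_eq_eval] using hv _ hmem
    rw [hv0, aeval_eq_eval]
    simp only [eval_linForm, dotProduct_zero]
  -- For a point off the curve, the two linear generators `α`, `β` of its ideal form a regular
  -- sequence modulo `F`.
  obtain ⟨p, hp⟩ := exists_notMem_pointIdeal hF (by lia) hprime.ne_zero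
  obtain ⟨α, β, hαβ, hP⟩ := exists_pointIdeal_eq_span p
  have hα0 : α ≠ 0 := hαβ.ne_zero 0
  have : (Ideal.span {F}).IsPrime := (Ideal.span_singleton_prime hprime.ne_zero).2 hprime
  let π := Ideal.Quotient.mk (Ideal.span {F})
  have hπ0 : ∀ H, π H = 0 ↔ F ∣ H := fun H => by
    rw [← Ideal.mem_span_singleton]; exact Ideal.Quotient.eq_zero_iff_mem
  have hπs : Function.Surjective π := Ideal.Quotient.mk_surjective
  have hx0 : π (linForm α) ≠ 0 := by
    rw [Ne, hπ0]
    exact not_dvd_of_degree_lt hF hprime.ne_zero (linForm_isHomogeneous α)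
      (linForm_ne_zero hα0) (by lia)
  have hβα : ¬ linForm α ∣ linForm β := by
    rintro ⟨c, hc⟩
    have hb0 : linForm β ≠ 0 := linForm_ne_zero (hαβ.ne_zero 1)
    obtain ⟨i, j, hij, hi, hj⟩ := isHomogeneous_of_mul (hc ▸ linForm_isHomogeneous β)
      (hc ▸ hb0)
    have hi1 := hi.inj_right (linForm_isHomogeneous α) (linForm_ne_zero hα0)
    obtain rfl : j = 0 := by lia
    obtain ⟨e, rfl⟩ : ∃ e : ℂ, c = C e :=
      ⟨coeff 0 c, (totalDegree_eq_zero_iff_eq_C (p := c)).1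
        ((totalDegree_zero_iff_isHomogeneous (Fin 3)).2 hj)⟩
    rw [mul_comm, ← linForm_smul] at hc
    exact (LinearIndependent.pair_iff' hα0).1 hαβ e (linForm_injective hc).symm
  have hreg : ∀ y, π (linForm α) ∣ π (linForm β) * y → π (linForm α) ∣ y := by
    intro y hy
    obtain ⟨y, rfl⟩ := hπs y
    obtain ⟨x, hx⟩ := hy
    obtain ⟨x, rfl⟩ := hπs x
    rw [← map_mul, ← map_mul, ← sub_eq_zero, ← map_sub, hπ0] at hx
    obtain ⟨w, hw⟩ := hx
    have hFw : F * w ∈ pointIdeal p := by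
      rw [← hw, hP]
      exact sub_mem (Ideal.mul_mem_right _ _ (Ideal.subset_span (by simp)))
        (Ideal.mul_mem_right _ _ (Ideal.subset_span (by simp)))
    have hwP := ((pointIdeal_isPrime p).mem_or_mem hFw).resolve_left hp
    rw [hP] at hwP
    obtain ⟨r, s, rfl⟩ := Ideal.mem_span_pair.1 hwP
    -- Since `F` does not vanish at `p`, the cofactor `w` lies in `(α, β)`. Absorbing it gives an
    -- honest divisibility by the prime `α`.
    have hdvd : linForm α ∣ linForm β * (y - F * s) := ⟨x + F * r, by linear_combination hw⟩
    obtain ⟨z, hz⟩ := ((linForm_prime hα0).dvd_or_dvd hdvd).resolve_left hβα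
    refine ⟨π z, ?_⟩
    rw [← map_mul, ← sub_eq_zero, ← map_sub, hπ0]
    exact ⟨s, by linear_combination hz⟩
  obtain ⟨n, hn⟩ := hpow α
  obtain ⟨m, hm⟩ := hpow β
  obtain ⟨u, w, huw⟩ := Ideal.mem_span_pair.1 hn
  obtain ⟨u', w', huw'⟩ := Ideal.mem_span_pair.1 hm
  have hπF : π F = 0 := (hπ0 F).2 dvd_rfl
  have e1 : π (linForm α) ^ n * π G = π u * π B := by
    rw [← map_pow, ← map_mul, ← huw, map_add, map_mul, map_mul, hπF]; ring
  have e2 : π (linForm β) ^ m * π G = π u' * π B := by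
    rw [← map_pow, ← map_mul, ← huw', map_add, map_mul, map_mul, hπF]; ring
  have hB0 : π B ≠ 0 := by rwa [Ne, hπ0]
  have e3 : π (linForm β) ^ m * π u = π (linForm α) ^ n * π u' := by
    apply mul_right_cancel₀ hB0
    linear_combination π (linForm α) ^ n * e2 - π (linForm β) ^ m * e1
  -- The quotient `G / B` is both `u / αⁿ` and `u' / βᵐ` modulo `F`. Regularity then forces `αⁿ` to
  -- divide `u`, so the quotient is a polynomial.
  obtain ⟨q, hq⟩ := pow_dvd_of_pow_dvd_pow_mul hx0 hreg n m (π u) ⟨_, e3⟩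
  obtain ⟨q, rfl⟩ := hπs q
  have e4 : π G = π q * π B := by
    apply mul_left_cancel₀ (pow_ne_zero n hx0)
    rw [e1, hq]; ring
  rw [← map_mul, ← sub_eq_zero, ← map_sub, hπ0] at e4
  obtain ⟨r, hr⟩ := e4
  exact Ideal.mem_span_pair.2 ⟨q, r, by linear_combination -hr⟩

/-- Smooth plane quartics. -/
structure IsSmoothQuartic (F : Form) : Prop where
  hom : F.IsHomogeneous 4
  smooth : IsSmoothCurve F

namespace IsSmoothQuartic

theorem ne_zero {F : Form} (h : IsSmoothQuartic F) : F ≠ 0 := h.smooth.ne_zero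

theorem prime {F : Form} (h : IsSmoothQuartic F) : Prime F := h.smooth.prime h.hom (by norm_num)

theorem not_dvd_mul {F : Form} (h : IsSmoothQuartic F)
    {G H : Form} (hG : ¬ F ∣ G) (hH : ¬ F ∣ H) : ¬ F ∣ G * H := fun h' =>
  (h.prime.dvd_or_dvd h').elim hG hH

theorem not_dvd_linForm {F : Form} (h : IsSmoothQuartic F)
    {a : Fin 3 → ℂ} (ha : a ≠ 0) : ¬ F ∣ linForm a :=
  not_dvd_of_degree_lt h.hom h.ne_zero (linForm_isHomogeneous a) (linForm_ne_zero ha) (by norm_num)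

theorem not_dvd_X {F : Form} (h : IsSmoothQuartic F) (i : Fin 3) : ¬ F ∣ X i :=
  not_dvd_of_degree_lt h.hom h.ne_zero (isHomogeneous_X _ i) (X_ne_zero i) (by norm_num)

theorem not_dvd_of_notMem {F : Form} (p : Curve F) {G : Form} (hG : G ∉ pointIdeal p.1) : ¬ F ∣ G :=
  fun h' => hG (Ideal.mem_of_dvd _ h' p.2)

theorem le_ordAt {F : Form} (h : IsSmoothQuartic F)
    (p : Curve F) {G : Form} (hG : ¬ F ∣ G) {n : ℕ} :
    n ≤ ordAt F p.1 G ↔ G ∈ ordIdeal F p.1 n :=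
  le_ordAt_iff h.hom (by norm_num) h.smooth p hG n

theorem mem_ordIdeal_ordAt {F : Form} (h : IsSmoothQuartic F)
    (p : Curve F) (G : Form) : G ∈ ordIdeal F p.1 (ordAt F p.1 G) := by
  by_cases hG : F ∣ G
  · exact mem_ordIdeal_of_dvd _ _ hG
  · exact (h.le_ordAt p hG).1 le_rfl

theorem ordAt_mul {F : Form} (h : IsSmoothQuartic F)
    (p : Curve F) {G H : Form} (hG : ¬ F ∣ G) (hH : ¬ F ∣ H) :
    ordAt F p.1 (G * H) = ordAt F p.1 G + ordAt F p.1 H :=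
  HeptagonAdjoint.ordAt_mul h.hom (by norm_num) h.smooth p hG hH

theorem ordAt_pos {F : Form} (h : IsSmoothQuartic F) (p : Curve F) {G : Form} (hG : ¬ F ∣ G) :
    1 ≤ ordAt F p.1 G ↔ G ∈ pointIdeal p.1 :=
  ordAt_pos_iff h.hom (by norm_num) h.smooth p hG

theorem ordAt_eq_zero {F : Form} (h : IsSmoothQuartic F)
    (p : Curve F) {G : Form} (hG : G ∉ pointIdeal p.1) :
    ordAt F p.1 G = 0 := by
  have := (h.ordAt_pos p (not_dvd_of_notMem p hG)).not.2 hG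
  lia

theorem mul_mem_ordIdeal {F : Form} (h : IsSmoothQuartic F)
    (p : Curve F) {G H : Form} {m n : ℕ} (hG : G ∈ ordIdeal F p.1 m)
    (hH : H ∈ ordIdeal F p.1 n) : G * H ∈ ordIdeal F p.1 (m + n) :=
  HeptagonAdjoint.mul_mem_ordIdeal h.hom (by norm_num) h.smooth p hG hH

theorem ordIdeal_anti {F : Form} (h : IsSmoothQuartic F) (p : Curve F) {m n : ℕ} (hmn : m ≤ n) :
    ordIdeal F p.1 n ≤ ordIdeal F p.1 m :=
  ordIdeal_antitone h.hom (by norm_num) h.smooth p hmn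

/-- Noether's theorem: a form whose divisor on the curve contains that of `B` is a multiple
of `B` on the curve. -/
theorem noether {F : Form} (h : IsSmoothQuartic F)
    {B G : Form} {b e : ℕ} (hB : B.IsHomogeneous b) (hFB : ¬ F ∣ B)
    (hG : G.IsHomogeneous (e + b))
    (hBG : ∀ p : Curve F, G ∈ ordIdeal F p.1 (ordAt F p.1 B)) :
    ∃ N : Form, N.IsHomogeneous e ∧ F ∣ G - N * B := by
  have hmem := mem_span_pair_of_locally h.hom (by norm_num) h.prime hB hFB hG fun p => by
    by_cases hp : F ∈ pointIdeal p
    · exact exists_mul_mem_span_pair h.hom (by norm_num) h.smooth ⟨p, hp⟩ hFB (hBG ⟨p, hp⟩)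
    · exact ⟨F, hp, Ideal.mul_mem_right _ _ (Ideal.subset_span (by simp))⟩
  obtain ⟨u, w, huw⟩ := Ideal.mem_span_pair.1 hmem
  refine ⟨homogeneousComponent e u, homogeneousComponent_isHomogeneous e u, ?_⟩
  have := congrArg (homogeneousComponent (e + b)) huw
  rw [map_add, homogeneousComponent_mul_right hB, homogeneousComponent_eq_self hG] at this
  rw [← this, add_sub_cancel_left]
  exact dvd_homogeneousComponent h.hom (dvd_mul_left _ _) _

/-- The ideals of these points are minimal primes over `(B, F)`, of which a Noetherian ring has
finitely many. For minimality, a prime `Q` in between contains a power of the uniformizer up to a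
local unit, hence the uniformizer, hence the whole ideal of the point. -/
theorem finite_zeros {F : Form} (h : IsSmoothQuartic F) {B : Form} (hFB : ¬ F ∣ B) :
    {p : Curve F | B ∈ pointIdeal p.1}.Finite := by
  have hfin := Ideal.finite_minimalPrimes_of_isNoetherianRing Form (Ideal.span {B, F})
  refine Set.Finite.of_finite_image (f := fun p : Curve F => pointIdeal p.1)
    (hfin.subset ?_) fun p _ q _ hpq => Subtype.ext (pointIdeal_injective hpq)
  rintro _ ⟨p, hp, rfl⟩
  refine ⟨⟨inferInstance, ?_⟩, fun Q hQ hQp => ?_⟩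
  · rw [Ideal.span_le]
    rintro _ (rfl | rfl)
    · exact hp
    · exact p.2
  · obtain ⟨hQ1, hQ2⟩ := hQ
    have hFQ : F ∈ Q := hQ2 (Ideal.subset_span (by simp))
    have hBQ : B ∈ Q := hQ2 (Ideal.subset_span (by simp))
    obtain ⟨a, ha, ha1, hloc⟩ := exists_uniformizer h.hom (by norm_num) h.smooth p
    have htn : ∀ n, linForm a ^ n ∈ ordIdeal F p.1 n := by
      intro n
      induction n with
      | zero => exact mem_ordIdeal_zero _ _ _
      | succ n ih =>
        rw [pow_succ]
        refine h.mul_mem_ordIdeal p ih ?_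
        rw [← h.le_ordAt p (h.not_dvd_linForm ha), ha1]
    have haQ : linForm a ∈ Q := by
      obtain ⟨s, hs, hsm⟩ := exists_mul_mem_span_pair h.hom (by norm_num) h.smooth p hFB
        (htn (ordAt F p.1 B))
      have : s * linForm a ^ (ordAt F p.1 B) ∈ Q := hQ2 hsm
      exact hQ1.mem_of_pow_mem _ ((hQ1.mem_or_mem this).resolve_left fun hs' => hs (hQp hs'))
    intro G hG
    have hG1 : G ∈ ordIdeal F p.1 1 :=
      ⟨1, fun h1 => (pointIdeal_isPrime p.1).ne_top ((Ideal.eq_top_iff_one _).2 h1), by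
        rw [one_mul, pow_one]; exact Ideal.mem_sup_left hG⟩
    obtain ⟨s, hs, hsm⟩ := hloc 1 G hG1
    have : s * G ∈ Q := by
      refine (Ideal.span_le.2 ?_ : Ideal.span {linForm a ^ 1, F} ≤ Q) hsm
      rintro _ (rfl | rfl)
      · simpa using haQ
      · exact hFQ
    exact (hQ1.mem_or_mem this).resolve_left fun hs' => hs (hQp hs')

end IsSmoothQuartic

open Classical in
/-- The divisor cut out by a form `G`, as a multiset of points. -/
noncomputable def mdiv (F G : Form) : Multiset (Curve F) :=
  if hfin : (Function.support fun p : Curve F => ordAt F p.1 G).Finite then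
    Finsupp.toMultiset (Finsupp.ofSupportFinite (fun p : Curve F => ordAt F p.1 G) hfin) else 0

open Classical in
theorem IsSmoothQuartic.count_mdiv {F : Form} (h : IsSmoothQuartic F) {G : Form} (hG : ¬ F ∣ G)
    (p : Curve F) : (mdiv F G).count p = ordAt F p.1 G := by
  have hfin : (Function.support fun p : Curve F => ordAt F p.1 G).Finite := by
    refine (h.finite_zeros hG).subset fun q hq => ?_
    rw [Set.mem_ofPred_eq, ← h.ordAt_pos q hG]
    exact Nat.one_le_iff_ne_zero.2 hq
  rw [mdiv, dif_pos hfin, Finsupp.count_toMultiset]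
  rfl

/-! ### Bézout's theorem -/

open scoped Classical in
/-- The forms of degree `n` whose divisor contains `s`. -/
noncomputable def formSpace (F : Form) (n : ℕ) (s : Multiset (Curve F)) : Submodule ℂ Form :=
  homogeneousSubmodule (Fin 3) ℂ n ⊓
    ⨅ p : Curve F, (ordIdeal F p.1 (s.count p)).restrictScalars ℂ

open scoped Classical in
theorem mem_formSpace {F : Form} {n : ℕ} {s : Multiset (Curve F)} {N : Form} :
    N ∈ formSpace F n s ↔
      N.IsHomogeneous n ∧ ∀ p : Curve F, N ∈ ordIdeal F p.1 (s.count p) := by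
  simp [formSpace, Submodule.mem_iInf]

instance finiteDimensional_homogeneousSubmodule (n : ℕ) :
    FiniteDimensional ℂ (homogeneousSubmodule (Fin 3) ℂ n) :=
  Module.Finite.iff_fg.2 (homogeneousSubmodule_fg (Fin 3) ℂ n)

instance finiteDimensional_formSpace (F : Form) (n : ℕ) (s : Multiset (Curve F)) :
    FiniteDimensional ℂ (formSpace F n s) :=
  Submodule.finiteDimensional_of_le (inf_le_left : formSpace F n s ≤ _)

theorem formSpace_zero (F : Form) (n : ℕ) :
    formSpace F n 0 = homogeneousSubmodule (Fin 3) ℂ n := by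
  ext N
  rw [mem_formSpace]
  simp [mem_ordIdeal_zero]

theorem finrank_homogeneousSubmodule (n : ℕ) :
    2 * Module.finrank ℂ (homogeneousSubmodule (Fin 3) ℂ n) = (n + 2) * (n + 1) := by
  have hset : {d : Fin 3 →₀ ℕ | d.degree = n} =
      (Finset.univ.finsuppAntidiag n : Finset (Fin 3 →₀ ℕ)) := by
    ext d
    simp [Finset.mem_finsuppAntidiag, Finsupp.degree_eq_sum]
  have hcard : Module.finrank ℂ (homogeneousSubmodule (Fin 3) ℂ n) = (n + 2).choose 2 := by
    let b : Module.Basis {d : Fin 3 →₀ ℕ | d.degree = n} ℂ (homogeneousSubmodule (Fin 3) ℂ n) :=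
      (basisRestrictSupport ℂ {d : Fin 3 →₀ ℕ | d.degree = n}).map
        (LinearEquiv.ofEq _ _ (homogeneousSubmodule_eq_finsupp_supported (Fin 3) ℂ n).symm)
    rw [Module.finrank_eq_nat_card_basis b, Nat.card_coe_set_eq, hset, Set.ncard_coe_finset,
      Finset.card_finsuppAntidiag_nat_eq_choose, Finset.card_univ, Fintype.card_fin,
      show 3 + n - 1 = n + 2 by lia, Nat.choose_symm_add]
  rw [hcard, Nat.choose_two_right, Nat.mul_div_cancel' (Nat.even_mul_pred_self _).two_dvd]
  simp

namespace IsSmoothQuartic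

open scoped Classical in
/-- There are forms vanishing on `s` and, at `p`, not more than that. -/
theorem exists_form_exact {F : Form} (h : IsSmoothQuartic F) (p : Curve F)
    (s : Multiset (Curve F)) (n : ℕ) (hn : s.card ≤ n) :
    ∃ N ∈ formSpace F n s, N ∉ ordIdeal F p.1 (s.count p + 1) := by
  have hexact : ∀ {G : Form}, ¬ F ∣ G → ∀ k, ordAt F p.1 G ≤ k → G ∉ ordIdeal F p.1 (k + 1) := by
    intro G hG k hk hmem
    rw [← h.le_ordAt p hG] at hmem
    lia
  induction s using Multiset.induction_on generalizing n with
  | empty =>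
    obtain ⟨i, hi⟩ := exists_X_notMem_pointIdeal p.1
    have hi' : (X i : Form) ^ n ∉ pointIdeal p.1 := fun h' =>
      hi ((pointIdeal_isPrime p.1).mem_of_pow_mem n h')
    refine ⟨X i ^ n, mem_formSpace.2 ⟨by simpa using (isHomogeneous_X ℂ i).pow n,
      fun q => by simpa using mem_ordIdeal_zero F q.1 _⟩, ?_⟩
    refine hexact (not_dvd_of_notMem p hi') _ ?_
    rw [h.ordAt_eq_zero p hi']
    exact Nat.zero_le _
  | cons q s ih =>
    rw [Multiset.card_cons] at hn
    obtain ⟨m, rfl⟩ := Nat.exists_eq_add_of_le' (show 1 ≤ n by lia)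
    obtain ⟨N, hN, hNp⟩ := ih m (by lia)
    rw [mem_formSpace] at hN
    have hFN : ¬ F ∣ N := fun h' => hNp (mem_ordIdeal_of_dvd _ _ h')
    have hNle : ordAt F p.1 N ≤ s.count p := by
      by_contra! hlt
      exact hNp ((h.le_ordAt p hFN).1 hlt)
    -- Each point of `s` costs one linear factor: a uniformizer if it is `p` itself, otherwise a
    -- line through it that misses `p`. The remaining degree was used up by a coordinate not
    -- vanishing at `p`.
    obtain ⟨a, ha0, haq, hap⟩ : ∃ a : Fin 3 → ℂ, a ≠ 0 ∧ linForm a ∈ ordIdeal F q.1 1 ∧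
        ordAt F p.1 (linForm a) = if p = q then 1 else 0 := by
      by_cases hpq : p = q
      · subst hpq
        obtain ⟨a, ha, ha1, -⟩ := exists_uniformizer h.hom (by norm_num) h.smooth p
        exact ⟨a, ha, by rw [← h.le_ordAt p (h.not_dvd_linForm ha), ha1], by simp [ha1]⟩
      · obtain ⟨a, ha1, ha2⟩ := exists_linForm_separating
          (p := q.1) (q := p.1) (fun h' => hpq (Subtype.ext h'.symm))
        have ha0 : a ≠ 0 := by
          rintro rfl
          exact ha2 (by simp [linForm])
        refine ⟨a, ha0, ?_, by rw [if_neg hpq, h.ordAt_eq_zero p ha2]⟩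
        rwa [← h.le_ordAt q (h.not_dvd_linForm ha0), h.ordAt_pos q (h.not_dvd_linForm ha0)]
    refine ⟨N * linForm a, mem_formSpace.2 ⟨hN.1.mul (linForm_isHomogeneous a), fun r => ?_⟩, ?_⟩
    · rw [Multiset.count_cons]
      refine h.mul_mem_ordIdeal r (hN.2 r) ?_
      split_ifs with hr
      · subst hr; exact haq
      · exact mem_ordIdeal_zero _ _ _
    · refine hexact (h.not_dvd_mul hFN (h.not_dvd_linForm ha0)) _ ?_
      rw [h.ordAt_mul p hFN (h.not_dvd_linForm ha0), hap, Multiset.count_cons]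
      lia

/-- Every further point imposes exactly one condition: at most one by `exists_combination`, at least
one by `exists_form_exact`, which is where the bound on the degree is needed. -/
theorem finrank_formSpace {F : Form} (h : IsSmoothQuartic F) (s : Multiset (Curve F)) (n : ℕ)
    (hn : s.card ≤ n) :
    Module.finrank ℂ (formSpace F n s) + s.card =
      Module.finrank ℂ (homogeneousSubmodule (Fin 3) ℂ n) := by
  classical
  induction s using Multiset.induction_on with
  | empty => rw [formSpace_zero, Multiset.card_zero, add_zero]
  | cons q s ih =>
    rw [Multiset.card_cons] at hn
    rw [← ih (by lia), Multiset.card_cons]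
    obtain ⟨N, hN, hNq⟩ := h.exists_form_exact q s n (by lia)
    have hN' := mem_formSpace.1 hN
    have hle : formSpace F n (q ::ₘ s) ≤ formSpace F n s := by
      intro A hA
      rw [mem_formSpace] at *
      exact ⟨hA.1, fun p => h.ordIdeal_anti p (Multiset.count_le_count_cons p q s) (hA.2 p)⟩
    have hmem : ∀ A ∈ formSpace F n s, A ∈ ordIdeal F q.1 (s.count q + 1) →
        A ∈ formSpace F n (q ::ₘ s) := by
      intro A hA hAq
      rw [mem_formSpace] at *
      refine ⟨hA.1, fun p => ?_⟩
      by_cases hp : p = q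
      · subst hp; rwa [Multiset.count_cons_self]
      · rw [Multiset.count_cons_of_ne hp]; exact hA.2 p
    have hsup : formSpace F n s = formSpace F n (q ::ₘ s) ⊔ Submodule.span ℂ {N} := by
      refine le_antisymm (fun A hA => ?_) (sup_le hle ?_)
      · have hA' := mem_formSpace.1 hA
        obtain ⟨c, c', hcc, hcomb⟩ := exists_combination h.hom (by norm_num) h.smooth q
          hA'.1 hN'.1 (hA'.2 q) (hN'.2 q)
        have hc : c ≠ 0 := by
          rintro rfl
          have hc' : c' ≠ 0 := by simpa using hcc
          apply hNq
          have := Ideal.mul_mem_left _ (C c'⁻¹) hcomb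
          rwa [C_0, zero_mul, zero_add, ← mul_assoc, ← C_mul, inv_mul_cancel₀ hc', C_1,
            one_mul] at this
        have hW : C c * A + C c' * N ∈ formSpace F n (q ::ₘ s) := by
          refine hmem _ ?_ hcomb
          rw [← smul_eq_C_mul, ← smul_eq_C_mul]
          exact add_mem (Submodule.smul_mem _ _ hA) (Submodule.smul_mem _ _ hN)
        have hAeq : A = c⁻¹ • (C c * A + C c' * N) + (-(c⁻¹ * c')) • N := by
          rw [← smul_eq_C_mul, ← smul_eq_C_mul, smul_add, smul_smul, smul_smul,
            inv_mul_cancel₀ hc, one_smul, neg_smul]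
          abel
        rw [hAeq]
        exact add_mem (Submodule.mem_sup_left (Submodule.smul_mem _ _ hW))
          (Submodule.mem_sup_right (Submodule.smul_mem _ _ (Submodule.mem_span_singleton_self N)))
      · rwa [Submodule.span_singleton_le_iff_mem]
    have hN0 : N ≠ 0 := by
      rintro rfl
      exact hNq (zero_mem _)
    have hdisj : formSpace F n (q ::ₘ s) ⊓ Submodule.span ℂ {N} = ⊥ := by
      rw [← disjoint_iff, Submodule.disjoint_span_singleton' hN0]
      intro hNmem
      have := (mem_formSpace.1 hNmem).2 q
      rw [Multiset.count_cons_self] at this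
      exact hNq this
    have hfr := Submodule.finrank_sup_add_finrank_inf_eq (formSpace F n (q ::ₘ s))
      (Submodule.span ℂ {N})
    rw [← hsup, hdisj, finrank_bot, finrank_span_singleton hN0] at hfr
    lia

/-- The forms of degree `m + 4 + g` through the `m` points of the divisor are counted twice. They
have codimension `m`. By Noether they are also the sum of the multiples of `G` and of `F`, which
meet in the multiples of `G * F`. The resulting second difference of `(n + 2)(n + 1) / 2` is `4 *
g`. Putting `m` into the degree makes the `m` conditions independent. -/
theorem card_mdiv {F : Form} (h : IsSmoothQuartic F) {G : Form} {g : ℕ} (hG : G.IsHomogeneous g)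
    (hFG : ¬ F ∣ G) : (mdiv F G).card = 4 * g := by
  classical
  set s := mdiv F G with hs
  have hG0 : G ≠ 0 := fun h0 => hFG (h0 ▸ dvd_zero F)
  have hF0 := h.ne_zero
  set m := s.card
  let H := homogeneousSubmodule (Fin 3) ℂ
  have hmap : ∀ (B : Form), B ≠ 0 → ∀ k,
      Module.finrank ℂ ((H k).map (LinearMap.mulLeft ℂ B)) = Module.finrank ℂ (H k) := by
    intro B hB k
    exact (LinearEquiv.finrank_eq (Submodule.equivMapOfInjective (LinearMap.mulLeft ℂ B)
      (fun x y hxy => mul_left_cancel₀ hB hxy) (H k))).symm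
  have hV : formSpace F (m + 4 + g) s =
      (H (m + 4)).map (LinearMap.mulLeft ℂ G) ⊔ (H (m + g)).map (LinearMap.mulLeft ℂ F) := by
    apply le_antisymm
    · intro A hA
      rw [mem_formSpace] at hA
      obtain ⟨N, hN, w, hw⟩ := h.noether hG hFG (e := m + 4) hA.1 fun p => by
        rw [← h.count_mdiv hFG p]
        exact hA.2 p
      have hFw : (F * w).IsHomogeneous (m + 4 + g) := by
        rw [← hw]; exact hA.1.sub (hN.mul hG)
      have hw' : F * w = F * homogeneousComponent (m + g) w := by
        rw [show m + 4 + g = m + g + 4 by lia] at hFw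
        rw [mul_comm F (homogeneousComponent _ _), ← homogeneousComponent_mul_right h.hom,
          mul_comm w, homogeneousComponent_eq_self hFw]
      rw [show A = G * N + F * homogeneousComponent (m + g) w by
        rw [← hw', ← hw]; ring]
      exact Submodule.add_mem_sup ⟨N, hN, rfl⟩
        ⟨_, homogeneousComponent_isHomogeneous (m + g) w, rfl⟩
    · refine sup_le ?_ ?_
      · rintro _ ⟨N, hN, rfl⟩
        rw [mem_formSpace]
        refine ⟨?_, fun p => ?_⟩
        · rw [LinearMap.mulLeft_apply, mul_comm]; exact IsHomogeneous.mul hN hG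
        · rw [h.count_mdiv hFG, LinearMap.mulLeft_apply]
          exact Ideal.mul_mem_right _ _ (h.mem_ordIdeal_ordAt p G)
      · rintro _ ⟨N, hN, rfl⟩
        rw [mem_formSpace]
        refine ⟨?_, fun p => mem_ordIdeal_of_dvd _ _ (dvd_mul_right _ _)⟩
        rw [LinearMap.mulLeft_apply, mul_comm, show m + 4 + g = m + g + 4 by lia]
        exact IsHomogeneous.mul hN h.hom
  have hinf : (H (m + 4)).map (LinearMap.mulLeft ℂ G) ⊓ (H (m + g)).map (LinearMap.mulLeft ℂ F)
      = (H m).map (LinearMap.mulLeft ℂ (G * F)) := by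
    apply le_antisymm
    · rintro _ ⟨⟨a, ha, rfl⟩, ⟨b, hb, hab⟩⟩
      rw [LinearMap.mulLeft_apply, LinearMap.mulLeft_apply] at hab
      obtain ⟨w, rfl⟩ := (h.prime.dvd_or_dvd (⟨b, hab.symm⟩ : F ∣ G * a)).resolve_left hFG
      refine ⟨homogeneousComponent m w, homogeneousComponent_isHomogeneous m w, ?_⟩
      rw [LinearMap.mulLeft_apply, LinearMap.mulLeft_apply, mul_assoc]
      congr 1
      rw [← homogeneousComponent_eq_self (show (F * w).IsHomogeneous (m + 4) from ha),
        mul_comm F w, homogeneousComponent_mul_right h.hom, mul_comm]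
    · rintro _ ⟨w, hw, rfl⟩
      refine ⟨⟨w * F, IsHomogeneous.mul hw h.hom, ?_⟩, ⟨w * G, IsHomogeneous.mul hw hG, ?_⟩⟩
      · simp only [LinearMap.mulLeft_apply]; ring
      · simp only [LinearMap.mulLeft_apply]; ring
  have h1 := h.finrank_formSpace s (m + 4 + g) (by lia)
  have h2 := Submodule.finrank_sup_add_finrank_inf_eq ((H (m + 4)).map (LinearMap.mulLeft ℂ G))
    ((H (m + g)).map (LinearMap.mulLeft ℂ F))
  rw [← hV, hinf, hmap _ hG0, hmap _ hF0, hmap _ (mul_ne_zero hG0 hF0)] at h2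
  have d1 := finrank_homogeneousSubmodule (m + 4 + g)
  have d2 := finrank_homogeneousSubmodule (m + 4)
  have d3 := finrank_homogeneousSubmodule (m + g)
  have d4 := finrank_homogeneousSubmodule m
  have h3 : 2 * m = 8 * g := by
    change _ + m = _ at h1
    zify at *
    linear_combination 2 * h1 - 2 * h2 + d1 - d2 - d3 + d4
  lia

end IsSmoothQuartic

/-! ### Linear systems -/

open scoped Classical in
/-- The effective divisor `s` is linearly equivalent to `D`. -/
def IsEff (F : Form) (D : Curve F → ℤ) (s : Multiset (Curve F)) : Prop :=
  ∃ (d : ℕ) (A B : Form), A.IsHomogeneous d ∧ B.IsHomogeneous d ∧ ¬ F ∣ A ∧ ¬ F ∣ B ∧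
    ∀ p : Curve F, (s.count p : ℤ) = formDiv F A p - formDiv F B p + D p

theorem formDiv_mul {F : Form} (h : IsSmoothQuartic F) {G H : Form} (hG : ¬ F ∣ G) (hH : ¬ F ∣ H)
    (p : Curve F) : formDiv F (G * H) p = formDiv F G p + formDiv F H p := by
  simp [formDiv, h.ordAt_mul p hG hH]

open scoped Classical in
theorem formDiv_eq_count {F : Form} (h : IsSmoothQuartic F) {G : Form} (hG : ¬ F ∣ G)
    (p : Curve F) : formDiv F G p = ((mdiv F G).count p : ℤ) := by
  rw [formDiv, h.count_mdiv hG]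

open scoped Classical in
theorem exists_effective {F : Form} (h : IsSmoothQuartic F) (D : Divisor F) {A B : Form}
    (hA : ¬ F ∣ A) (hB : ¬ F ∣ B) (hD : ∀ p, 0 ≤ formDiv F A p - formDiv F B p + D p) :
    ∃ s : Multiset (Curve F), ∀ p, (s.count p : ℤ) = formDiv F A p - formDiv F B p + D p := by
  let f : Divisor F := Multiset.toFinsupp (mdiv F A) |>.mapRange (fun n : ℕ => (n : ℤ)) rfl
  let g : Divisor F := Multiset.toFinsupp (mdiv F B) |>.mapRange (fun n : ℕ => (n : ℤ)) rfl
  have hf : ∀ p, f p = formDiv F A p := fun p => by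
    simp [f, formDiv_eq_count h hA]
  have hg : ∀ p, g p = formDiv F B p := fun p => by
    simp [g, formDiv_eq_count h hB]
  refine ⟨Finsupp.toMultiset ((f - g + D).mapRange Int.toNat rfl), fun p => ?_⟩
  rw [Finsupp.count_toMultiset, Finsupp.mapRange_apply, Finsupp.add_apply, Finsupp.sub_apply,
    hf, hg, Int.toNat_of_nonneg (hD p)]

theorem toFrac_mul (F G H : Form) : toFrac F (G * H) = toFrac F G * toFrac F H := by
  simp [toFrac]

theorem toFrac_C_mul (F G : Form) (c : ℂ) : toFrac F (C c * G) = c • toFrac F G := by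
  rw [← smul_eq_C_mul]
  exact ((Algebra.linearMap (Form ⧸ Ideal.span {F}) (FracRing F)).restrictScalars ℂ).map_smul c
    (Ideal.Quotient.mk (Ideal.span {F}) G)

section Frac

variable {F : Form}

theorem toFrac_eq_iff (G H : Form) :
    toFrac F G = toFrac F H ↔ F ∣ G - H := by
  unfold toFrac
  rw [(IsFractionRing.injective (Form ⧸ Ideal.span {F}) (FracRing F)).eq_iff,
    Ideal.Quotient.mk_eq_mk_iff_sub_mem, Ideal.mem_span_singleton]

theorem toFrac_eq_zero_iff (G : Form) : toFrac F G = 0 ↔ F ∣ G := by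
  have := toFrac_eq_iff (F := F) G 0
  rwa [sub_zero, show toFrac F 0 = 0 by simp [toFrac]] at this

theorem isDomain_quotient (h : IsSmoothQuartic F) : IsDomain (Form ⧸ Ideal.span {F}) := by
  have := (Ideal.span_singleton_prime h.ne_zero).2 h.prime
  infer_instance

theorem IsSmoothQuartic.nonempty_curve (h : IsSmoothQuartic F) : Nonempty (Curve F) := by
  obtain ⟨p, hp, -⟩ := exists_common_zero h.hom h.hom (by norm_num) (by norm_num)
  exact ⟨⟨p, hp⟩⟩

open scoped Classical in
-- Needed because `finrank` is 0 on an infinite-dimensional space. A form `B₀` vanishing on the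
-- positive part of `D` is a common denominator: by Noether every section is `N / B₀` with `N` of
-- the fixed degree of `B₀`.
theorem finiteDimensional_rrSpace (h : IsSmoothQuartic F) (D : Divisor F) :
    FiniteDimensional ℂ (rrSpace F D) := by
  have := isDomain_quotient h
  obtain ⟨p⟩ := h.nonempty_curve
  let s : Multiset (Curve F) := Finsupp.toMultiset (D.mapRange Int.toNat rfl)
  obtain ⟨B₀, hB₀, hB₀p⟩ := h.exists_form_exact p s s.card le_rfl
  rw [mem_formSpace] at hB₀
  have hFB₀ : ¬ F ∣ B₀ := fun h' => hB₀p (mem_ordIdeal_of_dvd _ _ h')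
  have hle : ∀ q, D q ≤ ordAt F q.1 B₀ := fun q => by
    have h1 := (h.le_ordAt q hFB₀).2 (hB₀.2 q)
    have h2 : s.count q = (D q).toNat := by
      rw [Finsupp.count_toMultiset, Finsupp.mapRange_apply]
    have := Int.self_le_toNat (D q)
    lia
  let K := FracRing F
  let T : Form →ₗ[ℂ] FracRing F :=
    { toFun := fun N => toFrac F N * (toFrac F B₀)⁻¹
      map_add' := fun x y => by simp [toFrac, add_mul]
      map_smul' := fun c x => by
        rw [smul_eq_C_mul, toFrac_C_mul, RingHom.id_apply, smul_mul_assoc] }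
  refine Submodule.finiteDimensional_of_le
    (S₂ := (homogeneousSubmodule (Fin 3) ℂ s.card).map T) ?_
  rw [rrSpace, Submodule.span_le]
  rintro f ⟨d, A, B, hA, hB, hFA, hFB, hf, hdiv⟩
  obtain ⟨N, hN, hFN⟩ := h.noether (e := s.card) hB hFB
    (by have := hB₀.1.mul hA; exact this) fun q => by
      rw [← h.le_ordAt q (h.not_dvd_mul hFB₀ hFA), h.ordAt_mul q hFB₀ hFA]
      have h1 := hdiv q
      have h2 := hle q
      simp only [formDiv] at h1
      lia
  refine ⟨N, hN, ?_⟩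
  have hB0 : toFrac F B ≠ 0 := by rwa [Ne, toFrac_eq_zero_iff]
  have hB₀0 : toFrac F B₀ ≠ 0 := by rwa [Ne, toFrac_eq_zero_iff]
  rw [← toFrac_eq_iff, toFrac_mul, toFrac_mul, ← hf] at hFN
  change toFrac F N * (toFrac F B₀)⁻¹ = f
  rw [mul_inv_eq_iff_eq_mul₀ hB₀0]
  apply mul_right_cancel₀ hB0
  rw [← hFN]
  ring

theorem h0_pos_iff (h : IsSmoothQuartic F) (D : Divisor F) :
    0 < h0 F D ↔ ∃ s, IsEff F D s := by
  have := isDomain_quotient h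
  have := finiteDimensional_rrSpace h D
  rw [h0, Module.finrank_pos_iff, Submodule.nontrivial_iff_ne_bot]
  constructor
  · intro hne
    by_contra! hcon
    apply hne
    rw [rrSpace, Submodule.span_eq_bot]
    rintro f ⟨d, A, B, hA, hB, hFA, hFB, hf, hdiv⟩
    obtain ⟨s, hs⟩ := exists_effective h D hFA hFB hdiv
    exact (hcon s ⟨d, A, B, hA, hB, hFA, hFB, hs⟩).elim
  · rintro ⟨s, d, A, B, hA, hB, hFA, hFB, hs⟩ hbot
    have hB0 : toFrac F B ≠ 0 := by rwa [Ne, toFrac_eq_zero_iff]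
    have hA0 : toFrac F A ≠ 0 := by rwa [Ne, toFrac_eq_zero_iff]
    rw [rrSpace, Submodule.span_eq_bot] at hbot
    refine div_ne_zero hA0 hB0 (hbot _ ⟨d, A, B, hA, hB, hFA, hFB, div_mul_cancel₀ _ hB0, ?_⟩)
    intro p
    rw [← hs]
    exact Int.natCast_nonneg _

end Frac

open scoped Classical in
/-- Linear equivalence preserves degrees: divisors equivalent to `η + t₁ - t₂`. -/
theorem card_of_isEff {F : Form} (h : IsSmoothQuartic F) {η : Divisor F} (hη : IsThetaChar F η)
    {s t₁ t₂ : Multiset (Curve F)} {D : Curve F → ℤ}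
    (hD : ∀ p, D p = η p + t₁.count p - t₂.count p) (hs : IsEff F D s) :
    s.card + t₂.card = 2 + t₁.card := by
  obtain ⟨d, A, B, hA, hB, hFA, hFB, hs⟩ := hs
  obtain ⟨e, A', B', hA', hB', hFA', hFB', hη⟩ := hη
  -- Only `2η` is compared with `H`, so the relation for `s` is doubled. With the negative terms
  -- moved across, it becomes an equality of multisets to which Bézout applies.
  have key : s + s + mdiv F B' + t₂ + t₂ + mdiv F B + mdiv F B =
      mdiv F (X 0) + mdiv F A' + t₁ + t₁ + mdiv F A + mdiv F A := by
    ext p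
    have h1 := hs p
    have h2 := hη p
    have h3 := hD p
    simp only [lineDiv, formDiv_eq_count h hFA, formDiv_eq_count h hFB, formDiv_eq_count h hFA',
      formDiv_eq_count h hFB', formDiv_eq_count h (h.not_dvd_X 0)] at h1 h2
    simp only [Multiset.count_add]
    lia
  have := congrArg Multiset.card key
  simp only [Multiset.card_add, h.card_mdiv hA hFA, h.card_mdiv hB hFB, h.card_mdiv hA' hFA',
    h.card_mdiv hB' hFB', h.card_mdiv (isHomogeneous_X ℂ 0) (h.not_dvd_X 0)] at this
  lia

open scoped Classical in
theorem mem_ordIdeal_of_le_mdiv {F : Form} (h : IsSmoothQuartic F) {G : Form} (hG : ¬ F ∣ G)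
    {s : Multiset (Curve F)} (hs : s ≤ mdiv F G) (p : Curve F) :
    G ∈ ordIdeal F p.1 (s.count p) := by
  rw [← h.le_ordAt p hG, ← h.count_mdiv hG]
  exact Multiset.count_le_of_le p hs

/-- There is a line cutting out a given effective divisor of degree two. -/
theorem exists_line {F : Form} (h : IsSmoothQuartic F) (a b : Curve F) :
    ∃ c : Fin 3 → ℂ, c ≠ 0 ∧ {a, b} ≤ mdiv F (linForm c) := by
  classical
  obtain ⟨α, β, hαβ, hP⟩ := exists_pointIdeal_eq_span a.1
  have hα0 : α ≠ 0 := hαβ.ne_zero 0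
  have hβ0 : β ≠ 0 := hαβ.ne_zero 1
  have hα : linForm α ∈ ordIdeal F a.1 1 := by
    rw [← h.le_ordAt a (h.not_dvd_linForm hα0),
      h.ordAt_pos a (h.not_dvd_linForm hα0), hP]
    exact Ideal.subset_span (by simp)
  have hβ : linForm β ∈ ordIdeal F a.1 1 := by
    rw [← h.le_ordAt a (h.not_dvd_linForm hβ0),
      h.ordAt_pos a (h.not_dvd_linForm hβ0), hP]
    exact Ideal.subset_span (by simp)
  have hb : ∀ {G}, G ∈ ordIdeal F a.1 1 → G ∈ ordIdeal F b.1 (({a} : Multiset _).count b) := by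
    intro G hG
    by_cases hab : b = a
    · subst hab; simpa using hG
    · rw [Multiset.count_singleton, if_neg hab]; exact mem_ordIdeal_zero _ _ _
  obtain ⟨x, y, hxy, hcomb⟩ := exists_combination h.hom (by norm_num) h.smooth b
    (linForm_isHomogeneous α) (linForm_isHomogeneous β) (hb hα) (hb hβ)
  have hc0 : x • α + y • β ≠ 0 := by
    intro h0
    have := LinearIndependent.pair_iff.1 hαβ x y h0
    simp [this] at hxy
  refine ⟨_, hc0, Multiset.le_iff_count.2 fun q => ?_⟩
  rw [h.count_mdiv (h.not_dvd_linForm hc0), h.le_ordAt q (h.not_dvd_linForm hc0), linForm_add,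
    linForm_smul, linForm_smul]
  rw [show ({a, b} : Multiset (Curve F)) = b ::ₘ {a} from Multiset.cons_swap a b 0]
  by_cases hq : q = b
  · subst hq
    rwa [Multiset.count_cons_self]
  · rw [Multiset.count_cons_of_ne hq]
    by_cases hqa : q = a
    · subst hqa
      rw [Multiset.count_singleton_self]
      exact add_mem (Ideal.mul_mem_left _ _ hα) (Ideal.mul_mem_left _ _ hβ)
    · rw [Multiset.count_singleton, if_neg hqa]; exact mem_ordIdeal_zero _ _ _

theorem exists_combination_of_mem_pointIdeal {p : P2} {a b c : Fin 3 → ℂ}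
    (hab : LinearIndependent ℂ ![a, b]) (ha : linForm a ∈ pointIdeal p)
    (hb : linForm b ∈ pointIdeal p) (hc : linForm c ∈ pointIdeal p) :
    ∃ x y : ℂ, c = x • a + y • b := by
  induction p using Projectivization.ind with
  | h v hv =>
    rw [linForm_mem_pointIdeal_mk] at ha hb hc
    have hsub : Submodule.span ℂ (Set.range ![a, b]) = LinearMap.ker (dotProductBilin ℂ ℂ v) := by
      have hle : Submodule.span ℂ (Set.range ![a, b]) ≤ LinearMap.ker (dotProductBilin ℂ ℂ v) := by
        rw [Submodule.span_le]
        rintro _ ⟨i, rfl⟩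
        fin_cases i
        · simpa [dotProduct_comm] using ha
        · simpa [dotProduct_comm] using hb
      refine Submodule.eq_of_le_of_finrank_le hle ?_
      rw [finrank_span_eq_card hab, Fintype.card_fin]
      have hr := LinearMap.finrank_range_add_finrank_ker (dotProductBilin ℂ ℂ v)
      have hne : dotProductBilin ℂ ℂ v ≠ 0 := by
        intro h0
        apply hv
        ext i
        have := LinearMap.congr_fun h0 (Pi.single i 1)
        simpa using this
      have hpos : 0 < Module.finrank ℂ (LinearMap.range (dotProductBilin ℂ ℂ v)) := by
        rw [Module.finrank_pos_iff, Submodule.nontrivial_iff_ne_bot, Ne, LinearMap.range_eq_bot]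
        exact hne
      rw [Module.finrank_fin_fun] at hr
      lia
    have hcmem : c ∈ Submodule.span ℂ (Set.range ![a, b]) := by
      rw [hsub]
      simpa [dotProduct_comm] using hc
    obtain ⟨f, hf⟩ := (Submodule.mem_span_range_iff_exists_fun ℂ).1 hcmem
    exact ⟨f 0, f 1, by rw [← hf]; simp⟩

/-- The line cutting out a given effective divisor of degree two is unique. -/
theorem line_unique {F : Form} (h : IsSmoothQuartic F) {a b : Curve F} {c c' : Fin 3 → ℂ}
    (hc : c ≠ 0) (hc' : c' ≠ 0) (hab : {a, b} ≤ mdiv F (linForm c))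
    (hab' : {a, b} ≤ mdiv F (linForm c')) : ∃ k : ℂ, c' = k • c := by
  classical
  have hm : ∀ {e : Fin 3 → ℂ}, e ≠ 0 → {a, b} ≤ mdiv F (linForm e) → ∀ q ∈ ({a, b} : Multiset _),
      linForm e ∈ pointIdeal q.1 := by
    intro e he hle q hq
    rw [← h.ordAt_pos q (h.not_dvd_linForm he), ← h.count_mdiv (h.not_dvd_linForm he)]
    exact Multiset.one_le_count_iff_mem.2 (Multiset.mem_of_le hle hq)
  by_cases hne : a = b
  -- Tangent case: two independent lines vanishing doubly at `a` would span all linear forms through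
  -- `a`, including the uniformizer, which has order 1.
  · subst hne
    by_contra! hcon
    have hli : LinearIndependent ℂ ![c, c'] :=
      (LinearIndependent.pair_iff' hc).2 fun k hk => hcon k hk.symm
    obtain ⟨u, hu, hu1, -⟩ := exists_uniformizer h.hom (by norm_num) h.smooth a
    have hua : linForm u ∈ pointIdeal a.1 := by
      rw [← h.ordAt_pos a (h.not_dvd_linForm hu), hu1]
    obtain ⟨x, y, hxy⟩ := exists_combination_of_mem_pointIdeal hli
      (hm hc hab a (by simp)) (hm hc' hab' a (by simp)) hua
    have h2 : linForm u ∈ ordIdeal F a.1 (({a, a} : Multiset _).count a) := by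
      rw [hxy, linForm_add, linForm_smul, linForm_smul]
      exact add_mem
        (Ideal.mul_mem_left _ _ (mem_ordIdeal_of_le_mdiv h (h.not_dvd_linForm hc) hab a))
        (Ideal.mul_mem_left _ _ (mem_ordIdeal_of_le_mdiv h (h.not_dvd_linForm hc') hab' a))
    rw [← h.le_ordAt a (h.not_dvd_linForm hu), hu1] at h2
    simp at h2
  · exact linForm_proportional_of_two_points (fun h' => hne (Subtype.ext h')) hc
      (hm hc hab a (by simp)) (hm hc hab b (by simp)) (hm hc' hab' a (by simp))
      (hm hc' hab' b (by simp))

/-! ### Even theta characteristics and the Scorza correspondence -/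

theorem exists_add_eq_mdiv_linForm {F : Form} (h : IsSmoothQuartic F) (a b : Curve F) :
    ∃ (c : Fin 3 → ℂ) (e f : Curve F), c ≠ 0 ∧ {a, b} + {e, f} = mdiv F (linForm c) := by
  obtain ⟨c, hc, hle⟩ := exists_line h a b
  obtain ⟨t, ht⟩ := Multiset.le_iff_exists_add.1 hle
  have hcard : t.card = 2 := by
    have := congrArg Multiset.card ht
    rw [h.card_mdiv (linForm_isHomogeneous c) (h.not_dvd_linForm hc), Multiset.card_add] at this
    simp only [Multiset.insert_eq_cons, Multiset.card_cons, Multiset.card_singleton] at this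
    lia
  obtain ⟨e, f, rfl⟩ := Multiset.card_eq_two.1 hcard
  exact ⟨c, e, f, hc, ht.symm⟩

theorem isEff_of_section {F : Form} (h : IsSmoothQuartic F) (D : Divisor F) {d : ℕ} {A B : Form}
    (hA : A.IsHomogeneous d) (hB : B.IsHomogeneous d) (hFA : ¬ F ∣ A) (hFB : ¬ F ∣ B)
    (hD : ∀ p, 0 ≤ formDiv F A p - formDiv F B p + D p) : ∃ s, IsEff F D s := by
  obtain ⟨s, hs⟩ := exists_effective h D hFA hFB hD
  exact ⟨s, d, A, B, hA, hB, hFA, hFB, hs⟩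

theorem finrank_le_one_of_le_span_singleton {V : Type*} [AddCommGroup V] [Module ℂ V]
    {W : Submodule ℂ V} {x : V} (hW : W ≤ Submodule.span ℂ {x}) : Module.finrank ℂ W ≤ 1 := by
  have : FiniteDimensional ℂ (Submodule.span ℂ {x}) := FiniteDimensional.span_singleton ℂ x
  refine (Submodule.finrank_mono hW).trans ((finrank_span_le_card _).trans ?_)
  simp

theorem eq_smul_div_of_dvd {K : Type*} [Field K] [Algebra ℂ K] {a b a' b' f : K} {k : ℂ}
    (hb : b ≠ 0) (hb' : b' ≠ 0) (hf : f * b' = a') (hk : a' * b = k • (a * b')) :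
    k • (a / b) = f := by
  rw [← smul_div_assoc, div_eq_iff hb]
  apply mul_right_cancel₀ hb'
  rw [smul_mul_assoc, ← hk, ← hf]
  ring

/-- If all sections of `D` are proportional, then `h⁰(D) ≤ 1`. -/
theorem h0_le_one {F : Form} (h : IsSmoothQuartic F) {D : Divisor F} {A B : Form}
    (hFB : ¬ F ∣ B)
    (hprop : ∀ (d : ℕ) (A' B' : Form), A'.IsHomogeneous d → B'.IsHomogeneous d → ¬ F ∣ A' →
      ¬ F ∣ B' → (∀ p, 0 ≤ formDiv F A' p - formDiv F B' p + D p) →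
      ∃ k : ℂ, F ∣ A' * B - C k * (A * B')) : h0 F D ≤ 1 := by
  have := isDomain_quotient h
  have hle : rrSpace F D ≤ Submodule.span ℂ {toFrac F A / toFrac F B} := by
    rw [rrSpace, Submodule.span_le]
    rintro f ⟨d, A', B', hA', hB', hFA', hFB', hf, hdiv⟩
    obtain ⟨k, hk⟩ := hprop d A' B' hA' hB' hFA' hFB' hdiv
    rw [← toFrac_eq_iff, toFrac_C_mul, toFrac_mul, toFrac_mul] at hk
    exact Submodule.mem_span_singleton.2 ⟨k, eq_smul_div_of_dvd
      (by rwa [Ne, toFrac_eq_zero_iff]) (by rwa [Ne, toFrac_eq_zero_iff]) hf hk⟩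
  exact finrank_le_one_of_le_span_singleton hle

/-- An even theta characteristic on a smooth plane quartic is not effective. -/
theorem not_isEff_of_even {F : Form} (h : IsSmoothQuartic F) {η : Divisor F}
    (hη : IsThetaChar F η) (heven : Even (h0 F η)) (s : Multiset (Curve F)) : ¬ IsEff F η s := by
  classical
  intro hs
  have hpos : 0 < h0 F η := (h0_pos_iff h η).2 ⟨s, hs⟩
  have hcard : s.card = 2 := by
    have := card_of_isEff h hη (t₁ := 0) (t₂ := 0) (fun p => by simp) hs
    simpa using this
  obtain ⟨d, A, B, hA, hB, hFA, hFB, hsdiv⟩ := id hs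
  obtain ⟨a, b, rfl⟩ := Multiset.card_eq_two.1 hcard
  obtain ⟨c, e, g, hc, hline⟩ := exists_add_eq_mdiv_linForm h a b
  have hFc := h.not_dvd_linForm hc
  have hle1 : h0 F η ≤ 1 := by
    -- The line through `s = a + b` leaves the residual pair `e + g`. For any other section, with
    -- divisor `s'`, the sum `s' + e + g` is equivalent to `H`, so Noether produces a line cutting
    -- it out. Both lines cut out `e + g`, hence coincide, and the sections are proportional.
    refine h0_le_one h (A := A) hFB fun d' A' B' hA' hB' hFA' hFB' hdiv => ?_
    obtain ⟨s', hs'⟩ := exists_effective h η hFA' hFB' hdiv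
    have hden := h.not_dvd_mul hFB' hFA
    have hnum := h.not_dvd_mul (h.not_dvd_mul hFA' hFB) hFc
    have hordeq : ∀ p, (ordAt F p.1 (A' * B * linForm c) : ℤ) =
        ordAt F p.1 (B' * A) + s'.count p + ({e, g} : Multiset _).count p := by
      intro p
      rw [h.ordAt_mul p (h.not_dvd_mul hFA' hFB) hFc, h.ordAt_mul p hFA' hFB,
        h.ordAt_mul p hFB' hFA, ← h.count_mdiv hFc, ← hline, Multiset.count_add]
      have h1 := hsdiv p
      have h2 := hs' p
      simp only [formDiv] at h1 h2
      push_cast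
      linarith
    obtain ⟨N, hN, hFN⟩ := h.noether (e := 1) (hB'.mul hA) hden
      (by have := (linForm_isHomogeneous c).mul (hA'.mul hB)
          rwa [mul_comm (linForm c)] at this) fun p => by
        rw [← h.le_ordAt p hnum]
        have := hordeq p
        lia
    obtain ⟨c', rfl⟩ := exists_eq_linForm hN
    have hFc' : ¬ F ∣ linForm c' := by
      intro h'
      apply hnum
      have := dvd_add hFN (h'.mul_right (B' * A))
      rwa [sub_add_cancel] at this
    have hc' : c' ≠ 0 := by
      rintro rfl
      exact hFc' (by simp [linForm])
    have hline' : s' + {e, g} = mdiv F (linForm c') := by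
      ext p
      have h1 := hordeq p
      rw [ordAt_congr p hFN, h.ordAt_mul p hFc' hden] at h1
      rw [h.count_mdiv hFc', Multiset.count_add]
      lia
    obtain ⟨k, rfl⟩ := line_unique h hc hc' (a := e) (b := g)
      (by rw [← hline]; exact Multiset.le_add_left _ _)
      (by rw [← hline']; exact Multiset.le_add_left _ _)
    refine ⟨k, (h.prime.dvd_or_dvd (a := linForm c) ?_).resolve_left hFc⟩
    rw [linForm_smul] at hFN
    convert! hFN using 1
    ring
  obtain ⟨k, hk⟩ := heven
  lia

open scoped Classical in
/-- If `η` is not effective, `η + x` is equivalent to at most one effective divisor. -/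
theorem isEff_unique {F : Form} (h : IsSmoothQuartic F) {η : Divisor F}
    (hno : ∀ s, ¬ IsEff F η s) (x : Curve F) {D : Curve F → ℤ}
    (hD : ∀ p, D p = η p + ({x} : Multiset (Curve F)).count p)
    {s s' : Multiset (Curve F)} (hs : IsEff F D s) (hs' : IsEff F D s') : s = s' := by
  obtain ⟨d, A, B, hA, hB, hFA, hFB, hs⟩ := hs
  obtain ⟨d', A', B', hA', hB', hFA', hFB', hs'⟩ := hs'
  have hU := h.not_dvd_mul hFA hFB'
  have hV := h.not_dvd_mul hFA' hFB
  have hW := h.not_dvd_mul hFB hFB'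
  have hUhom := hA.mul hB'
  have hVhom : (A' * B).IsHomogeneous (d + d') := by rw [add_comm]; exact hA'.mul hB
  have hUord : ∀ p, (ordAt F p.1 (A * B') : ℤ) = ordAt F p.1 (B * B') - D p + s.count p := by
    intro p
    have h1 := hs p
    simp only [formDiv] at h1
    rw [h.ordAt_mul p hFA hFB', h.ordAt_mul p hFB hFB']
    push_cast
    lia
  have hVord : ∀ p, (ordAt F p.1 (A' * B) : ℤ) = ordAt F p.1 (B * B') - D p + s'.count p := by
    intro p
    have h1 := hs' p
    simp only [formDiv] at h1
    rw [h.ordAt_mul p hFA' hFB, h.ordAt_mul p hFB hFB']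
    push_cast
    lia
  -- Over the common denominator `B * B'`, a combination of the two sections gains one more zero at
  -- `x` and so becomes a section of `η`. It must vanish on the curve, which makes the two sections
  -- proportional.
  obtain ⟨c, c', hcc, hcomb⟩ := exists_combination h.hom (by norm_num) h.smooth x
    (n := ((ordAt F x.1 (B * B') : ℤ) - D x).toNat) hUhom hVhom
    (by rw [← h.le_ordAt x hU]; have := hUord x; lia)
    (by rw [← h.le_ordAt x hV]; have := hVord x; lia)
  have hdvd : F ∣ C c * (A * B') + C c' * (A' * B) := by
    by_contra hT
    obtain ⟨t, ht⟩ := isEff_of_section h η ((hUhom.C_mul c).add (hVhom.C_mul c'))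
      (hB.mul hB') hT hW fun p => by
        have hDp := hD p
        by_cases hp : p = x
        · subst hp
          rw [Multiset.count_singleton_self] at hDp
          have h1 := (h.le_ordAt p hT).2 hcomb
          simp only [formDiv]
          lia
        · rw [Multiset.count_singleton, if_neg hp] at hDp
          have h1 : ((ordAt F p.1 (B * B') : ℤ) - D p).toNat ≤
              ordAt F p.1 (C c * (A * B') + C c' * (A' * B)) := by
            rw [h.le_ordAt p hT]
            refine add_mem (Ideal.mul_mem_left _ _ ?_) (Ideal.mul_mem_left _ _ ?_)
            · rw [← h.le_ordAt p hU]; have := hUord p; lia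
            · rw [← h.le_ordAt p hV]; have := hVord p; lia
          simp only [formDiv]
          lia
    exact hno t ht
  have hunit : ∀ {e : ℂ}, e ≠ 0 → IsUnit (C e : Form) := fun he =>
    IsUnit.map (C : ℂ →+* Form) (isUnit_iff_ne_zero.2 he)
  have hc : c ≠ 0 := by
    rintro rfl
    have hc' : c' ≠ 0 := by simpa using hcc
    rw [C_0, zero_mul, zero_add, (hunit hc').dvd_mul_left] at hdvd
    exact hV hdvd
  have hc' : c' ≠ 0 := by
    rintro rfl
    rw [C_0, zero_mul, add_zero, (hunit hc).dvd_mul_left] at hdvd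
    exact hU hdvd
  have hnC : ∀ {e : ℂ}, e ≠ 0 → ¬ F ∣ C e := fun he hd =>
    h.prime.not_isUnit (isUnit_of_dvd_unit hd (hunit he))
  have hC0 : ∀ {e : ℂ}, e ≠ 0 → ∀ p : Curve F, ordAt F p.1 (C e) = 0 := fun he p =>
    h.ordAt_eq_zero p fun hmem =>
      (pointIdeal_isPrime p.1).ne_top (Ideal.eq_top_of_isUnit_mem _ hmem (hunit he))
  ext p
  have h1 : ordAt F p.1 (C c * (A * B')) = ordAt F p.1 (C (-c') * (A' * B)) :=
    ordAt_congr p (by rwa [C_neg, neg_mul, sub_neg_eq_add])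
  rw [h.ordAt_mul p (hnC hc) hU, h.ordAt_mul p (hnC (neg_ne_zero.2 hc')) hV, hC0 hc,
    hC0 (neg_ne_zero.2 hc')] at h1
  have := hUord p
  have := hVord p
  lia

open scoped Classical in
/-- If `s ∼ η + x - y` and `s + t` is a line section, then `t ∼ η + y - x`. -/
theorem isEff_residual {F : Form} (h : IsSmoothQuartic F) {η : Divisor F} (hη : IsThetaChar F η)
    {D D' : Curve F → ℤ} (hD : ∀ p, D p + D' p = 2 * η p) {s t : Multiset (Curve F)}
    (hs : IsEff F D s) {c : Fin 3 → ℂ} (hc : c ≠ 0) (hst : s + t = mdiv F (linForm c)) :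
    IsEff F D' t := by
  obtain ⟨d, A, B, hA, hB, hFA, hFB, hs⟩ := hs
  obtain ⟨e, A', B', hA', hB', hFA', hFB', hη⟩ := hη
  have hFc := h.not_dvd_linForm hc
  have hFX := h.not_dvd_X (F := F) 0
  refine ⟨1 + d + e, linForm c * B * B', X 0 * A * A',
    ((linForm_isHomogeneous c).mul hB).mul hB', ((isHomogeneous_X ℂ 0).mul hA).mul hA',
    h.not_dvd_mul (h.not_dvd_mul hFc hFB) hFB', h.not_dvd_mul (h.not_dvd_mul hFX hFA) hFA',
    fun p => ?_⟩
  rw [formDiv_mul h (h.not_dvd_mul hFc hFB) hFB', formDiv_mul h hFc hFB,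
    formDiv_mul h (h.not_dvd_mul hFX hFA) hFA', formDiv_mul h hFX hFA, formDiv_eq_count h hFc,
    ← hst, Multiset.count_add]
  have h1 := hs p
  have h2 := hη p
  have h3 := hD p
  simp only [lineDiv] at h2
  push_cast
  linarith

/-- The function `η + x - y`. -/
theorem mem_scorza_iff {F : Form} (h : IsSmoothQuartic F) (η : Divisor F) (x y : Curve F) :
    (x, y) ∈ scorza F η ↔
      ∃ s, IsEff F (η + Finsupp.single x 1 - Finsupp.single y 1 : Divisor F) s :=
  h0_pos_iff h _

/-- For a pair in the Scorza correspondence, the effective divisors equivalent to `η + x - y`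
and `η + y - x` add up to a line section. -/
theorem scorza_line {F : Form} (h : IsSmoothQuartic F) {η : Divisor F} (hη : IsThetaChar F η)
    {x y : Curve F} (hxy : (x, y) ∈ scorza F η) :
    ∃ (c : Fin 3 → ℂ) (a b e f : Curve F), c ≠ 0 ∧ {a, b} + {e, f} = mdiv F (linForm c) ∧
      IsEff F (η + Finsupp.single x 1 : Divisor F) {y, a, b} ∧
      IsEff F (η + Finsupp.single y 1 : Divisor F) {x, e, f} ∧ (y, x) ∈ scorza F η := by
  classical
  obtain ⟨s, hs⟩ := (mem_scorza_iff h η x y).1 hxy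
  have hcard := card_of_isEff h hη (t₁ := {x}) (t₂ := {y}) (fun p => by
    simp [Multiset.count_singleton, Finsupp.single_apply, eq_comm]) hs
  simp only [Multiset.card_singleton] at hcard
  obtain ⟨a, b, rfl⟩ := Multiset.card_eq_two.1 (show s.card = 2 by lia)
  -- Any line through `a + b` will do: its residual pair has class `H - (η + x - y) = η + y - x`.
  -- This also gives the symmetry of the correspondence.
  obtain ⟨c, e, f, hc, hline⟩ := exists_add_eq_mdiv_linForm h a b
  have hres : IsEff F (η + Finsupp.single y 1 - Finsupp.single x 1 : Divisor F) {e, f} :=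
    isEff_residual h hη (fun p => by simp; ring) hs hc hline
  have hadd : ∀ {u v : Curve F} {t : Multiset (Curve F)},
      IsEff F (η + Finsupp.single u 1 - Finsupp.single v 1 : Divisor F) t →
      IsEff F (η + Finsupp.single u 1 : Divisor F) (v ::ₘ t) := by
    rintro u v t ⟨d, A, B, hA, hB, hFA, hFB, ht⟩
    refine ⟨d, A, B, hA, hB, hFA, hFB, fun p => ?_⟩
    have := ht p
    rw [Multiset.count_cons]
    simp only [Finsupp.coe_sub, Finsupp.coe_add, Pi.sub_apply, Pi.add_apply,
      Finsupp.single_apply] at this ⊢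
    by_cases hpv : p = v
    · simp only [if_pos hpv, if_pos hpv.symm] at this ⊢
      push_cast; linarith
    · simp only [if_neg hpv, if_neg (Ne.symm hpv)] at this ⊢
      push_cast; linarith
  exact ⟨c, a, b, e, f, hc, hline, hadd hs, hadd hres, (mem_scorza_iff h η y x).2 ⟨_, hres⟩⟩

/-! ### Forms vanishing at many points of a line -/

theorem exists_eq_mul_of_dvd {G l : Form} {d e : ℕ} (hG : G.IsHomogeneous (d + e))
    (hl : l.IsHomogeneous e) (h : l ∣ G) : ∃ G', G'.IsHomogeneous d ∧ G = G' * l := by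
  obtain ⟨w, rfl⟩ := h
  refine ⟨homogeneousComponent d w, homogeneousComponent_isHomogeneous d w, ?_⟩
  rw [← homogeneousComponent_mul_right hl, mul_comm w, homogeneousComponent_eq_self hG]

/-- Induction on the degree instead of a parametrization of the line. At one of the points `G = u a
+ w m` with `m` a second line through it. Since `m` misses the other points, `w` vanishes there and
has degree one less. -/
theorem linForm_dvd_of_card_lt {a : Fin 3 → ℂ} (ha : a ≠ 0) {d : ℕ} {G : Form}
    (hG : G.IsHomogeneous d) (S : Finset P2) (hd : d < S.card)
    (hS : ∀ p ∈ S, linForm a ∈ pointIdeal p ∧ G ∈ pointIdeal p) : linForm a ∣ G := by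
  classical
  induction d generalizing G S with
  | zero =>
    obtain ⟨p, hp⟩ := Finset.card_pos.1 hd
    by_contra hndvd
    have hG0 : G ≠ 0 := fun h => hndvd (h ▸ dvd_zero _)
    exact (pointIdeal_isPrime p).ne_top (Ideal.eq_top_of_isUnit_mem _ (hS p hp).2
      (isUnit_of_isHomogeneous_zero hG hG0))
  | succ d ih =>
    obtain ⟨p, hp⟩ := Finset.card_pos.1 ((Nat.zero_le _).trans_lt hd)
    obtain ⟨α, β, hαβ, hP⟩ := exists_pointIdeal_eq_span p
    have hαP : linForm α ∈ pointIdeal p := by rw [hP]; exact Ideal.subset_span (by simp)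
    have hβP : linForm β ∈ pointIdeal p := by rw [hP]; exact Ideal.subset_span (by simp)
    obtain ⟨m, hm, hmP⟩ : ∃ m, LinearIndependent ℂ ![a, m] ∧ linForm m ∈ pointIdeal p := by
      by_contra! hcon
      have h1 : ∀ m, linForm m ∈ pointIdeal p → ∃ k : ℂ, k • a = m := fun m hm => by
        by_contra! hk
        exact hcon m ((LinearIndependent.pair_iff' ha).2 hk) hm
      obtain ⟨k, hk⟩ := h1 α hαP
      obtain ⟨k', hk'⟩ := h1 β hβP
      have h2 := LinearIndependent.pair_iff.1 hαβ k' (-k) (by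
        rw [← hk, ← hk', smul_smul, smul_smul, ← add_smul]
        ring_nf
        simp)
      have hα0 : α ≠ 0 := hαβ.ne_zero 0
      apply hα0
      rw [← hk, neg_eq_zero.1 h2.2, zero_smul]
    have hP' : pointIdeal p = Ideal.span {linForm a, linForm m} := by
      have hc : ∀ c, linForm c ∈ pointIdeal p → linForm c ∈ Ideal.span {linForm a, linForm m} := by
        intro c hc
        obtain ⟨x, y, rfl⟩ := exists_combination_of_mem_pointIdeal hm (hS p hp).1 hmP hc
        rw [linForm_add, linForm_smul, linForm_smul]
        exact add_mem (Ideal.mul_mem_left _ _ (Ideal.subset_span (by simp)))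
          (Ideal.mul_mem_left _ _ (Ideal.subset_span (by simp)))
      apply le_antisymm
      · rw [hP, Ideal.span_le]
        rintro _ (rfl | rfl)
        · exact hc _ hαP
        · exact hc _ hβP
      · rw [Ideal.span_le]
        rintro _ (rfl | rfl)
        · exact (hS p hp).1
        · exact hmP
    have hGp := (hS p hp).2
    rw [hP', Ideal.mem_span_pair] at hGp
    obtain ⟨u, w, huw⟩ := hGp
    have hcomp := congrArg (homogeneousComponent (d + 1)) huw
    rw [map_add, homogeneousComponent_mul_right (linForm_isHomogeneous a),
      homogeneousComponent_mul_right (linForm_isHomogeneous m),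
      homogeneousComponent_eq_self hG] at hcomp
    rw [← hcomp]
    refine dvd_add (dvd_mul_left _ _) (dvd_mul_of_dvd_left ?_ _)
    refine ih (homogeneousComponent_isHomogeneous d w) (S.erase p)
      (by rw [Finset.card_erase_of_mem hp]; lia) fun q hq => ?_
    have hqS := hS q (Finset.mem_of_mem_erase hq)
    refine ⟨hqS.1, ?_⟩
    have hmul : homogeneousComponent d w * linForm m ∈ pointIdeal q := by
      rw [eq_sub_of_add_eq' hcomp]
      exact sub_mem hqS.2 (Ideal.mul_mem_left _ _ hqS.1)
    refine ((pointIdeal_isPrime q).mem_or_mem hmul).resolve_right fun hmq => ?_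
    obtain ⟨k, hk⟩ := linForm_proportional_of_two_points (Finset.ne_of_mem_erase hq).symm ha
      (hS p hp).1 hqS.1 hmP hmq
    exact (LinearIndependent.pair_iff' ha).1 hm k hk.symm

/-! ### Heptagons -/

/-- An equation of a line. -/
noncomputable def lineForm (ℓ : P2) : Form := linForm ℓ.rep

theorem lineForm_isHomogeneous (ℓ : P2) : (lineForm ℓ).IsHomogeneous 1 := linForm_isHomogeneous _

theorem lineForm_mem_iff (ℓ p : P2) : lineForm ℓ ∈ pointIdeal p ↔ p.orthogonal ℓ := by
  rw [lineForm, linForm_mem_pointIdeal_iff _ ℓ.rep_nonzero, Projectivization.mk_rep]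

theorem eq_cross_of_mem {ℓ m p : P2} (hne : ℓ ≠ m) (h1 : lineForm ℓ ∈ pointIdeal p)
    (h2 : lineForm m ∈ pointIdeal p) : p = ℓ.cross m := by
  have h3 : lineForm ℓ ∈ pointIdeal (ℓ.cross m) := by
    rw [lineForm_mem_iff]; exact Projectivization.cross_orthogonal_left hne
  have h4 : lineForm m ∈ pointIdeal (ℓ.cross m) := by
    rw [lineForm_mem_iff]; exact Projectivization.cross_orthogonal_right hne
  by_contra hp
  obtain ⟨k, hk⟩ := linForm_proportional_of_two_points hp ℓ.rep_nonzero h1 h3 h2 h4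
  apply hne
  rw [← ℓ.mk_rep, ← m.mk_rep, Projectivization.mk_eq_mk_iff']
  have hk0 : k ≠ 0 := by
    rintro rfl
    exact m.rep_nonzero (by rw [hk, zero_smul])
  exact ⟨k⁻¹, by rw [hk, smul_smul, inv_mul_cancel₀ hk0, one_smul]⟩

theorem meet_comm (L : Fin 7 → P2) (i j : Fin 7) : meet L i j = meet L j i :=
  Projectivization.cross_comm _ _

section Heptagon

variable {L : Fin 7 → P2}

theorem heptagon_injective (hL : L ∈ heptagons) : Function.Injective L := by
  intro i j hij
  by_contra hne
  obtain ⟨k, hik, hjk⟩ : ∃ k, i ≠ k ∧ j ≠ k := by clear hij hne; revert i j; decide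
  obtain ⟨p, hp, hp'⟩ := exists_common_zero (lineForm_isHomogeneous (L i))
    (lineForm_isHomogeneous (L k)) one_ne_zero one_ne_zero
  rw [lineForm_mem_iff] at hp hp'
  exact hL i j k hne hik hjk ⟨p, hp, hij ▸ hp, hp'⟩

theorem lineForm_mem_meet_left (hL : L ∈ heptagons) {i j : Fin 7} (hij : i ≠ j) :
    lineForm (L i) ∈ pointIdeal (meet L i j) := by
  rw [lineForm_mem_iff]
  exact Projectivization.cross_orthogonal_left fun h => hij (heptagon_injective hL h)

theorem lineForm_mem_meet_right (hL : L ∈ heptagons) {i j : Fin 7} (hij : i ≠ j) :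
    lineForm (L j) ∈ pointIdeal (meet L i j) := by
  rw [meet_comm]
  exact lineForm_mem_meet_left hL hij.symm

theorem lineForm_notMem_meet (hL : L ∈ heptagons) {i j k : Fin 7} (hij : i ≠ j) (hik : i ≠ k)
    (hjk : j ≠ k) : lineForm (L k) ∉ pointIdeal (meet L i j) := by
  intro hk
  refine hL i j k hij hik hjk ⟨meet L i j, ?_, ?_, ?_⟩
  · rw [← lineForm_mem_iff]; exact lineForm_mem_meet_left hL hij
  · rw [← lineForm_mem_iff]; exact lineForm_mem_meet_right hL hij
  · rwa [← lineForm_mem_iff]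

theorem meet_injective (hL : L ∈ heptagons) {i j k : Fin 7} (hij : i ≠ j) (hik : i ≠ k)
    (h : meet L i j = meet L i k) : j = k := by
  by_contra hjk
  exact lineForm_notMem_meet hL hij hik hjk (h ▸ lineForm_mem_meet_right hL hik)

theorem eq_meet_of_mem (hL : L ∈ heptagons) {i j : Fin 7} (hij : i ≠ j) {p : P2}
    (hi : lineForm (L i) ∈ pointIdeal p) (hj : lineForm (L j) ∈ pointIdeal p) :
    p = meet L i j :=
  eq_cross_of_mem (fun h => hij (heptagon_injective hL h)) hi hj

/-- A form vanishing at too many vertices on a line of the heptagon is divisible by the equation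
of this line. -/
theorem exists_eq_mul_lineForm (hL : L ∈ heptagons) {d : ℕ} {G : Form}
    (hG : G.IsHomogeneous (d + 1)) (i : Fin 7) (J : Finset (Fin 7)) (hiJ : i ∉ J)
    (hJ : d + 1 < J.card) (hv : ∀ j ∈ J, G ∈ pointIdeal (meet L i j)) :
    ∃ G', G'.IsHomogeneous d ∧ G = G' * lineForm (L i) := by
  classical
  refine exists_eq_mul_of_dvd hG (lineForm_isHomogeneous _) ?_
  have hij : ∀ j ∈ J, i ≠ j := fun j hj h => hiJ (h ▸ hj)
  refine linForm_dvd_of_card_lt (L i).rep_nonzero hG (J.image (meet L i)) ?_ ?_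
  · rwa [Finset.card_image_of_injOn]
    intro j hj k hk hjk
    exact meet_injective hL (hij j hj) (hij k hk) hjk
  · intro p hp
    obtain ⟨j, hj, rfl⟩ := Finset.mem_image.1 hp
    exact ⟨lineForm_mem_meet_left hL (hij j hj), hv j hj⟩

theorem mem_meet_of_mul (hL : L ∈ heptagons) {G : Form} {i j k : Fin 7}
    (h : i ≠ j ∧ i ≠ k ∧ j ≠ k) (hG : G * lineForm (L k) ∈ pointIdeal (meet L i j)) :
    G ∈ pointIdeal (meet L i j) :=
  ((pointIdeal_isPrime _).mem_or_mem hG).resolve_right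
    (lineForm_notMem_meet hL h.1 h.2.1 h.2.2)

/-- Only uniqueness needs an argument. The vertex `p_01` is not on `F`, as otherwise the line `L 0`
would carry five points of the quartic and split off. So a multiple of `F` can be subtracted to make
a competing quartic vanish at `p_01` as well, and the difference turns out to be zero. -/
theorem isAdjointQuartic_of_vanishes {F : Form} (h : IsSmoothQuartic F) (hL : L ∈ heptagons)
    (hv : VanishesOnResidual L F) : IsAdjointQuartic L F := by
  refine ⟨h.hom, h.ne_zero, hv, fun G hG hGv => ?_⟩
  have hF01 : F ∉ pointIdeal (meet L 0 1) := by
    intro h01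
    obtain ⟨G', hG', hFG'⟩ := exists_eq_mul_lineForm hL (d := 3) h.hom 0 {1, 2, 3, 4, 5}
      (by decide) (by decide) (by
        intro j hj
        by_cases hj1 : j = 1
        · rw [hj1]; exact h01
        · exact hv (0, j) (by revert j; decide))
    have hG'0 : G' ≠ 0 := by
      rintro rfl
      exact h.ne_zero (by rw [hFG', zero_mul])
    rcases h.prime.irreducible.isUnit_or_isUnit hFG' with hu | hu
    · have := hG'.inj_right (totalDegree_zero_iff_isHomogeneous (Fin 3) |>.1
        (isUnit_iff_totalDegree_of_isReduced.1 hu).2) hG'0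
      lia
    · exact (linForm_prime (L 0).rep_nonzero).not_isUnit hu
  obtain ⟨w, hw, hpw⟩ : ∃ w hw, meet L 0 1 = Projectivization.mk ℂ w hw :=
    ⟨_, _, (Projectivization.mk_rep _).symm⟩
  rw [hpw, mem_pointIdeal_iff_eval w hw h.hom] at hF01
  set c := eval w G / eval w F with hc
  refine ⟨c, ?_⟩
  set K := G - C c * F with hK
  have hK4 : K.IsHomogeneous 4 := hG.sub (h.hom.C_mul c)
  have hKv : ∀ ij ∈ residualPairs, K ∈ pointIdeal (meet L ij.1 ij.2) := fun ij hij =>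
    sub_mem (hGv ij hij) (Ideal.mul_mem_left _ _ (hv ij hij))
  have hK01 : K ∈ pointIdeal (meet L 0 1) := by
    rw [hpw, mem_pointIdeal_iff_eval w hw hK4]
    simp [hK, hc, hF01]
  -- The lines `L 0, L 1, L 2, L 3` split off one after another, having 5, 4, 3 and 2 known zeros
  -- against degrees 4, 3, 2 and 1. The constant that remains vanishes at `p_46`.
  obtain ⟨K₃, hK₃, e₃⟩ := exists_eq_mul_lineForm hL (d := 3) hK4 0 {1, 2, 3, 4, 5}
    (by decide) (by decide) (by
      intro j hj
      by_cases hj1 : j = 1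
      · rw [hj1]; exact hK01
      · exact hKv (0, j) (by clear_value K; clear hK01; revert j; decide))
  have hv₃ : ∀ i j : Fin 7, (i, j) ∈ residualPairs → (i ≠ j ∧ i ≠ 0 ∧ j ≠ 0) →
      K₃ ∈ pointIdeal (meet L i j) := fun i j hij h' =>
    mem_meet_of_mul hL h' (e₃ ▸ hKv (i, j) hij)
  obtain ⟨K₂, hK₂, e₂⟩ := exists_eq_mul_lineForm hL (d := 2) hK₃ 1 {3, 4, 5, 6}
    (by decide) (by decide) (fun j hj => hv₃ 1 j (by revert j; decide) (by revert j; decide))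
  have hv₂ : ∀ i j : Fin 7, (i, j) ∈ residualPairs → (i ≠ j ∧ i ≠ 0 ∧ j ≠ 0) →
      (i ≠ j ∧ i ≠ 1 ∧ j ≠ 1) → K₂ ∈ pointIdeal (meet L i j) := fun i j hij h0 h1 =>
    mem_meet_of_mul hL h1 (e₂ ▸ hv₃ i j hij h0)
  obtain ⟨K₁, hK₁, e₁⟩ := exists_eq_mul_lineForm hL (d := 1) hK₂ 2 {4, 5, 6}
    (by decide) (by decide) (fun j hj => hv₂ 2 j (by revert j; decide) (by revert j; decide)
      (by revert j; decide))
  obtain ⟨K₀, hK₀, e₀⟩ := exists_eq_mul_lineForm hL (d := 0) hK₁ 3 {5, 6}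
    (by decide) (by decide) (fun j hj => mem_meet_of_mul hL (k := 2) (by revert j; decide)
      (e₁ ▸ hv₂ 3 j (by revert j; decide) (by revert j; decide) (by revert j; decide)))
  have h46 : K₀ ∈ pointIdeal (meet L 4 6) :=
    mem_meet_of_mul hL (k := 3) (by decide) (e₀ ▸ mem_meet_of_mul hL (k := 2) (by decide)
      (e₁ ▸ hv₂ 4 6 (by decide) (by decide) (by decide)))
  have hK0 : K₀ = 0 := by
    by_contra hne
    exact (pointIdeal_isPrime _).ne_top (Ideal.eq_top_of_isUnit_mem _ h46
      (isUnit_of_isHomogeneous_zero hK₀ hne))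
  have : K = 0 := by rw [e₃, e₂, e₁, e₀, hK0]; ring
  exact sub_eq_zero.1 this

end Heptagon

/-! ### Residual divisors and the Scorza correspondence -/

open scoped Classical in
/-- The multiplicity of the vertex `p_ij` at the point `p`. -/
noncomputable def vertexMult {F : Form} (L : Fin 7 → P2) (i j : Fin 7) (p : Curve F) : ℤ :=
  if p.1 = meet L i j then 1 else 0

theorem vertexMult_comm {F : Form} (L : Fin 7 → P2) (i j : Fin 7) (p : Curve F) :
    vertexMult L i j p = vertexMult L j i p := by
  rw [vertexMult, vertexMult, meet_comm]

theorem residualDivisor_apply {F : Form} (L : Fin 7 → P2) (p : Curve F) :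
    residualDivisor F L p = ∑ ij ∈ residualPairs, vertexMult L ij.1 ij.2 p := by
  classical
  rw [residualDivisor, Finsupp.subtypeDomain_apply, Finsupp.finsetSum_apply]
  refine Finset.sum_congr rfl fun ij _ => ?_
  rw [Finsupp.single_apply, vertexMult]
  simp [eq_comm]

/-- The combinatorics of the residual points on three consecutive lines. -/
theorem sum_three_lines (δ : Fin 7 → Fin 7 → ℤ) (hδ : ∀ i j, δ i j = δ j i) (ℓ : Fin 7 → ℤ)
    (hℓ : ∀ i, ℓ i = δ i (i + 2) + δ i (i + 3) + δ i (i + 4) + δ i (i + 5)) (k : Fin 7) :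
    ℓ (3 * k) + ℓ (3 * k + 1) + ℓ (3 * k + 2) = (∑ ij ∈ residualPairs, δ ij.1 ij.2)
      + δ (3 * k) (3 * k + 2) - δ (3 * k + 3) (3 * k + 5) - δ (3 * k + 4) (3 * k + 6)
      - δ (3 * k + 3) (3 * k + 6) := by
  have hsum : ∑ ij ∈ residualPairs, δ ij.1 ij.2 = δ 0 2 + δ 0 3 + δ 0 4 + δ 0 5 + δ 1 3 + δ 1 4
      + δ 1 5 + δ 1 6 + δ 2 4 + δ 2 5 + δ 2 6 + δ 3 5 + δ 3 6 + δ 4 6 := by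
    simp [residualPairs, Finset.sum_insert]
    ring
  have h0 : ℓ 0 = δ 0 2 + δ 0 3 + δ 0 4 + δ 0 5 := hℓ 0
  have h1 : ℓ 1 = δ 1 3 + δ 1 4 + δ 1 5 + δ 1 6 := hℓ 1
  have h2 : ℓ 2 = δ 2 4 + δ 2 5 + δ 2 6 + δ 0 2 := by rw [hδ 0 2]; exact hℓ 2
  have h3 : ℓ 3 = δ 3 5 + δ 3 6 + δ 0 3 + δ 1 3 := by rw [hδ 0 3, hδ 1 3]; exact hℓ 3
  have h4 : ℓ 4 = δ 4 6 + δ 0 4 + δ 1 4 + δ 2 4 := by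
    rw [hδ 0 4, hδ 1 4, hδ 2 4]; exact hℓ 4
  have h5 : ℓ 5 = δ 0 5 + δ 1 5 + δ 2 5 + δ 3 5 := by
    rw [hδ 0 5, hδ 1 5, hδ 2 5, hδ 3 5]; exact hℓ 5
  have h6 : ℓ 6 = δ 1 6 + δ 2 6 + δ 3 6 + δ 4 6 := by
    rw [hδ 1 6, hδ 2 6, hδ 3 6, hδ 4 6]; exact hℓ 6
  rw [hsum]
  have hk : ∀ a b c d e f g : Fin 7, 3 * k = a → 3 * k + 1 = b → 3 * k + 2 = c → 3 * k + 3 = d →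
      3 * k + 4 = e → 3 * k + 5 = f → 3 * k + 6 = g →
      ℓ a + ℓ b + ℓ c = (δ 0 2 + δ 0 3 + δ 0 4 + δ 0 5 + δ 1 3 + δ 1 4
      + δ 1 5 + δ 1 6 + δ 2 4 + δ 2 5 + δ 2 6 + δ 3 5 + δ 3 6 + δ 4 6)
      + δ a c - δ d f - δ e g - δ d g → ℓ (3 * k) + ℓ (3 * k + 1) + ℓ (3 * k + 2) =
      δ 0 2 + δ 0 3 + δ 0 4 + δ 0 5 + δ 1 3 + δ 1 4
      + δ 1 5 + δ 1 6 + δ 2 4 + δ 2 5 + δ 2 6 + δ 3 5 + δ 3 6 + δ 4 6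
      + δ (3 * k) (3 * k + 2) - δ (3 * k + 3) (3 * k + 5) - δ (3 * k + 4) (3 * k + 6)
      - δ (3 * k + 3) (3 * k + 6) := by
    rintro a b c d e f g rfl rfl rfl rfl rfl rfl rfl h
    exact h
  fin_cases k
  · exact hk 0 1 2 3 4 5 6 rfl rfl rfl rfl rfl rfl rfl (by linarith)
  · exact hk 3 4 5 6 0 1 2 rfl rfl rfl rfl rfl rfl rfl (by
      linarith [hδ 6 1, hδ 0 2, hδ 6 2])
  · exact hk 6 0 1 2 3 4 5 rfl rfl rfl rfl rfl rfl rfl (by linarith [hδ 6 1])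
  · exact hk 2 3 4 5 6 0 1 rfl rfl rfl rfl rfl rfl rfl (by
      linarith [hδ 5 0, hδ 6 1, hδ 5 1])
  · exact hk 5 6 0 1 2 3 4 rfl rfl rfl rfl rfl rfl rfl (by linarith [hδ 5 0])
  · exact hk 1 2 3 4 5 6 0 rfl rfl rfl rfl rfl rfl rfl (by
      linarith [hδ 5 0, hδ 4 0])
  · exact hk 4 5 6 0 1 2 3 rfl rfl rfl rfl rfl rfl rfl (by linarith)

section Residual

variable {F : Form} {L : Fin 7 → P2} {η : Divisor F}

theorem vanishesOnResidual_iff (L : Fin 7 → P2) (F : Form) : VanishesOnResidual L F ↔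
    ∀ i, F ∈ pointIdeal (meet L i (i + 2)) ∧ F ∈ pointIdeal (meet L i (i + 3)) := by
  constructor
  · intro hv i
    have key : ∀ i j : Fin 7, (i, j) ∈ residualPairs ∨ (j, i) ∈ residualPairs →
        F ∈ pointIdeal (meet L i j) := by
      rintro i j (hij | hij)
      · exact hv (i, j) hij
      · rw [meet_comm]; exact hv (j, i) hij
    exact ⟨key _ _ (by revert i; decide), key _ _ (by revert i; decide)⟩
  · rintro h ⟨i, j⟩ hij
    have : j = i + 2 ∨ j = i + 3 ∨ i = j + 2 ∨ i = j + 3 := by revert i j; decide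
    rcases this with rfl | rfl | rfl | rfl
    · exact (h i).1
    · exact (h i).2
    · rw [meet_comm]; exact (h j).1
    · rw [meet_comm]; exact (h j).2

theorem mem_meet_of_vanishes (hv : VanishesOnResidual L F) {i j : Fin 7}
    (hij : j = i + 2 ∨ j = i + 3 ∨ i = j + 2 ∨ i = j + 3) : F ∈ pointIdeal (meet L i j) := by
  rw [vanishesOnResidual_iff] at hv
  rcases hij with rfl | rfl | rfl | rfl
  · exact (hv i).1
  · exact (hv i).2
  · rw [meet_comm]; exact (hv j).1
  · rw [meet_comm]; exact (hv j).2

open scoped Classical in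
theorem count_mk_eq_vertexMult {i j : Fin 7} (hij : F ∈ pointIdeal (meet L i j)) (p : Curve F) :
    ((({⟨meet L i j, hij⟩} : Multiset (Curve F)).count p : ℕ) : ℤ) = vertexMult L i j p := by
  rw [Multiset.count_singleton, vertexMult]
  simp [Subtype.ext_iff]

/-- The four residual points on a line of the heptagon make up its intersection with the adjoint
curve. -/
theorem formDiv_lineForm (h : IsSmoothQuartic F) (hL : L ∈ heptagons)
    (hv : VanishesOnResidual L F) (i : Fin 7) (p : Curve F) :
    formDiv F (lineForm (L i)) p = vertexMult L i (i + 2) p + vertexMult L i (i + 3) p +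
      vertexMult L i (i + 4) p + vertexMult L i (i + 5) p := by
  classical
  have hF : ∀ j : Fin 7, j = i + 2 ∨ j = i + 3 ∨ j = i + 4 ∨ j = i + 5 →
      F ∈ pointIdeal (meet L i j) := fun j hj => mem_meet_of_vanishes hv (by
        revert i j; decide)
  have hi : ∀ j : Fin 7, j = i + 2 ∨ j = i + 3 ∨ j = i + 4 ∨ j = i + 5 → i ≠ j := by
    clear hF; revert i; decide
  have hFl : ¬ F ∣ lineForm (L i) := h.not_dvd_linForm (L i).rep_nonzero
  let P : ∀ j : Fin 7, (j = i + 2 ∨ j = i + 3 ∨ j = i + 4 ∨ j = i + 5) → Curve F := fun j hj =>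
    ⟨meet L i j, hF j hj⟩
  have hP : ∀ j k hj hk, j ≠ k → P j hj ≠ P k hk := fun j k hj hk hjk hPjk =>
    hjk (meet_injective hL (hi j hj) (hi k hk) (congrArg Subtype.val hPjk))
  have e2 : i + 2 = i + 2 ∨ i + 2 = i + 3 ∨ i + 2 = i + 4 ∨ i + 2 = i + 5 := by simp
  have e3 : i + 3 = i + 2 ∨ i + 3 = i + 3 ∨ i + 3 = i + 4 ∨ i + 3 = i + 5 := by simp
  have e4 : i + 4 = i + 2 ∨ i + 4 = i + 3 ∨ i + 4 = i + 4 ∨ i + 4 = i + 5 := by simp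
  have e5 : i + 5 = i + 2 ∨ i + 5 = i + 3 ∨ i + 5 = i + 4 ∨ i + 5 = i + 5 := by simp
  -- Four distinct points inside a divisor of degree four exhaust it, so each has multiplicity one.
  have hs : ({P _ e2} + {P _ e3} + {P _ e4} + {P _ e5} : Multiset (Curve F)) =
      mdiv F (lineForm (L i)) := by
    refine Multiset.eq_of_le_of_card_le ?_ ?_
    · refine (Multiset.le_iff_subset ?_).2 ?_
      · simp only [Multiset.singleton_add, Multiset.nodup_cons, Multiset.mem_cons,
          Multiset.mem_singleton, Multiset.nodup_singleton, Multiset.cons_add, not_or, and_true]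
        exact ⟨⟨hP _ _ e2 e3 (by simp), hP _ _ e2 e4 (by simp), hP _ _ e2 e5 (by simp)⟩,
          ⟨hP _ _ e3 e4 (by simp), hP _ _ e3 e5 (by simp)⟩, hP _ _ e4 e5 (by simp)⟩
      · intro q hq
        have hmem : ∀ j hj, P j hj ∈ mdiv F (lineForm (L i)) := fun j hj => by
          rw [← Multiset.one_le_count_iff_mem, h.count_mdiv hFl, h.ordAt_pos _ hFl]
          exact lineForm_mem_meet_left hL (hi j hj)
        simp only [Multiset.mem_add, Multiset.mem_singleton] at hq
        rcases hq with ((rfl | rfl) | rfl) | rfl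
        exacts [hmem _ e2, hmem _ e3, hmem _ e4, hmem _ e5]
    · rw [h.card_mdiv (lineForm_isHomogeneous _) hFl]
      simp
  rw [formDiv_eq_count h hFl, ← hs]
  simp only [Multiset.count_add]
  push_cast
  rw [count_mk_eq_vertexMult, count_mk_eq_vertexMult, count_mk_eq_vertexMult,
    count_mk_eq_vertexMult]

/-- The product of three consecutive lines of a heptagon. -/
noncomputable def tripleForm (L : Fin 7 → P2) (k : Fin 7) : Form :=
  lineForm (L (3 * k)) * lineForm (L (3 * k + 1)) * lineForm (L (3 * k + 2))

theorem tripleForm_isHomogeneous (L : Fin 7 → P2) (k : Fin 7) :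
    (tripleForm L k).IsHomogeneous 3 :=
  ((lineForm_isHomogeneous _).mul (lineForm_isHomogeneous _)).mul (lineForm_isHomogeneous _)

theorem not_dvd_tripleForm (h : IsSmoothQuartic F) (L : Fin 7 → P2) (k : Fin 7) :
    ¬ F ∣ tripleForm L k :=
  h.not_dvd_mul (h.not_dvd_mul (h.not_dvd_linForm (L _).rep_nonzero)
    (h.not_dvd_linForm (L _).rep_nonzero)) (h.not_dvd_linForm (L _).rep_nonzero)

theorem formDiv_tripleForm (h : IsSmoothQuartic F) (hL : L ∈ heptagons)
    (hv : VanishesOnResidual L F) (k : Fin 7) (p : Curve F) :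
    formDiv F (tripleForm L k) p = residualDivisor F L p + vertexMult L (3 * k) (3 * k + 2) p
      - vertexMult L (3 * k + 3) (3 * k + 5) p - vertexMult L (3 * k + 4) (3 * k + 6) p
      - vertexMult L (3 * k + 3) (3 * k + 6) p := by
  have hl : ∀ i, ¬ F ∣ lineForm (L i) := fun i => h.not_dvd_linForm (L i).rep_nonzero
  rw [tripleForm, formDiv_mul h (h.not_dvd_mul (hl _) (hl _)) (hl _),
    formDiv_mul h (hl _) (hl _), residualDivisor_apply]
  exact sum_three_lines (fun i j => vertexMult L i j p) (fun i j => vertexMult_comm L i j p)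
    (fun i => formDiv F (lineForm (L i)) p) (fun i => formDiv_lineForm h hL hv i p) k

/-- The cube of the coordinate defining `lineDiv`. -/
theorem formDiv_X_pow (h : IsSmoothQuartic F) (p : Curve F) :
    formDiv F (X 0 ^ 3) p = 3 * lineDiv F p := by
  have hX := h.not_dvd_X 0
  rw [pow_succ, pow_two, formDiv_mul h (h.not_dvd_mul hX hX) hX, formDiv_mul h hX hX, lineDiv]
  ring

theorem not_dvd_X_pow (h : IsSmoothQuartic F) : ¬ F ∣ X 0 ^ 3 := fun hd =>
  h.not_dvd_X 0 (h.prime.dvd_of_dvd_pow hd)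

open scoped Classical in
/-- The residual divisor of a heptagon is equivalent to `3H + η` if and only if `η + p_{i-1,i+1}`
is equivalent to the sum of the residual points not on the lines `i - 1, i, i + 1`. -/
theorem linEquiv_residualDivisor_iff (h : IsSmoothQuartic F) (hL : L ∈ heptagons)
    (hv : VanishesOnResidual L F) (k : Fin 7) {D : Curve F → ℤ} {s : Multiset (Curve F)}
    (hD : ∀ p, D p = η p + vertexMult L (3 * k) (3 * k + 2) p)
    (hs : ∀ p, (s.count p : ℤ) = vertexMult L (3 * k + 3) (3 * k + 5) p +
      vertexMult L (3 * k + 4) (3 * k + 6) p + vertexMult L (3 * k + 3) (3 * k + 6) p) :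
    LinEquiv F (residualDivisor F L) (fun p => 3 * lineDiv F p + η p) ↔ IsEff F D s := by
  have hT := not_dvd_tripleForm h L k
  have hX := not_dvd_X_pow h
  have hXh : (X 0 ^ 3 : Form).IsHomogeneous 3 := isHomogeneous_X_pow 0 3
  have hTh := tripleForm_isHomogeneous L k
  constructor
  · rintro ⟨d, A, B, hA, hB, hFA, hFB, hAB⟩
    -- The function is multiplied by the cube of a coordinate over the product of three lines, whose
    -- divisor trades `R - 3H` for four residual points. The other direction uses the inverse
    -- factor.
    refine ⟨d + 3, A * X 0 ^ 3, B * tripleForm L k, hA.mul hXh, hB.mul hTh,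
      h.not_dvd_mul hFA hX, h.not_dvd_mul hFB hT, fun p => ?_⟩
    rw [formDiv_mul h hFA hX, formDiv_mul h hFB hT, formDiv_X_pow h,
      formDiv_tripleForm h hL hv, hs, hD]
    linarith [hAB p]
  · rintro ⟨d, A, B, hA, hB, hFA, hFB, hAB⟩
    refine ⟨d + 3, A * tripleForm L k, B * X 0 ^ 3, hA.mul hTh, hB.mul hXh,
      h.not_dvd_mul hFA hT, h.not_dvd_mul hFB hX, fun p => ?_⟩
    rw [formDiv_mul h hFA hT, formDiv_mul h hFB hX, formDiv_X_pow h,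
      formDiv_tripleForm h hL hv]
    have h1 := hAB p
    rw [hs, hD] at h1
    linarith

theorem mem_scorza_of_isEff (h : IsSmoothQuartic F) {x y : Curve F} {t : Multiset (Curve F)}
    (ht : IsEff F (η + Finsupp.single x 1 : Divisor F) (y ::ₘ t)) : (x, y) ∈ scorza F η := by
  classical
  rw [mem_scorza_iff h]
  obtain ⟨d, A, B, hA, hB, hFA, hFB, ht⟩ := ht
  refine ⟨t, d, A, B, hA, hB, hFA, hFB, fun p => ?_⟩
  have := ht p
  rw [Multiset.count_cons] at this
  simp only [Finsupp.coe_sub, Finsupp.coe_add, Pi.sub_apply, Pi.add_apply,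
    Finsupp.single_apply] at this ⊢
  by_cases hp : p = y
  · simp only [if_pos hp, if_pos hp.symm] at this ⊢
    push_cast at this; linarith
  · simp only [if_neg hp, if_neg (Ne.symm hp)] at this ⊢
    push_cast at this; linarith

end Residual

/-- With this formula and `linesOfPoints_apply`, seven cases become one cyclic argument.
Multiplication by 3 and by 5 are inverse modulo 7, which is why `I` and `J` undo each other. -/
theorem innerPoints_apply (L : Fin 7 → P2) (k : Fin 7) :
    innerPoints L k = meet L (3 * k) (3 * k + 2) := by
  fin_cases k
  · rfl
  · rfl
  · exact meet_comm L 1 6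
  · rfl
  · exact meet_comm L 0 5
  · rfl
  · rfl

theorem join_comm (x : Fin 7 → P2) (i j : Fin 7) : join x i j = join x j i :=
  Projectivization.cross_comm _ _

theorem linesOfPoints_apply (x : Fin 7 → P2) (i : Fin 7) :
    linesOfPoints x i = join x (5 * i) (5 * i + 4) := by
  fin_cases i
  · rfl
  · exact join_comm x 2 5
  · exact join_comm x 0 3
  · rfl
  · exact join_comm x 3 6
  · exact join_comm x 1 4
  · rfl

theorem mem_linesDomain_iff (x : Fin 7 → P2) :
    x ∈ linesDomain ↔ ∀ k : Fin 7, x k ≠ x (k + 4) := by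
  constructor
  · rintro ⟨h0, h1, h2, h3, h4, h5, h6⟩ k
    fin_cases k
    · exact h0
    · exact h3
    · exact h6
    · exact h2.symm
    · exact h5.symm
    · exact h1.symm
    · exact h4.symm
  · intro h
    exact ⟨h 0, (h 5).symm, (h 3).symm, h 1, (h 6).symm, (h 4).symm, h 2⟩

/-! ### The bijection -/

theorem lineForm_mem_innerPoints {L : Fin 7 → P2} (hL : L ∈ heptagons) (k : Fin 7) :
    lineForm (L (3 * k)) ∈ pointIdeal (innerPoints L k) ∧
      lineForm (L (3 * k + 2)) ∈ pointIdeal (innerPoints L k) := by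
  have hk : 3 * k ≠ 3 * k + 2 := by revert k; decide
  rw [innerPoints_apply]
  exact ⟨lineForm_mem_meet_left hL hk, lineForm_mem_meet_right hL hk⟩

theorem innerPoints_mem_linesDomain {L : Fin 7 → P2} (hL : L ∈ heptagons) :
    innerPoints L ∈ linesDomain := by
  rw [mem_linesDomain_iff]
  intro k hk
  have h1 : 3 * k ≠ 3 * k + 2 := by clear hk; revert k; decide
  have h2 : 3 * (k + 4) = 3 * k + 5 := by clear hk h1; revert k; decide
  have h3 : 3 * (k + 4) + 2 = 3 * k := by clear hk h1 h2; revert k; decide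
  have h4 : 3 * k ≠ 3 * k + 5 := by clear hk h1 h2 h3; revert k; decide
  have h5 : 3 * k + 2 ≠ 3 * k + 5 := by clear hk h1 h2 h3 h4; revert k; decide
  rw [innerPoints_apply, innerPoints_apply, h3, h2, meet_comm L (3 * k + 5)] at hk
  exact h5 (meet_injective hL h1 h4 hk)

theorem linesOfPoints_innerPoints {L : Fin 7 → P2} (hL : L ∈ heptagons) :
    linesOfPoints (innerPoints L) = L := by
  ext1 i
  have hne := (mem_linesDomain_iff _).1 (innerPoints_mem_linesDomain hL) (5 * i)
  have h1 : 3 * (5 * i) = i := by clear hne; revert i; decide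
  have h2 : 3 * (5 * i + 4) + 2 = i := by clear hne h1; revert i; decide
  have hl := (lineForm_mem_innerPoints hL (5 * i)).1
  have hr := (lineForm_mem_innerPoints hL (5 * i + 4)).2
  rw [h1] at hl
  rw [h2] at hr
  rw [linesOfPoints_apply, join]
  symm
  apply eq_cross_of_mem hne
  · rw [lineForm_mem_iff] at hl ⊢
    exact Projectivization.orthogonal_comm.1 hl
  · rw [lineForm_mem_iff] at hr ⊢
    exact Projectivization.orthogonal_comm.1 hr

theorem innerPoints_linesOfPoints {x : Fin 7 → P2} (hx : x ∈ linesPreimage) :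
    innerPoints (linesOfPoints x) = x := by
  ext1 k
  have hdom := (mem_linesDomain_iff _).1 hx.1
  have h1 : 5 * (3 * k) = k := by revert k; decide
  have h2 : 5 * (3 * k + 2) = k + 3 := by clear h1; revert k; decide
  have h3 : k + 3 + 4 = k := by clear h1 h2; revert k; decide
  have h4 : 3 * k ≠ 3 * k + 2 := by clear h1 h2 h3; revert k; decide
  rw [innerPoints_apply]
  symm
  apply eq_meet_of_mem hx.2 h4
  · rw [lineForm_mem_iff, linesOfPoints_apply, h1, Projectivization.orthogonal_comm]
    exact Projectivization.cross_orthogonal_left (hdom k)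
  · have := hdom (k + 3)
    rw [h3] at this
    rw [lineForm_mem_iff, linesOfPoints_apply, h2, h3, Projectivization.orthogonal_comm]
    exact Projectivization.cross_orthogonal_right this

section

variable {F : Form} {η : Divisor F}

open scoped Classical in
theorem count_singleton_eq_vertexMult {L : Fin 7 → P2} {i j : Fin 7} {q : Curve F}
    (hq : q.1 = meet L i j) (p : Curve F) :
    ((({q} : Multiset (Curve F)).count p : ℕ) : ℤ) = vertexMult L i j p := by
  rw [Multiset.count_singleton, vertexMult, ← hq]
  simp [Subtype.ext_iff]

theorem single_eq_vertexMult {L : Fin 7 → P2} {i j : Fin 7} {q : Curve F}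
    (hq : q.1 = meet L i j) (p : Curve F) :
    (Finsupp.single q 1 : Divisor F) p = vertexMult L i j p := by
  classical
  rw [Finsupp.single_apply, vertexMult, ← hq]
  simp [Subtype.ext_iff, eq_comm]

/-- The condition on the residual divisor in terms of the points of `C` at the residual points. -/
theorem linEquiv_iff_isEff (h : IsSmoothQuartic F) {L : Fin 7 → P2} (hL : L ∈ heptagons)
    (hv : VanishesOnResidual L F) (k : Fin 7) {y : Fin 7 → Curve F} {z : Curve F}
    (hy : ∀ k, (y k : P2) = innerPoints L k) (hz : (z : P2) = meet L (3 * k + 3) (3 * k + 6)) :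
    LinEquiv F (residualDivisor F L) (fun p => 3 * lineDiv F p + η p) ↔
      IsEff F (η + Finsupp.single (y k) 1 : Divisor F) {y (k + 1), y (k + 6), z} := by
  classical
  have h1 : 3 * (k + 1) = 3 * k + 3 := by clear hz; revert k; decide
  have h2 : 3 * (k + 6) = 3 * k + 4 := by clear hz h1; revert k; decide
  have h3 : 3 * k + 3 + 2 = 3 * k + 5 := by clear hz h1 h2; revert k; decide
  have h4 : 3 * k + 4 + 2 = 3 * k + 6 := by clear hz h1 h2 h3; revert k; decide
  have hy0 : (y k : P2) = meet L (3 * k) (3 * k + 2) := (hy k).trans (innerPoints_apply L k)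
  have hy1 : (y (k + 1) : P2) = meet L (3 * k + 3) (3 * k + 5) := by
    rw [hy, innerPoints_apply, h1, h3]
  have hy2 : (y (k + 6) : P2) = meet L (3 * k + 4) (3 * k + 6) := by
    rw [hy, innerPoints_apply, h2, h4]
  refine linEquiv_residualDivisor_iff h hL hv k (fun p => ?_) fun p => ?_
  · rw [Finsupp.add_apply, single_eq_vertexMult hy0]
  · rw [← count_singleton_eq_vertexMult hy1, ← count_singleton_eq_vertexMult hy2,
      ← count_singleton_eq_vertexMult hz, Multiset.insert_eq_cons, Multiset.insert_eq_cons,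
      ← Multiset.singleton_add, ← Multiset.singleton_add, Multiset.count_add, Multiset.count_add]
    push_cast
    ring

theorem innerPoints_mem_scorzaHeptagons (h : IsSmoothQuartic F) {L : Fin 7 → P2}
    (hL : L ∈ adjFibre F η) : innerPoints L ∈ scorzaHeptagons F η := by
  obtain ⟨hL, hA, hR⟩ := hL
  have hv := hA.2.2.1
  let y : Fin 7 → Curve F := fun k => ⟨innerPoints L k, by
    rw [innerPoints_apply]; exact mem_meet_of_vanishes hv (Or.inl rfl)⟩
  have key : ∀ k, (y k, y (k + 1)) ∈ scorza F η ∧ (y k, y (k + 6)) ∈ scorza F η := by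
    intro k
    let z : Curve F := ⟨meet L (3 * k + 3) (3 * k + 6), mem_meet_of_vanishes hv (by
      revert k; decide)⟩
    have hE := (linEquiv_iff_isEff h hL hv k (y := y) (z := z) (fun _ => rfl) rfl).1 hR
    refine ⟨mem_scorza_of_isEff h hE, ?_⟩
    rw [Multiset.insert_eq_cons, Multiset.insert_eq_cons, Multiset.cons_swap] at hE
    exact mem_scorza_of_isEff h hE
  refine ⟨⟨y, ⟨⟨⟨⟨⟨⟨(key 0).1, (key 1).1⟩, (key 2).1⟩, (key 3).1⟩, (key 4).1⟩, (key 5).1⟩,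
    (key 0).2⟩, fun _ => rfl⟩, innerPoints_mem_linesDomain hL, ?_⟩
  rwa [linesOfPoints_innerPoints hL]

/-- Each of `y` and `y'` lies in some effective divisor equivalent to `η + x`. There is only one
such divisor and it has degree three. -/
theorem exists_third_point (h : IsSmoothQuartic F) (hη : IsThetaChar F η)
    (hno : ∀ s, ¬ IsEff F η s) {x y y' : Curve F} (hy : (x, y) ∈ scorza F η)
    (hy' : (x, y') ∈ scorza F η) (hne : y ≠ y') :
    ∃ z, IsEff F (η + Finsupp.single x 1 : Divisor F) {y, y', z} := by
  classical
  obtain ⟨-, a, b, -, -, -, -, hE, -⟩ := scorza_line h hη hy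
  obtain ⟨-, a', b', -, -, -, -, hE', -⟩ := scorza_line h hη hy'
  have heq := isEff_unique h hno x (D := (η + Finsupp.single x 1 : Divisor F)) (fun p => by
    simp [Multiset.count_singleton, Finsupp.single_apply, eq_comm]) hE hE'
  have hmem : y' ∈ ({y, a, b} : Multiset (Curve F)) := by rw [heq]; simp
  simp only [Multiset.insert_eq_cons, Multiset.mem_cons, Multiset.mem_singleton] at hmem
  rcases hmem with rfl | rfl | rfl
  · exact absurd rfl hne
  · exact ⟨b, hE⟩
  · refine ⟨a, ?_⟩
    rwa [Multiset.pair_comm]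

theorem mem_adjFibre_of_scorza (h : IsSmoothQuartic F) (hη : IsThetaChar F η)
    (heven : Even (h0 F η)) {L : Fin 7 → P2} (hL : L ∈ heptagons) {y : Fin 7 → Curve F}
    (hy : ∀ k, (y k : P2) = innerPoints L k) (hT : y ∈ T7 F η) : L ∈ adjFibre F η := by
  classical
  have hno := not_isEff_of_even h hη heven
  have hsymm : ∀ {x y : Curve F}, (x, y) ∈ scorza F η → (y, x) ∈ scorza F η := fun hxy => by
    obtain ⟨-, -, -, -, -, -, -, -, -, hyx⟩ := scorza_line h hη hxy
    exact hyx
  have hS : ∀ k, (y k, y (k + 1)) ∈ scorza F η := by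
    obtain ⟨⟨⟨⟨⟨⟨h0, h1⟩, h2⟩, h3⟩, h4⟩, h5⟩, h6⟩ := hT
    intro k
    fin_cases k
    exacts [h0, h1, h2, h3, h4, h5, hsymm h6]
  have e61 : ∀ k : Fin 7, k + 6 + 1 = k := by decide
  have e16 : ∀ k : Fin 7, k + 1 + 6 = k := by decide
  have e11 : ∀ k : Fin 7, k + 1 + 1 = k + 2 := by decide
  have hS' : ∀ k, (y k, y (k + 6)) ∈ scorza F η := fun k => by
    have := hsymm (hS (k + 6))
    rwa [e61] at this
  have hmem0 : ∀ k, lineForm (L (3 * k)) ∈ pointIdeal (y k : P2) := fun k => by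
    rw [hy]; exact (lineForm_mem_innerPoints hL k).1
  have hmem2 : ∀ k, lineForm (L (3 * k + 2)) ∈ pointIdeal (y k : P2) := fun k => by
    rw [hy]; exact (lineForm_mem_innerPoints hL k).2
  have hthree : ∀ {i j k : Fin 7}, i ≠ j → i ≠ k → j ≠ k → ∀ p,
      lineForm (L i) ∈ pointIdeal p → lineForm (L j) ∈ pointIdeal p →
      lineForm (L k) ∈ pointIdeal p → False := fun hij hik hjk p hi hj hk => by
    rw [lineForm_mem_iff] at hi hj hk
    exact hL _ _ _ hij hik hjk ⟨p, hi, hj, hk⟩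
  -- Coinciding neighbours would put a third line of the heptagon through the point.
  have hne : ∀ k, y (k + 1) ≠ y (k + 6) := fun k heq => by
    refine hthree (i := 3 * (k + 1)) (j := 3 * (k + 1) + 2) (k := 3 * (k + 6)) ?_ ?_ ?_
      (y (k + 1)) (hmem0 _) (hmem2 _) (by rw [heq]; exact hmem0 _) <;>
    · clear * -; revert k; decide
  choose z hz using fun k => exists_third_point h hη hno (hS k) (hS' k) (hne k)
  have hD : ∀ (x p : Curve F), (η + Finsupp.single x 1 : Divisor F) p =
      η p + ({x} : Multiset (Curve F)).count p := fun x p => by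
    simp [Multiset.count_singleton, Finsupp.single_apply, eq_comm]
  have hline : ∀ k, lineForm (L (3 * k + 6)) ∈ pointIdeal (z k : P2) ∧
      lineForm (L (3 * k + 6)) ∈ pointIdeal (z (k + 1) : P2) := by
    intro k
    obtain ⟨c, a, b, e, f, hc, hm, hE, hE', -⟩ := scorza_line h hη (hS k)
    have hab := isEff_unique h hno (y k) (hD _) hE (hz k)
    have hz' := hz (k + 1)
    rw [e16, e11, Multiset.insert_eq_cons, Multiset.insert_eq_cons, Multiset.cons_swap] at hz'
    have hef := isEff_unique h hno (y (k + 1)) (hD _) hE' hz'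
    simp only [Multiset.insert_eq_cons, Multiset.cons_inj_right] at hab hef hm
    rw [hab, hef] at hm
    have hFc := h.not_dvd_linForm hc
    have hcm : ∀ q ∈ mdiv F (linForm c), linForm c ∈ pointIdeal q.1 := fun q hq => by
      rwa [← Multiset.one_le_count_iff_mem, h.count_mdiv hFc, h.ordAt_pos _ hFc] at hq
    rw [← hm] at hcm
    have h1 := hcm (y (k + 6)) (by simp)
    have h2 := hcm (y (k + 2)) (by simp)
    have hyne : (y (k + 6) : P2) ≠ y (k + 2) := fun heq => by
      refine hthree (i := 3 * (k + 6)) (j := 3 * (k + 6) + 2) (k := 3 * (k + 2) + 2) ?_ ?_ ?_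
        (y (k + 6)) (hmem0 _) (hmem2 _) (by rw [heq]; exact hmem2 _) <;>
      · clear * -; revert k; decide
    have h3 := hmem2 (k + 6)
    have h4 := hmem0 (k + 2)
    rw [show 3 * (k + 6) + 2 = 3 * k + 6 by clear * -; revert k; decide] at h3
    rw [show 3 * (k + 2) = 3 * k + 6 by clear * -; revert k; decide] at h4
    -- The line from `scorza_line` and `L (3 * k + 6)` share the distinct points `y (k + 6)` and `y
    -- (k + 2)`, so they are equal.
    obtain ⟨t, ht⟩ := linForm_proportional_of_two_points hyne hc h1 h2 h3 h4
    have hdvd : ∀ q ∈ ({y (k + 6), z k} + {y (k + 2), z (k + 1)} : Multiset (Curve F)),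
        lineForm (L (3 * k + 6)) ∈ pointIdeal q.1 := fun q hq => by
      rw [lineForm, ht, linForm_smul]
      exact Ideal.mul_mem_left _ _ (hcm q hq)
    exact ⟨hdvd _ (by simp), hdvd _ (by simp)⟩
  have hzm : ∀ k, (z k : P2) = meet L (3 * k + 3) (3 * k + 6) := fun k => by
    have h1 := (hline (k + 6)).2
    rw [e61, show 3 * (k + 6) + 6 = 3 * k + 3 by clear * -; revert k; decide] at h1
    exact eq_meet_of_mem hL (by clear * -; revert k; decide) h1 (hline k).1
  have hv : VanishesOnResidual L F := by
    rw [vanishesOnResidual_iff]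
    intro i
    constructor
    · have := (y (5 * i)).2
      rwa [hy, innerPoints_apply, show 3 * (5 * i) = i by clear * -; revert i; decide] at this
    · have := (z (5 * i + 6)).2
      rwa [hzm, show 3 * (5 * i + 6) + 3 = i by clear * -; revert i; decide,
        show 3 * (5 * i + 6) + 6 = i + 3 by clear * -; revert i; decide] at this
  exact ⟨hL, isAdjointQuartic_of_vanishes h hL hv,
    (linEquiv_iff_isEff h hL hv 0 hy (hzm 0)).2 (hz 0)⟩

theorem linesOfPoints_mem_adjFibre (h : IsSmoothQuartic F) (hη : IsThetaChar F η)
    (heven : Even (h0 F η)) {x : Fin 7 → P2} (hx : x ∈ scorzaHeptagons F η) :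
    linesOfPoints x ∈ adjFibre F η := by
  obtain ⟨⟨y, hT, hy⟩, hx⟩ := hx
  refine mem_adjFibre_of_scorza h hη heven hx.2 (y := y) (fun k => ?_) hT
  rw [innerPoints_linesOfPoints hx, hy]

theorem invOn_linesOfPoints_innerPoints :
    Set.InvOn linesOfPoints innerPoints (adjFibre F η) (scorzaHeptagons F η) :=
  ⟨fun _ hL => linesOfPoints_innerPoints hL.1, fun _ hx => innerPoints_linesOfPoints hx.2⟩

theorem bijOn_innerPoints (h : IsSmoothQuartic F) (hη : IsThetaChar F η)
    (heven : Even (h0 F η)) :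
    Set.BijOn innerPoints (adjFibre F η) (scorzaHeptagons F η) :=
  invOn_linesOfPoints_innerPoints.bijOn (fun _ hL => innerPoints_mem_scorzaHeptagons h hL)
    fun _ hx => linesOfPoints_mem_adjFibre h hη heven hx

end

/-! ### Morphisms given by cross products -/

/-- One triple of polynomials, the cross product, works on all of `S`: it is nonzero exactly because
the two points are distinct. -/
theorem isMorphismOn_cross {S : Set (Fin 7 → P2)} {f : (Fin 7 → P2) → Fin 7 → P2}
    (a b : Fin 7 → Fin 7)
    (hf : ∀ x ∈ S, ∀ k, x (a k) ≠ x (b k) ∧ f x k = (x (a k)).cross (x (b k))) :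
    IsMorphismOn S f := by
  intro x hx k
  have hq : ∀ v : Fin 7 → Fin 3 → ℂ, evalTriple (crossProduct
      (fun j => (X (a k, j) : MvPolynomial (Fin 7 × Fin 3) ℂ)) fun j => X (b k, j)) v =
      crossProduct (v (a k)) (v (b k)) := fun v => by
    ext j
    fin_cases j <;> simp [evalTriple, cross_apply]
  refine ⟨crossProduct (fun j => X (a k, j)) fun j => X (b k, j), fun v hv => ?_,
    fun y hy v hv => ?_⟩
  · rw [hq]
    obtain ⟨ha, hva⟩ := hv (a k)
    obtain ⟨hb, hvb⟩ := hv (b k)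
    rw [Ne, ← Projectivization.mk_eq_mk_iff_crossProduct_eq_zero ha hb, hva, hvb]
    exact (hf x hx k).1
  · obtain ⟨ha, hva⟩ := hv (a k)
    obtain ⟨hb, hvb⟩ := hv (b k)
    have hne := (hf y hy k).1
    rw [(hf y hy k).2]
    rw [← hva, ← hvb] at hne ⊢
    simp only [hq]
    intro hq0
    exact Projectivization.cross_mk_of_ne ha hb hne

theorem isMorphismOn_innerPoints {F : Form} {η : Divisor F} :
    IsMorphismOn (adjFibre F η) innerPoints :=
  isMorphismOn_cross (fun k => 3 * k) (fun k => 3 * k + 2) fun _ hL k =>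
    ⟨(heptagon_injective hL.1).ne (by revert k; decide), innerPoints_apply _ k⟩

theorem isMorphismOn_linesOfPoints {F : Form} {η : Divisor F} :
    IsMorphismOn (scorzaHeptagons F η) linesOfPoints :=
  isMorphismOn_cross (fun k => 5 * k) (fun k => 5 * k + 4) fun x hx k =>
    ⟨(mem_linesDomain_iff x).1 hx.2.1 (5 * k), linesOfPoints_apply x k⟩

/-! ### The classical topology of the projective plane -/

/-- The representative of a point of the plane whose `k`-th coordinate is `c`. -/
noncomputable def normLift (c : ℂ) (k : Fin 3) (p : P2) : Fin 3 → ℂ := (c / p.rep k) • p.rep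

theorem exists_rep_mk (u : Fin 3 → ℂ) (hu : u ≠ 0) :
    ∃ a : ℂ, a ≠ 0 ∧ (Projectivization.mk ℂ u hu).rep = a • u := by
  obtain ⟨a, ha⟩ := Projectivization.exists_smul_eq_mk_rep ℂ u hu
  exact ⟨a, a.ne_zero, ha.symm⟩

theorem normLift_mk (c : ℂ) (k : Fin 3) (u : Fin 3 → ℂ) (hu : u ≠ 0) :
    normLift c k (Projectivization.mk ℂ u hu) = (c / u k) • u := by
  obtain ⟨a, ha, hau⟩ := exists_rep_mk u hu
  rw [normLift, hau, Pi.smul_apply, smul_smul, smul_eq_mul]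
  congr 1
  field_simp

theorem normLift_apply {c : ℂ} {k : Fin 3} {p : P2} (hk : p.rep k ≠ 0) :
    normLift c k p k = c := by
  rw [normLift, Pi.smul_apply, smul_eq_mul, div_mul_cancel₀ _ hk]

theorem mk_normLift {c : ℂ} (hc : c ≠ 0) {k : Fin 3} {p : P2} (hk : p.rep k ≠ 0) :
    ∃ h : normLift c k p ≠ 0, Projectivization.mk ℂ (normLift c k p) h = p := by
  have h : normLift c k p ≠ 0 := smul_ne_zero (div_ne_zero hc hk) p.rep_nonzero
  refine ⟨h, ?_⟩
  conv_rhs => rw [← p.mk_rep]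
  rw [Projectivization.mk_eq_mk_iff']
  exact ⟨_, rfl⟩

/-- The choice `rep` has no continuity, but fixing the `k`-th coordinate removes the dependence on
it. Pulled back to nonzero vectors, the lift is `u ↦ (c / u k) • u`. -/
theorem isOpen_normLift (c : ℂ) (k : Fin 3) {T : Set (Fin 3 → ℂ)} (hT : IsOpen T) :
    IsOpen {p : P2 | p.rep k ≠ 0 ∧ normLift c k p ∈ T} := by
  rw [isOpen_coinduced]
  have hset : Projectivization.mk' ℂ ⁻¹' {p : P2 | p.rep k ≠ 0 ∧ normLift c k p ∈ T} =
      {u : {v : Fin 3 → ℂ // v ≠ 0} | u.1 k ≠ 0} ∩ (fun u => (c / u.1 k) • u.1) ⁻¹' T := by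
    ext ⟨u, hu⟩
    obtain ⟨a, ha, hau⟩ := exists_rep_mk u hu
    simp only [Set.mem_preimage, Set.mem_ofPred_eq, Projectivization.mk'_eq_mk, Set.mem_inter_iff,
      normLift_mk, hau, Pi.smul_apply, smul_eq_mul, ne_eq, mul_eq_zero, ha, false_or]
  rw [hset]
  have hcont : Continuous fun u : {v : Fin 3 → ℂ // v ≠ 0} => u.1 k :=
    (continuous_apply k).comp continuous_subtype_val
  refine ContinuousOn.isOpen_inter_preimage ?_ (isOpen_ne_fun hcont continuous_const) hT
  exact (continuousOn_const.div hcont.continuousOn fun _ h => h).smul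
    continuous_subtype_val.continuousOn

theorem continuousAt_normLift (c : ℂ) {k : Fin 3} {p : P2} (hk : p.rep k ≠ 0) :
    ContinuousAt (normLift c k) p := by
  intro T hT
  obtain ⟨T', hTT', hT', hp⟩ := mem_nhds_iff.1 hT
  rw [mem_map]
  exact mem_of_superset ((isOpen_normLift c k hT').mem_nhds ⟨hk, hp⟩) fun q hq => hTT' hq.2

theorem eventually_rep_ne_zero {k : Fin 3} {p : P2} (hk : p.rep k ≠ 0) :
    ∀ᶠ q in 𝓝 p, q.rep k ≠ 0 :=
  mem_of_superset ((isOpen_normLift 1 k isOpen_univ).mem_nhds ⟨hk, trivial⟩) fun _ hq => hq.1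

theorem exists_rep_apply_ne_zero (p : P2) : ∃ k, p.rep k ≠ 0 := Function.ne_iff.1 p.rep_nonzero

/-- Any function inverse to the choice of coordinates is continuous where it should be. -/
theorem continuousAt_of_eq_mk {g : (Fin 3 → ℂ) → P2}
    (hg : ∀ u (hu : u ≠ 0), g u = Projectivization.mk ℂ u hu) {u : Fin 3 → ℂ} (hu : u ≠ 0) :
    ContinuousAt g u := by
  have hopen : IsOpen {v : Fin 3 → ℂ | v ≠ 0} := isOpen_ne
  refine (hopen.isOpenEmbedding_subtypeVal.continuousAt_iff (g := g) (x := ⟨u, hu⟩)).1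
    (Continuous.continuousAt ?_)
  have : g ∘ Subtype.val = Projectivization.mk' ℂ := funext fun v => hg v.1 v.2
  exact this ▸ continuous_coinduced_rng

theorem continuousAt_cross {p q : P2} (hpq : p ≠ q) :
    ContinuousAt (fun x : P2 × P2 => x.1.cross x.2) (p, q) := by
  classical
  obtain ⟨k, hk⟩ := exists_rep_apply_ne_zero p
  obtain ⟨l, hl⟩ := exists_rep_apply_ne_zero q
  let g : (Fin 3 → ℂ) → P2 := fun u => if h : u ≠ 0 then Projectivization.mk ℂ u h else p
  have hg : ∀ u (hu : u ≠ 0), g u = Projectivization.mk ℂ u hu := fun u hu => dif_pos hu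
  let φ : P2 × P2 → Fin 3 → ℂ := fun x => crossProduct (normLift 1 k x.1) (normLift 1 l x.2)
  have hφ : ContinuousAt φ (p, q) := by
    have h1 : ContinuousAt (fun x : P2 × P2 => normLift 1 k x.1) (p, q) :=
      ContinuousAt.comp (f := Prod.fst) (continuousAt_normLift 1 hk) continuousAt_fst
    have h2 : ContinuousAt (fun x : P2 × P2 => normLift 1 l x.2) (p, q) :=
      ContinuousAt.comp (f := Prod.snd) (continuousAt_normLift 1 hl) continuousAt_snd
    have h1' := continuousAt_pi.1 h1
    have h2' := continuousAt_pi.1 h2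
    rw [continuousAt_pi]
    intro j
    fin_cases j
    · exact ((h1' 1).mul (h2' 2)).sub ((h1' 2).mul (h2' 1))
    · exact ((h1' 2).mul (h2' 0)).sub ((h1' 0).mul (h2' 2))
    · exact ((h1' 0).mul (h2' 1)).sub ((h1' 1).mul (h2' 0))
  have hcross : ∀ x : P2 × P2, x.1.rep k ≠ 0 → x.2.rep l ≠ 0 → φ x ≠ 0 →
      g (φ x) = x.1.cross x.2 := by
    rintro ⟨a, b⟩ ha hb hx
    obtain ⟨hu, hua⟩ := mk_normLift one_ne_zero ha
    obtain ⟨hw, hwb⟩ := mk_normLift one_ne_zero hb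
    rw [hg _ hx]
    conv_rhs => rw [← hua, ← hwb]
    exact (Projectivization.cross_mk_of_cross_ne_zero hu hw hx).symm
  have hne : φ (p, q) ≠ 0 := by
    obtain ⟨hu, hua⟩ := mk_normLift one_ne_zero hk
    obtain ⟨hw, hwb⟩ := mk_normLift one_ne_zero hl
    intro h0
    exact hpq (hua ▸ hwb ▸ (Projectivization.mk_eq_mk_iff_crossProduct_eq_zero hu hw).2 h0)
  refine ((ContinuousAt.comp (continuousAt_of_eq_mk hg hne) hφ).congr ?_)
  have e1 : ∀ᶠ x : P2 × P2 in 𝓝 (p, q), x.1.rep k ≠ 0 :=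
    continuousAt_fst.eventually (eventually_rep_ne_zero hk)
  have e2 : ∀ᶠ x : P2 × P2 in 𝓝 (p, q), x.2.rep l ≠ 0 :=
    continuousAt_snd.eventually (eventually_rep_ne_zero hl)
  filter_upwards [e1, e2, hφ.eventually_ne hne] with x h1 h2 h3 using hcross x h1 h2 h3

theorem continuousAt_linesOfPoints {x : Fin 7 → P2} (hx : x ∈ linesDomain) :
    ContinuousAt linesOfPoints x := by
  rw [continuousAt_pi]
  intro i
  have hne := (mem_linesDomain_iff x).1 hx (5 * i)
  have heq : (fun y => linesOfPoints y i) =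
      (fun z : P2 × P2 => z.1.cross z.2) ∘ fun y => (y (5 * i), y (5 * i + 4)) :=
    funext fun y => linesOfPoints_apply y i
  rw [heq]
  exact ContinuousAt.comp (f := fun y : Fin 7 → P2 => (y (5 * i), y (5 * i + 4)))
    (continuousAt_cross hne)
    ((continuous_apply (5 * i)).prodMk (continuous_apply (5 * i + 4))).continuousAt

/-- Near homogeneous coordinates of `L`, all tuples of lines have homogeneous coordinates with
prescribed nonzero entries. -/
theorem exists_isOpen_isLift {v : Fin 7 → Fin 3 → ℂ} {L : Fin 7 → P2} (hv : IsLift v L)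
    {k : Fin 7 → Fin 3} (hk : ∀ i, v i (k i) ≠ 0) {P : (Fin 7 → Fin 3 → ℂ) → Prop}
    (hP : ∀ᶠ w in 𝓝 v, P w) : ∃ U : Set (Fin 7 → P2), IsOpen U ∧ L ∈ U ∧
      ∀ M ∈ U, ∃ w, P w ∧ IsLift w M ∧ ∀ i, w i (k i) = v i (k i) := by
  have hrep : ∀ i, (L i).rep (k i) ≠ 0 := fun i => by
    obtain ⟨hi, hL⟩ := hv i
    obtain ⟨a, ha, hau⟩ := exists_rep_mk (v i) hi
    rw [← hL, hau, Pi.smul_apply, smul_eq_mul]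
    exact mul_ne_zero ha (hk i)
  let σ : (Fin 7 → P2) → Fin 7 → Fin 3 → ℂ := fun M i => normLift (v i (k i)) (k i) (M i)
  have hσL : σ L = v := by
    ext1 i
    obtain ⟨hi, hL⟩ := hv i
    simp only [σ]
    rw [← hL, normLift_mk, div_self (hk i), one_smul]
  have hσ : ContinuousAt σ L := by
    rw [continuousAt_pi]
    intro i
    exact ContinuousAt.comp (f := fun M : Fin 7 → P2 => M i) (continuousAt_normLift _ (hrep i))
      (continuous_apply i).continuousAt
  have h1 : ∀ᶠ M in 𝓝 L, P (σ M) := hσ.eventually (hσL.symm ▸ hP)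
  have h2 : ∀ᶠ M in 𝓝 L, ∀ i, (M i).rep (k i) ≠ 0 := eventually_all.2 fun i =>
    (continuous_apply (A := fun _ : Fin 7 => P2) i).continuousAt.eventually
      (eventually_rep_ne_zero (hrep i))
  obtain ⟨U, hU, hUo, hLU⟩ := mem_nhds_iff.1 (h1.and h2)
  exact ⟨U, hUo, hLU, fun M hM => ⟨σ M, (hU hM).1, fun i => mk_normLift (hk i) ((hU hM).2 i),
    fun i => normLift_apply ((hU hM).2 i)⟩⟩

/-! ### Heptagons with nonsingular differential are isolated -/

theorem exists_finset_coeff_eq_zero {V : Type*} [AddCommGroup V] [Module ℂ V]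
    [FiniteDimensional ℂ V] (f : V →ₗ[ℂ] Form) :
    ∃ S : Finset (Fin 3 →₀ ℕ), ∀ u, ∀ m ∉ S, (f u).coeff m = 0 := by
  classical
  let b := Module.finBasis ℂ V
  refine ⟨Finset.univ.biUnion fun i => (f (b i)).support, fun u m hm => ?_⟩
  rw [← b.sum_repr u, map_sum, coeff_sum]
  refine Finset.sum_eq_zero fun i _ => ?_
  rw [map_smul, coeff_smul, notMem_support_iff.1 fun hi =>
    hm (Finset.mem_biUnion.2 ⟨i, Finset.mem_univ i, hi⟩), smul_zero]

theorem IsLift.unique {w : Fin 7 → Fin 3 → ℂ} {M N : Fin 7 → P2} (hM : IsLift w M)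
    (hN : IsLift w N) : M = N := by
  ext1 i
  obtain ⟨_, hi⟩ := hM i
  obtain ⟨_, hi'⟩ := hN i
  exact hi.symm.trans hi'

/-- A quartic proportional to `F` has vanishing `2 × 2`-minors with `F`. -/
theorem coeff_mul_coeff_comm {F G : Form} {c : ℂ} (h : G = C c * F) (m m₀ : Fin 3 →₀ ℕ) :
    F.coeff m₀ * G.coeff m - F.coeff m * G.coeff m₀ = 0 := by
  rw [h, coeff_C_mul, coeff_C_mul]
  ring

/-- The map `Ψ` records the minors of `Φ w` against `F` and the normalized coordinates. A kernel
vector of its derivative has `dΦ u` proportional to `Φ v`, so each `u i` is a multiple of `v i`, and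
the normalization makes it zero. An injective derivative isolates `v` in its fibre, and every
normalized lift with adjoint `F` near `v` lies in that fibre. -/
theorem eventually_eq_of_nonsingular {F : Form} {L : Fin 7 → P2} (hA : IsAdjointQuartic L F)
    {v : Fin 7 → Fin 3 → ℂ} {Φ : (Fin 7 → Fin 3 → ℂ) → Form}
    {dΦ : (Fin 7 → Fin 3 → ℂ) →ₗ[ℂ] Form} (hv : IsLift v L)
    (hΦ : ∀ᶠ w in 𝓝 v, ∃ M : Fin 7 → P2, IsLift w M ∧ IsAdjointQuartic M (Φ w))
    (hd : ∀ m : Fin 3 →₀ ℕ, HasFDerivAt (fun w => (Φ w).coeff m)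
      (LinearMap.toContinuousLinearMap (lcoeff ℂ m ∘ₗ dΦ)) v)
    (hker : ∀ u : Fin 7 → Fin 3 → ℂ, (∃ c : ℂ, dΦ u = C c * Φ v) → ∀ i, ∃ a : ℂ, u i = a • v i)
    {k : Fin 7 → Fin 3} (hk : ∀ i, v i (k i) ≠ 0) :
    ∀ᶠ w in 𝓝 v, ∀ M, IsLift w M → IsAdjointQuartic M F → (∀ i, w i (k i) = v i (k i)) →
      w = v := by
  classical
  obtain ⟨S₀, hS₀⟩ := exists_finset_coeff_eq_zero dΦ
  obtain ⟨m₀, hm₀⟩ := ne_zero_iff.1 hA.2.1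
  -- Finitely many coefficients suffice for injectivity: outside `S` both `F` and the image of `dΦ`
  -- have none.
  let S := S₀ ∪ F.support
  have hprop : ∀ w M N, IsLift w M → IsAdjointQuartic M F → IsLift w N →
      IsAdjointQuartic N (Φ w) → ∃ c : ℂ, Φ w = C c * F := by
    intro w M N hM hMF hN hNΦ
    obtain rfl := hM.unique hN
    exact hMF.2.2.2 _ hNΦ.1 hNΦ.2.2.1
  obtain ⟨c₀, hc₀, hΦv⟩ : ∃ c₀ : ℂ, c₀ ≠ 0 ∧ Φ v = C c₀ * F := by
    obtain ⟨M, hM, hMΦ⟩ := hΦ.self_of_nhds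
    obtain ⟨c, hc⟩ := hprop v L M hv hA hM hMΦ
    refine ⟨c, ?_, hc⟩
    rintro rfl
    exact hMΦ.2.1 (by rw [hc, map_zero, zero_mul])
  let Ψ : (Fin 7 → Fin 3 → ℂ) → (S → ℂ) × (Fin 7 → ℂ) := fun w =>
    (fun m => F.coeff m₀ * (Φ w).coeff m - F.coeff m * (Φ w).coeff m₀, fun i => w i (k i))
  let dl : (m : Fin 3 →₀ ℕ) → (Fin 7 → Fin 3 → ℂ) →L[ℂ] ℂ := fun m =>
    LinearMap.toContinuousLinearMap (lcoeff ℂ m ∘ₗ dΦ)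
  have hdl : ∀ m u, dl m u = (dΦ u).coeff m := fun m u => rfl
  let ev : Fin 7 → (Fin 7 → Fin 3 → ℂ) →L[ℂ] ℂ := fun i =>
    (ContinuousLinearMap.proj (R := ℂ) (φ := fun _ : Fin 3 => ℂ) (k i)).comp
      (ContinuousLinearMap.proj (R := ℂ) (φ := fun _ : Fin 7 => Fin 3 → ℂ) i)
  let dΨ : (Fin 7 → Fin 3 → ℂ) →L[ℂ] (S → ℂ) × (Fin 7 → ℂ) :=
    (ContinuousLinearMap.pi fun m : S => F.coeff m₀ • dl m - F.coeff m • dl m₀).prod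
      (ContinuousLinearMap.pi ev)
  have hΨ : HasFDerivAt Ψ dΨ v := by
    refine HasFDerivAt.prodMk (hasFDerivAt_pi.2 fun m => ?_) (hasFDerivAt_pi.2 fun i => ?_)
    · exact ((hd m).const_mul _).sub ((hd m₀).const_mul _)
    · exact (ev i).hasFDerivAt
  have hinj : LinearMap.ker (dΨ : (Fin 7 → Fin 3 → ℂ) →ₗ[ℂ] (S → ℂ) × (Fin 7 → ℂ)) = ⊥ := by
    rw [LinearMap.ker_eq_bot']
    intro u hu
    have hu1 : ∀ m ∈ S, F.coeff m₀ * (dΦ u).coeff m = F.coeff m * (dΦ u).coeff m₀ :=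
      fun m hm => sub_eq_zero.1 (congrFun (congrArg Prod.fst hu) ⟨m, hm⟩)
    have hu2 : ∀ i, u i (k i) = 0 := fun i => congrFun (congrArg Prod.snd hu) i
    have hdu : dΦ u = C ((dΦ u).coeff m₀ / F.coeff m₀ / c₀) * Φ v := by
      ext m
      rw [hΦv, coeff_C_mul, coeff_C_mul]
      by_cases hm : m ∈ S
      · have := hu1 m hm
        field_simp
        linear_combination this
      · have hm' := Finset.notMem_union.1 hm
        rw [hS₀ u m hm'.1, notMem_support_iff.1 hm'.2, mul_zero, mul_zero]
    ext1 i
    obtain ⟨a, ha⟩ := hker u ⟨_, hdu⟩ i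
    have h0 := hu2 i
    rw [ha, Pi.smul_apply, smul_eq_mul, mul_eq_zero, or_iff_left (hk i)] at h0
    rw [ha, h0, zero_smul, Pi.zero_apply]
  obtain ⟨K, -, hK⟩ := LinearMap.exists_antilipschitzWith _ hinj
  have hne := hΨ.eventually_ne (c := Ψ v) ⟨K, hK⟩
  rw [eventually_nhdsWithin_iff] at hne
  filter_upwards [hne, hΦ] with w hw hwΦ M hM hMF hwk
  obtain ⟨N, hN, hNΦ⟩ := hwΦ
  obtain ⟨c, hc⟩ := hprop w M N hM hMF hN hNΦ
  by_contra hwv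
  refine hw hwv (Prod.ext (funext fun m => ?_) (funext hwk))
  exact (coeff_mul_coeff_comm hc m m₀).trans (coeff_mul_coeff_comm hΦv m m₀).symm

theorem exists_isOpen_of_nonsingular {F : Form} {L : Fin 7 → P2} (hA : IsAdjointQuartic L F)
    (hns : AdjDifferentialNonsingular L) :
    ∃ U : Set (Fin 7 → P2), IsOpen U ∧ L ∈ U ∧ ∀ M ∈ U, IsAdjointQuartic M F → M = L := by
  obtain ⟨v, Φ, dΦ, hv, hΦ, hd, hker⟩ := hns
  have hk : ∀ i, ∃ j, v i j ≠ 0 := fun i => Function.ne_iff.1 (hv i).1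
  choose k hk using hk
  obtain ⟨U, hUo, hLU, hU⟩ := exists_isOpen_isLift hv hk
    (eventually_eq_of_nonsingular hA hv hΦ hd hker hk)
  refine ⟨U, hUo, hLU, fun M hM hMF => ?_⟩
  obtain ⟨w, hw, hwM, hwk⟩ := hU M hM
  obtain rfl := hw M hwM hMF hwk
  exact hwM.unique hv

/-- `J` is continuous at `I(L)` and sends nearby points of `T₇ ∩ J⁻¹(ℋ)` to heptagons with adjoint
quartic `F` near `L`. Those equal `L`, and applying `I` recovers the point. -/
theorem innerPoints_mem_isolatedPoints {F : Form} (h : IsSmoothQuartic F) {η : Divisor F}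
    (hη : IsThetaChar F η) (heven : Even (h0 F η)) {L : Fin 7 → P2} (hL : L ∈ adjFibre F η)
    (hns : AdjDifferentialNonsingular L) :
    innerPoints L ∈ isolatedPoints (scorzaHeptagons F η) := by
  obtain ⟨U, hUo, hLU, hU⟩ := exists_isOpen_of_nonsingular hL.2.1 hns
  have hLL := linesOfPoints_innerPoints hL.1
  have hmem : linesOfPoints ⁻¹' U ∈ 𝓝 (innerPoints L) :=
    continuousAt_linesOfPoints (innerPoints_mem_linesDomain hL.1)
      (hUo.mem_nhds (hLL.symm ▸ hLU))
  obtain ⟨V, hVU, hVo, hLV⟩ := mem_nhds_iff.1 hmem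
  refine ⟨V, hVo, Set.Subset.antisymm ?_ ?_⟩
  · rintro x ⟨hxV, hx⟩
    have := hU _ (hVU hxV) (linesOfPoints_mem_adjFibre h hη heven hx).2.1
    rw [Set.mem_singleton_iff, ← this, innerPoints_linesOfPoints hx.2]
  · rintro x rfl
    exact ⟨hLV, innerPoints_mem_scorzaHeptagons h hL⟩

end HeptagonAdjoint

theorem mainTheorem6 (F : Form) (hF : F.IsHomogeneous 4) (hsmooth : IsSmoothCurve F)
    (η : Divisor F) (hη : IsThetaChar F η) (heven : Even (h0 F η)) :
    Set.BijOn innerPoints (adjFibre F η) (scorzaHeptagons F η) ∧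
    Set.InvOn linesOfPoints innerPoints (adjFibre F η) (scorzaHeptagons F η) ∧
    IsMorphismOn (adjFibre F η) innerPoints ∧
    IsMorphismOn (scorzaHeptagons F η) linesOfPoints ∧
    ((isolatedPoints (scorzaHeptagons F η)).encard ≤ 336 →
      {L ∈ adjFibre F η | AdjDifferentialNonsingular L}.encard ≤ 336) := by
  have h : IsSmoothQuartic F := ⟨hF, hsmooth⟩
  have hbij := bijOn_innerPoints h hη heven
  refine ⟨hbij, invOn_linesOfPoints_innerPoints, isMorphismOn_innerPoints,
    isMorphismOn_linesOfPoints, fun hle => le_trans ?_ hle⟩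
  exact Set.encard_le_encard_of_injOn
    (fun L hL => innerPoints_mem_isolatedPoints h hη heven hL.1 hL.2)
    (hbij.injOn.mono fun _ hL => hL.1)
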